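/- Let $s\in\mathbb N$ and let $a_j,b_j\in\mathbb Z$ with $(a_j,b_j)\ne(0,0)$ $(1\le j\le s)$. Put $$q_0=\min_{(c,d)\in\mathbb Z^2\setminus\{(0,0)\}}\operatorname{card}\{1\le j\le s: ca_j+db_j\ne 0\},$$ and suppose that $q_0\ge 15$ and $k\in\{0,1\}$. Write $e(z)=e^{2\pi i z}$. For real $P\geq 1$ let $$f_k(\alpha)=\sum_{k\le x\le P}e(\alpha x^4)\quad (x\in\mathbb Z),\qquad \mathscr F_k(\alpha,\beta)=\prod_{j=1}^s f_k(a_j\alpha+b_j\beta),$$ and let $\mathfrak W=\mathfrak W(P)$ be the union of the sets $$\{(\alpha,\beta)\in[0,1]^2:\ |q\alpha-a|\le P^{-3},\ |q\beta-b|\le P^{-3}\}$$ over all integers $q,a,b$ with $1\le q\le P$, $0\le a,b\le q$ and $\gcd(a,b,q)=1$. Let $M(q)$ denote the number of $\mathbf x\in(\mathbb Z/q\mathbb Z)^s$ with $\sum_j a_jx_j^4=\sum_j b_jx_j^4=0$. Then the limits $$\mathfrak J=\lim_{T\to\infty}\int_{-T}^T\int_{-T}^T\prod_{j=1}^s\int_{-1}^1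 e\big((a_j\alpha+b_j\beta)t_j^4\big)\,dt_j\,d\alpha\,d\beta,\qquad \mathfrak s_p=\lim_{h\to\infty}p^{(2-s)h}M(p^h)\quad(p\text{ prime})$$ exist, the product $\mathfrak S=\prod_p\mathfrak s_p$ converges absolutely (that is, $\sum_p|\mathfrak s_p-1|<\infty$), and, as $P\to\infty$ through real values, $$\iint_{\mathfrak W}\mathscr F_k(\alpha,\beta)\,d\alpha\,d\beta = 2^{-s}P^{s-8}\,\mathfrak S\,\mathfrak J+O\big(P^{s-8-1/32}\big),$$ where the implicit constant may depend on $s$ and on the coefficients $a_j,b_j$. -/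

import Mathlib

open MeasureTheory Filter Topology Asymptotics

namespace QuarticPairs

/-- `e(z) = exp(2πiz)`. -/
noncomputable def e (z : ℝ) : ℂ := Complex.exp (2 * Real.pi * Complex.I * z)

/-- `q₀(a,b)`: the least number of indices `j` with `c a_j + d b_j ≠ 0`, over all `(c,d) ≠ (0,0)`
in `ℤ²`. -/
noncomputable def q0 {s : ℕ} (a b : Fin s → ℤ) : ℕ :=
  sInf {n : ℕ | ∃ c d : ℤ, (c, d) ≠ (0, 0) ∧
    n = (Finset.univ.filter fun j : Fin s => c * a j + d * b j ≠ 0).card}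

/-- The quartic Weyl sum `f_k(α) = ∑_{k ≤ x ≤ P} e(α x⁴)`. -/
noncomputable def weylSum (k : ℕ) (P α : ℝ) : ℂ :=
  ∑ x ∈ Finset.Icc k ⌊P⌋₊, e (α * (x : ℝ) ^ 4)

/-- The generating function `𝓕_k(α,β) = ∏_j f_k(a_j α + b_j β)`. -/
noncomputable def genFun {s : ℕ} (a b : Fin s → ℤ) (k : ℕ) (P : ℝ) (α β : ℝ) : ℂ :=
  ∏ j, weylSum k P (a j * α + b j * β)

/-- The major arcs `𝔚`: the union of the rectangles `𝔚(q,u,v)` with `1 ≤ q ≤ P`,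
`0 ≤ u, v ≤ q` and `(u,v,q) = 1`. -/
def majorArcs (P : ℝ) : Set (ℝ × ℝ) :=
  {x | x ∈ Set.Icc (0 : ℝ) 1 ×ˢ Set.Icc (0 : ℝ) 1 ∧
    ∃ q u v : ℕ, 1 ≤ q ∧ (q : ℝ) ≤ P ∧ u ≤ q ∧ v ≤ q ∧ Nat.gcd (Nat.gcd u v) q = 1 ∧
      |q * x.1 - u| ≤ P ^ (-3 : ℤ) ∧ |q * x.2 - v| ≤ P ^ (-3 : ℤ)}

/-- The truncated singular integral
`∫_{-T}^T ∫_{-T}^T ∏_j ∫_{-1}^1 e((a_j α + b_j β) t⁴) dt dα dβ`. -/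
noncomputable def truncSingularIntegral {s : ℕ} (a b : Fin s → ℤ) (T : ℝ) : ℂ :=
  ∫ β in (-T)..T, ∫ α in (-T)..T,
    ∏ j, ∫ t in (-1 : ℝ)..1, e ((a j * α + b j * β) * t ^ 4)

/-- The singular integral, the limit of the truncated ones as `T → ∞`. -/
noncomputable def singularIntegral {s : ℕ} (a b : Fin s → ℤ) : ℂ :=
  limUnder atTop (truncSingularIntegral a b)

/-- `M(q)`: the number of solutions of the pair of equations in `(ℤ/qℤ)^s`. -/
noncomputable def numSolMod {s : ℕ} (a b : Fin s → ℤ) (q : ℕ) : ℕ :=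
  Nat.card {x : Fin s → ZMod q //
    ∑ j, (a j : ZMod q) * x j ^ 4 = 0 ∧ ∑ j, (b j : ZMod q) * x j ^ 4 = 0}

/-- The normalised count `p^{(2-s)h} M(p^h)`. -/
noncomputable def normalizedCount {s : ℕ} (a b : Fin s → ℤ) (p h : ℕ) : ℝ :=
  (p : ℝ) ^ ((2 - (s : ℤ)) * (h : ℤ)) * numSolMod a b (p ^ h)

/-- The `p`-adic density, the limit of the normalised counts as `h → ∞`. -/
noncomputable def padicDensity {s : ℕ} (a b : Fin s → ℤ) (p : ℕ) : ℝ :=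
  limUnder atTop (normalizedCount a b p)

/-- The singular series, the product of the `p`-adic densities over all primes. -/
noncomputable def singularSeries {s : ℕ} (a b : Fin s → ℤ) : ℝ :=
  ∏' p : Nat.Primes, padicDensity a b p

end QuarticPairs

namespace QuarticPairs

/-! ### The additive character `e` -/

/-! The proof is the circle method on wide major arcs. The usual approximation of `f(a/q + ξ)` by
`q⁻¹ S(q,a)` times an integral has error `O(q(1 + P⁴|ξ|))` (`norm_weylSum_sub_main_le`). With `q` as
large as `P` and `|ξ|` as large as `1/(qP³)` this is no better than trivial. It is therefore used
only on small inner arcs, `q ≤ R` and distance at most `R/P⁴` from the centre, with `R = P^{1/8}`.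
Elsewhere an upper bound suffices.

That bound is `f(a/q + ξ) ≪ P (q(1 + P⁴|ξ|))^{-6/25}` on the whole of each wide arc
(`exists_weylSum_bound`). It comes from completion: `f` is cut into boundedly many blocks, each
expanded into the sums `S(q,a,b)` times `∑ e(ξn⁴ - bn/q)`. On a block all but two frequencies `b`
fall to the Kusmin–Landau inequality, and the remaining two to a van der Corput estimate. The
arithmetic input is `S(q,a,b) ≪ q^{151/200}` for `(a,q) = 1` (`exists_quarticSum_bound`), proved by
Mordell's fourth moment for odd primes, stationary phase for prime powers, and multiplicativity. The
exponent `6/25` lies just below `1 - 151/200 = 49/200`, itself just below the natural `1/4`.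

The condition `q₀ ≥ 15` means that every form `a_j x + b_j y` is independent of at least 15 others.
Hence a point cannot make many forms small at once, either in absolute value
(`exists_prod_forms_ge`) or in the sense that their values at `(u,v)/q` have small denominators
(`pow_fifteen_dvd`). Multiplying the one-variable bounds gives decay `(q(1 + P⁴‖x‖))^{-18/5}` for
the product, as `15 · 6/25 = 18/5`. The exponent exceeds 3, which makes the sum over `q` with `q²`
centres converge, and exceeds 2, which makes the plane integral converge, both with a power to
spare. This yields the singular integral, the absolutely convergent singular series and a saving
`R^{-1/2}` outside the inner arcs (`exists_outer_bound`).

Finally, summing over all fractions of denominator `q` counts solutions modulo `q`, so Möbius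
inversion and the Chinese remainder theorem turn the series into the product of the local densities
(`hasProd_padicDensity`). -/

lemma e_eq_exp_mul_I (z : ℝ) : e z = Complex.exp (((2 * Real.pi * z : ℝ) : ℂ) * Complex.I) := by
  unfold e; congr 1; push_cast; ring

@[simp] lemma norm_e (z : ℝ) : ‖e z‖ = 1 := by
  rw [e_eq_exp_mul_I, Complex.norm_exp_ofReal_mul_I]

lemma e_add (x y : ℝ) : e (x + y) = e x * e y := by
  unfold e; rw [← Complex.exp_add]; congr 1; push_cast; ring

@[simp] lemma e_zero : e 0 = 1 := by simp [e]

lemma e_int (n : ℤ) : e n = 1 := by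
  unfold e
  rw [Complex.exp_eq_one_iff]
  exact ⟨n, by push_cast; ring⟩

lemma e_add_int (x : ℝ) (n : ℤ) : e (x + n) = e x := by rw [e_add, e_int, mul_one]

lemma e_congr {x y : ℝ} (n : ℤ) (h : x = y + n) : e x = e y := by rw [h, e_add_int]

lemma e_neg (x : ℝ) : e (-x) = (starRingEnd ℂ) (e x) := by
  unfold e
  rw [← Complex.exp_conj]
  congr 1
  simp [Complex.conj_ofNat]

@[fun_prop] lemma continuous_e : Continuous e := by unfold e; fun_prop

lemma e_eq_cos_sin (z : ℝ) :
    e z = (Real.cos (2 * Real.pi * z) : ℂ) + (Real.sin (2 * Real.pi * z) : ℂ) * Complex.I := by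
  rw [e_eq_exp_mul_I, Complex.exp_mul_I]; push_cast; rfl

/-! ### The Kusmin–Landau inequality -/

lemma two_mul_le_sin_pi_mul {l d : ℝ} (hl : 0 ≤ l) (h1 : l ≤ d) (h2 : d ≤ 1 - l) :
    2 * l ≤ Real.sin (Real.pi * d) := by
  have hpi := Real.pi_pos
  have key : ∀ x : ℝ, 0 ≤ x → x ≤ 1 / 2 → 2 * x ≤ Real.sin (Real.pi * x) := by
    intro x hx hx'
    have := Real.mul_le_sin (x := Real.pi * x) (by positivity) (by nlinarith)
    calc 2 * x = 2 / Real.pi * (Real.pi * x) := by field_simp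
      _ ≤ _ := this
  rcases le_total d (1 / 2) with h | h
  · linarith [key d (by linarith) h]
  · have := key (1 - d) (by linarith) (by linarith)
    rw [show Real.pi * (1 - d) = Real.pi - Real.pi * d by ring, Real.sin_pi_sub] at this
    linarith

/-- The second factor is `1/2 + (i/2) cot πd`, the inverse of `1 - e(d)`. Its real part is constant
and its imaginary part is monotone between integers; this is what makes the partial summation in
Kusmin–Landau lossless. -/
lemma one_sub_e_mul {d : ℝ} (hd : Real.sin (Real.pi * d) ≠ 0) :
    (1 - e d) * (1 / 2 + ((Real.cos (Real.pi * d) / (2 * Real.sin (Real.pi * d)) : ℝ) : ℂ)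
      * Complex.I) = 1 := by
  rw [e_eq_cos_sin, show 2 * Real.pi * d = 2 * (Real.pi * d) by ring, Real.cos_two_mul,
    Real.sin_two_mul]
  have h := Real.sin_sq_add_cos_sq (Real.pi * d)
  have hs : (Real.sin (Real.pi * d) : ℂ) ≠ 0 := by exact_mod_cast hd
  have h' : (Real.sin (Real.pi * d) : ℂ) ^ 2 + (Real.cos (Real.pi * d) : ℂ) ^ 2 = 1 := by
    exact_mod_cast h
  push_cast at *
  generalize Complex.sin (Real.pi * d) = S at *
  generalize Complex.cos (Real.pi * d) = C at *
  have hI := Complex.I_sq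
  field_simp
  linear_combination (-2 * C * Complex.I) * h' + (-2 * C ^ 2 * S) * hI

lemma antitone_cot {l x y : ℝ} (hl : 0 < l) (h1 : l ≤ x) (hxy : x ≤ y) (h2 : y ≤ 1 - l) :
    Real.cos (Real.pi * y) / (2 * Real.sin (Real.pi * y)) ≤
      Real.cos (Real.pi * x) / (2 * Real.sin (Real.pi * x)) := by
  have hx := two_mul_le_sin_pi_mul hl.le h1 (by linarith)
  have hy := two_mul_le_sin_pi_mul hl.le (h1.trans hxy) h2
  rw [div_le_div_iff₀ (by linarith) (by linarith)]
  have : 0 ≤ Real.sin (Real.pi * y - Real.pi * x) := by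
    apply Real.sin_nonneg_of_nonneg_of_le_pi <;> nlinarith [Real.pi_pos]
  rw [Real.sin_sub] at this
  linarith

/-- Each term is `e(ψ n) = (e(ψ n) - e(ψ (n+1))) c n` with `c n` the inverse of `1 - e(ψ (n+1) - ψ
n)`. After summation by parts the total variation of `c` appears. It telescopes, because the
differences of `ψ` increase and the cotangent decreases. -/
theorem kusmin_landau {ψ : ℕ → ℝ} {L : ℕ} {l : ℝ} (hl : 0 < l)
    (hlo : ∀ n < L, l ≤ ψ (n + 1) - ψ n) (hhi : ∀ n < L, ψ (n + 1) - ψ n ≤ 1 - l)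
    (hmono : ∀ n, n + 1 < L → ψ (n + 1) - ψ n ≤ ψ (n + 2) - ψ (n + 1)) :
    ‖∑ n ∈ Finset.range L, e (ψ n)‖ ≤ 1 / l := by
  set r : ℕ → ℝ := fun n => Real.cos (Real.pi * (ψ (n + 1) - ψ n)) /
    (2 * Real.sin (Real.pi * (ψ (n + 1) - ψ n))) with hr
  set c : ℕ → ℂ := fun n => 1 / 2 + (r n : ℂ) * Complex.I with hc
  have hsin : ∀ n < L, 2 * l ≤ Real.sin (Real.pi * (ψ (n + 1) - ψ n)) := fun n hn =>
    two_mul_le_sin_pi_mul hl.le (hlo n hn) (hhi n hn)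
  have hid : ∀ n < L, (e (ψ n) - e (ψ (n + 1))) * c n = e (ψ n) := by
    intro n hn
    have h := one_sub_e_mul (d := ψ (n + 1) - ψ n) (by linarith [hsin n hn])
    have h2 : e (ψ (n + 1)) = e (ψ n) * e (ψ (n + 1) - ψ n) := by
      rw [← e_add]; congr 1; ring
    rw [h2, show e (ψ n) - e (ψ n) * e (ψ (n + 1) - ψ n) =
      e (ψ n) * (1 - e (ψ (n + 1) - ψ n)) by ring, mul_assoc, hc, hr]
    simp only
    rw [h, mul_one]
  have hrb : ∀ n < L, |r n| ≤ 1 / (4 * l) := by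
    intro n hn
    have h := hsin n hn
    rw [hr]
    simp only
    rw [abs_div, abs_of_pos (show 0 < 2 * Real.sin (Real.pi * (ψ (n + 1) - ψ n)) by linarith)]
    exact div_le_div₀ zero_le_one (Real.abs_cos_le_one _) (by positivity) (by linarith)
  have hcb : ∀ n < L, ‖c n‖ ≤ 1 / (4 * l) := by
    intro n hn
    have h := one_sub_e_mul (d := ψ (n + 1) - ψ n) (by linarith [hsin n hn])
    have hs := hsin n hn
    have hnorm : ‖c n‖ ^ 2 = (1 / (2 * Real.sin (Real.pi * (ψ (n + 1) - ψ n)))) ^ 2 := by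
      rw [hc, ← Complex.normSq_eq_norm_sq, Complex.normSq_apply]
      simp only [Complex.add_re, Complex.mul_re, Complex.ofReal_re, Complex.I_re, mul_zero,
        Complex.ofReal_im, Complex.I_im, Complex.add_im, Complex.mul_im, mul_one]
      have := Real.sin_sq_add_cos_sq (Real.pi * (ψ (n + 1) - ψ n))
      have hne : Real.sin (Real.pi * (ψ (n + 1) - ψ n)) ≠ 0 := by linarith
      rw [hr]
      norm_num
      field_simp
      linarith
    have h2 := (pow_left_inj₀ (norm_nonneg _) (by
      apply div_nonneg zero_le_one; linarith) two_ne_zero).1 hnorm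
    rw [h2]
    exact div_le_div₀ zero_le_one le_rfl (by positivity) (by linarith)
  -- With the boundary term included, passing from `M` to `M + 1` adds exactly `e(ψ(M+1)) (c(M+1) -
  -- c M)`, of norm `r M - r (M+1)`.
  have main : ∀ M, M + 1 ≤ L →
      ‖∑ n ∈ Finset.range (M + 1), e (ψ n) + e (ψ (M + 1)) * c M‖ ≤ ‖c 0‖ + (r 0 - r M) := by
    intro M
    induction M with
    | zero =>
      intro h
      have := hid 0 (by omega)
      have h3 : e (ψ 0) + e (ψ 1) * c 0 = e (ψ 0) * c 0 := by
        simp only [zero_add] at this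
        linear_combination -this
      simp [h3]
    | succ M ih =>
      intro h
      have h1 := ih (by omega)
      have h2 := hid (M + 1) (by omega)
      have h3 : ∑ n ∈ Finset.range (M + 1 + 1), e (ψ n) + e (ψ (M + 1 + 1)) * c (M + 1) =
          (∑ n ∈ Finset.range (M + 1), e (ψ n) + e (ψ (M + 1)) * c M) +
            e (ψ (M + 1)) * (c (M + 1) - c M) := by
        rw [Finset.sum_range_succ _ (M + 1)]
        linear_combination -h2
      have h4 : r (M + 1) ≤ r M :=
        antitone_cot hl (hlo M (by omega)) (hmono M (by omega)) (hhi (M + 1) (by omega))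
      have h5 : ‖c (M + 1) - c M‖ = r M - r (M + 1) := by
        have : c (M + 1) - c M = ((r (M + 1) - r M : ℝ) : ℂ) * Complex.I := by
          rw [hc]; push_cast; ring
        rw [this, norm_mul, Complex.norm_I, mul_one, Complex.norm_real, Real.norm_eq_abs,
          abs_of_nonpos (by linarith)]
        ring
      rw [h3]
      refine (norm_add_le _ _).trans ?_
      rw [norm_mul, norm_e, one_mul, h5]
      linarith
  rcases L with _ | M
  · simp; positivity
  · have h1 := main M le_rfl
    have h2 := norm_sub_le (∑ n ∈ Finset.range (M + 1), e (ψ n) + e (ψ (M + 1)) * c M)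
      (e (ψ (M + 1)) * c M)
    rw [add_sub_cancel_right, norm_mul, norm_e, one_mul] at h2
    have h3 := hcb 0 (by omega)
    have h4 := hcb M (by omega)
    have h5 := (abs_le.1 (hrb 0 (by omega))).2
    have h6 := (abs_le.1 (hrb M (by omega))).1
    -- The four quarters are the bounds for `‖c 0‖`, `‖c M‖`, `r 0` and `-r M`.
    have h7 : 1 / l = 4 * (1 / (4 * l)) := by field_simp
    linarith

/-- The Kusmin–Landau inequality for differences on either side of `0`. -/
theorem kusmin_landau_signed {ψ : ℕ → ℝ} {L : ℕ} {l : ℝ} (hl : 0 < l) (hl' : l ≤ 3 / 8)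
    (hmono : ∀ n, n + 1 < L → ψ (n + 1) - ψ n ≤ ψ (n + 2) - ψ (n + 1))
    (h : (∀ n < L, l ≤ ψ (n + 1) - ψ n ∧ ψ (n + 1) - ψ n ≤ 5 / 8) ∨
      (∀ n < L, ψ (n + 1) - ψ n ≤ -l ∧ -(5 / 8) ≤ ψ (n + 1) - ψ n)) :
    ‖∑ n ∈ Finset.range L, e (ψ n)‖ ≤ 1 / l := by
  rcases h with h | h
  · exact kusmin_landau hl (fun n hn => (h n hn).1) (fun n hn => by linarith [(h n hn).2]) hmono
  -- Adding `n` to `ψ n` leaves `e` unchanged and moves the differences from `[-5/8, -l]` to `[3/8,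
  -- 1 - l]`; this is where `l ≤ 3/8` enters.
  · have h1 : ∀ n : ℕ, e (ψ n) = e (ψ n + n) := fun n => by
      rw [← e_add_int (ψ n) (n : ℤ)]; simp
    rw [Finset.sum_congr rfl fun n _ => h1 n]
    refine kusmin_landau (ψ := fun n => ψ n + n) hl ?_ ?_ ?_
    · intro n hn; push_cast; linarith [(h n hn).2]
    · intro n hn; push_cast; linarith [(h n hn).1]
    · intro n hn; push_cast; linarith [hmono n hn]

lemma exists_threshold (d : ℕ → ℝ) (t : ℝ) (L : ℕ) (hd : ∀ m n, m ≤ n → n < L → d m ≤ d n) :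
    ∃ K ≤ L, (∀ n < K, d n ≤ t) ∧ ∀ n, K ≤ n → n < L → t < d n := by
  induction L with
  | zero => exact ⟨0, le_rfl, by simp, by simp⟩
  | succ L ih =>
    obtain ⟨K, hK, h1, h2⟩ := ih fun m n hmn hn => hd m n hmn (by omega)
    by_cases h : d L ≤ t
    · exact ⟨L + 1, le_rfl, fun n hn => (hd n L (by omega) (by omega)).trans h, by omega⟩
    · refine ⟨K, by omega, h1, fun n hn hn' => ?_⟩
      rcases Nat.lt_succ_iff_lt_or_eq.1 hn' with h3 | rfl
      · exact h2 n hn h3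
      · exact not_le.1 h

/-- A van der Corput type bound for phases whose differences grow like a cube. -/
theorem norm_sum_e_le_of_cubic_growth {ψ : ℕ → ℝ} {L : ℕ} {t : ℝ} (ht : 0 < t)
    (hb : ∀ n < L, |ψ (n + 1) - ψ n| ≤ 5 / 8)
    (hg : ∀ m n, m ≤ n → n < L →
      4 * t ^ 4 * ((n : ℝ) - m) ^ 3 ≤ (ψ (n + 1) - ψ n) - (ψ (m + 1) - ψ m)) :
    ‖∑ n ∈ Finset.range L, e (ψ n)‖ ≤ 8 * (1 + 1 / t) := by
  set d : ℕ → ℝ := fun n => ψ (n + 1) - ψ n with hd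
  have hmono : ∀ m n, m ≤ n → n < L → d m ≤ d n := by
    intro m n hmn hn
    have h1 := hg m n hmn hn
    have h2 : (0 : ℝ) ≤ (n : ℝ) - m := by
      have : (m : ℝ) ≤ n := by exact_mod_cast hmn
      linarith
    have h3 : 0 ≤ 4 * t ^ 4 * ((n : ℝ) - m) ^ 3 := by positivity
    simp only [hd]; linarith
  -- The cut `l = (3/8) min(1,t)` balances the parts. Differences beyond `±l` cost `1/l` each by
  -- Kusmin–Landau. Those in `(-l, l]` occupy an interval of some length `y + 1` with `4t⁴y³ ≤ 2l ≤
  -- 3t/4`, so `ty ≤ 1`.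
  obtain ⟨l, hl0, hl1, hlt, hlinv⟩ : ∃ l : ℝ, 0 < l ∧ l ≤ 3 / 8 ∧ l ≤ 3 / 8 * t ∧
      1 / l ≤ 8 / 3 * (1 + 1 / t) := by
    rcases le_total t 1 with h | h
    · refine ⟨3 / 8 * t, by positivity, by linarith, le_rfl, ?_⟩
      have : 1 / (3 / 8 * t) = 8 / 3 * (1 / t) := by field_simp
      rw [this]; linarith
    · refine ⟨3 / 8, by positivity, le_rfl, by linarith, ?_⟩
      have : 0 < 1 / t := by positivity
      linarith
  obtain ⟨K₁, hK₁, ha, hb1⟩ := exists_threshold d (-l) L hmono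
  obtain ⟨K₂, hK₂, hc, hd1⟩ := exists_threshold d l L hmono
  have hK : K₁ ≤ K₂ := by
    by_contra hcon
    have h1 := ha K₂ (by omega)
    have h2 := hd1 K₂ le_rfl (by omega)
    linarith
  have s1 : ‖∑ n ∈ Finset.range K₁, e (ψ n)‖ ≤ 1 / l := by
    apply kusmin_landau_signed hl0 hl1
    · intro n hn; exact hmono n (n + 1) (by omega) (by omega)
    · right; intro n hn
      exact ⟨ha n hn, (abs_le.1 (hb n (by omega))).1⟩
  have s3 : ‖∑ n ∈ Finset.Ico K₂ L, e (ψ n)‖ ≤ 1 / l := by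
    rw [Finset.sum_Ico_eq_sum_range]
    refine kusmin_landau_signed (ψ := fun n => ψ (K₂ + n)) hl0 hl1 ?_ ?_
    · intro n hn; exact hmono (K₂ + n) (K₂ + (n + 1)) (by omega) (by omega)
    · left; intro n hn
      exact ⟨(hd1 (K₂ + n) (by omega) (by omega)).le, (abs_le.1 (hb (K₂ + n) (by omega))).2⟩
  have s2 : ‖∑ n ∈ Finset.Ico K₁ K₂, e (ψ n)‖ ≤ 1 + 1 / t := by
    refine (norm_sum_le _ _).trans ?_
    simp only [norm_e, Finset.sum_const, Nat.card_Ico, nsmul_eq_mul, mul_one]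
    rcases hK.eq_or_lt with h | h
    · subst h; simp; positivity
    · have h1 := hg K₁ (K₂ - 1) (by omega) (by omega)
      have h2 := hb1 K₁ le_rfl (by omega)
      have h3 := hc (K₂ - 1) (by omega)
      have h4 : ((K₂ - 1 : ℕ) : ℝ) - K₁ = (K₂ - K₁ : ℕ) - 1 := by
        rw [Nat.cast_sub (by omega), Nat.cast_sub hK]; push_cast; ring
      rw [h4] at h1
      set y : ℝ := ((K₂ - K₁ : ℕ) : ℝ) - 1 with hy
      have hy0 : 0 ≤ y := by
        have : (1 : ℝ) ≤ ((K₂ - K₁ : ℕ) : ℝ) := by exact_mod_cast (by omega : 1 ≤ K₂ - K₁)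
        linarith
      have h5 : t * (4 * (t * y) ^ 3) ≤ t * (3 / 4) := by
        simp only [hd] at h2 h3
        have : t * (4 * (t * y) ^ 3) = 4 * t ^ 4 * y ^ 3 := by ring
        rw [this]; linarith
      have h6 := le_of_mul_le_mul_left h5 ht
      have h7 : t * y ≤ 1 := by
        by_contra hcon
        push Not at hcon
        have : 1 ≤ (t * y) ^ 3 := one_le_pow₀ hcon.le
        linarith
      have h8 : y ≤ 1 / t := by rw [le_div_iff₀ ht]; linarith
      linarith
  have hsplit : ∑ n ∈ Finset.range L, e (ψ n) = ∑ n ∈ Finset.range K₁, e (ψ n) +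
      ∑ n ∈ Finset.Ico K₁ K₂, e (ψ n) + ∑ n ∈ Finset.Ico K₂ L, e (ψ n) := by
    rw [Finset.sum_range_add_sum_Ico _ hK, Finset.sum_range_add_sum_Ico _ hK₂]
  rw [hsplit]
  have ht' : 0 < 1 / t := by positivity
  calc _ ≤ 1 / l + (1 + 1 / t) + 1 / l :=
        (norm_add_le _ _).trans (add_le_add ((norm_add_le _ _).trans (add_le_add s1 s2)) s3)
    _ ≤ _ := by linarith

/-! ### Complete exponential sums -/

/-- The additive character `n ↦ e(n/q)` of `ℤ`. -/
noncomputable def ez (q : ℕ) (n : ℤ) : ℂ := e ((n : ℝ) / q)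

@[simp] lemma norm_ez (q : ℕ) (n : ℤ) : ‖ez q n‖ = 1 := norm_e _

lemma ez_add (q : ℕ) (m n : ℤ) : ez q (m + n) = ez q m * ez q n := by
  unfold ez; rw [← e_add]; congr 1; push_cast; ring

@[simp] lemma ez_zero (q : ℕ) : ez q 0 = 1 := by simp [ez]

lemma ez_congr {q : ℕ} {m n : ℤ} (h : (q : ℤ) ∣ m - n) : ez q m = ez q n := by
  rcases Nat.eq_zero_or_pos q with rfl | hq
  · have : m = n := by simpa [sub_eq_zero] using h
    rw [this]
  · obtain ⟨k, hk⟩ := h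
    refine e_congr k ?_
    have hm : m = n + q * k := by linarith
    have hq' : (q : ℝ) ≠ 0 := by positivity
    rw [hm]; push_cast; field_simp

lemma ez_mul_left {q k : ℕ} (hk : 0 < k) (n : ℤ) : ez (k * q) (k * n) = ez q n := by
  unfold ez
  congr 1
  push_cast
  exact mul_div_mul_left _ _ (by positivity)

lemma ez_eq_stdAddChar {q : ℕ} [NeZero q] (n : ℤ) : ez q n = ZMod.stdAddChar (n : ZMod q) := by
  rw [ZMod.stdAddChar_coe]
  unfold ez e
  congr 1
  push_cast
  ring

lemma sum_ez_mul {q : ℕ} (hq : 0 < q) (c : ℤ) :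
    ∑ z ∈ Finset.range q, ez q (c * z) = if (q : ℤ) ∣ c then (q : ℂ) else 0 := by
  split_ifs with h
  · rw [Finset.sum_congr rfl fun (z : ℕ) _ => (ez_congr (n := 0) (by
      rw [sub_zero]; exact h.mul_right _) : ez q (c * z) = ez q 0)]
    simp
  · have h1 : ez q c ≠ 1 := by
      unfold ez e
      intro hcon
      rw [Complex.exp_eq_one_iff] at hcon
      obtain ⟨n, hn⟩ := hcon
      apply h
      refine ⟨n, ?_⟩
      have hpi : (2 * Real.pi * Complex.I : ℂ) ≠ 0 := Complex.two_pi_I_ne_zero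
      have hq' : (q : ℂ) ≠ 0 := by exact_mod_cast hq.ne'
      push_cast at hn
      rw [mul_comm (n : ℂ)] at hn
      have := mul_left_cancel₀ hpi hn
      rw [div_eq_iff hq'] at this
      have h3 : c = n * q := by exact_mod_cast this
      rw [h3, mul_comm]
    have h2 : ∀ z : ℕ, ez q (c * z) = ez q c ^ z := by
      intro z
      induction z with
      | zero => simp
      | succ z ih => rw [pow_succ, ← ih, ← ez_add]; congr 1; push_cast; ring
    rw [Finset.sum_congr rfl fun z _ => h2 z, geom_sum_eq h1, ← h2, ez_congr (n := 0)]
    · simp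
    · simp

/-- The complete quartic sum `S(q,a,b) = ∑_{x mod q} e((a x⁴ + b x)/q)`. -/
noncomputable def quarticSum (q : ℕ) (a b : ℤ) : ℂ :=
  ∑ x ∈ Finset.range q, ez q (a * (x : ℤ) ^ 4 + b * x)

lemma norm_quarticSum_le (q : ℕ) (a b : ℤ) : ‖quarticSum q a b‖ ≤ q := by
  refine (norm_sum_le _ _).trans ?_
  simp

lemma quartic_dvd {q : ℤ} (a b x y : ℤ) (h : q ∣ x - y) :
    q ∣ (a * x ^ 4 + b * x) - (a * y ^ 4 + b * y) := by
  rw [show (a * x ^ 4 + b * x) - (a * y ^ 4 + b * y) =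
    (x - y) * (a * (x ^ 3 + x ^ 2 * y + x * y ^ 2 + y ^ 3) + b) by ring]
  exact h.mul_right _

lemma sum_complete_residues {ι : Type*} {q : ℕ} (hq : 0 < q) (F : ℤ → ℂ)
    (hF : ∀ x y : ℤ, (q : ℤ) ∣ x - y → F x = F y) (I : Finset ι) (φ : ι → ℤ) (hI : I.card = q)
    (hinj : ∀ i ∈ I, ∀ j ∈ I, (q : ℤ) ∣ φ i - φ j → i = j) :
    ∑ i ∈ I, F (φ i) = ∑ x ∈ Finset.range q, F x := by
  have hq' : (q : ℤ) ≠ 0 := by exact_mod_cast hq.ne'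
  have hcast : ∀ i, (((φ i % q).toNat : ℕ) : ℤ) = φ i % q := fun i =>
    Int.toNat_of_nonneg (Int.emod_nonneg _ hq')
  have hinj' : Set.InjOn (fun i => (φ i % q).toNat) I := by
    intro i hi j hj hij
    apply hinj i hi j hj
    have : φ i % q = φ j % q := by rw [← hcast i, ← hcast j]; exact congrArg _ hij
    exact Int.ModEq.dvd (this.symm : φ j ≡ φ i [ZMOD q])
  have himg : I.image (fun i => (φ i % q).toNat) = Finset.range q := by
    apply Finset.eq_of_subset_of_card_le
    · intro x hx
      obtain ⟨i, -, rfl⟩ := Finset.mem_image.1 hx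
      have h1 : φ i % q < q := Int.emod_lt_of_pos _ (by exact_mod_cast hq)
      have := hcast i
      rw [Finset.mem_range]
      omega
    · rw [Finset.card_image_of_injOn hinj', hI, Finset.card_range]
  rw [← himg, Finset.sum_image hinj']
  refine Finset.sum_congr rfl fun i _ => hF _ _ ?_
  rw [hcast i]
  exact Int.dvd_self_sub_emod

lemma sum_range_mul_eq {M : Type*} [AddCommMonoid M] (A B : ℕ) (F : ℕ → M) :
    ∑ x ∈ Finset.range (A * B), F x =
      ∑ y ∈ Finset.range A, ∑ z ∈ Finset.range B, F (y + A * z) := by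
  rw [Finset.sum_comm]
  induction B with
  | zero => simp
  | succ B ih =>
    rw [Finset.sum_range_succ, ← ih, Nat.mul_succ, Finset.sum_range_add]
    congr 1
    exact Finset.sum_congr rfl fun y _ => by rw [add_comm]

/-- Put `x = ny + mz`. The mixed terms of `x⁴` are divisible by `mn`, and `n⁴y⁴/(mn) = n³y⁴/m`. -/
theorem quarticSum_mul {m n : ℕ} (hm : 0 < m) (hn : 0 < n) (hmn : Nat.Coprime m n) (a b : ℤ) :
    quarticSum (m * n) a b = quarticSum m (a * (n : ℤ) ^ 3) b * quarticSum n (a * (m : ℤ) ^ 3) b := by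
  have h := sum_complete_residues (q := m * n) (Nat.mul_pos hm hn)
    (fun x => ez (m * n) (a * x ^ 4 + b * x)) (fun x y hxy => ez_congr (quartic_dvd a b x y hxy))
    (Finset.range m ×ˢ Finset.range n) (fun i => (n : ℤ) * i.1 + m * i.2) (by simp) (by
      rintro ⟨y, z⟩ hi ⟨y', z'⟩ hj hd
      simp only [Finset.mem_product, Finset.mem_range] at hi hj
      have hc : IsCoprime (m : ℤ) n := Nat.isCoprime_iff_coprime.2 hmn
      have h1 : (m : ℤ) ∣ (n : ℤ) * ((y : ℤ) - y') := by
        have h2 : (m : ℤ) ∣ (n : ℤ) * y + m * z - (n * y' + m * z') :=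
          (Dvd.intro (n : ℤ) (by push_cast; ring)).trans hd
        have h3 := dvd_sub h2 (Dvd.intro ((z : ℤ) - z') rfl)
        rwa [show (n : ℤ) * y + m * z - (n * y' + m * z') - m * ((z : ℤ) - z') =
          n * ((y : ℤ) - y') by ring] at h3
      have h1' : (n : ℤ) ∣ (m : ℤ) * ((z : ℤ) - z') := by
        have h2 : (n : ℤ) ∣ (n : ℤ) * y + m * z - (n * y' + m * z') :=
          (Dvd.intro (m : ℤ) (by push_cast; ring)).trans hd
        have h3 := dvd_sub h2 (Dvd.intro ((y : ℤ) - y') rfl)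
        rwa [show (n : ℤ) * y + m * z - (n * y' + m * z') - n * ((y : ℤ) - y') =
          m * ((z : ℤ) - z') by ring] at h3
      have h4 := hc.dvd_of_dvd_mul_left h1
      have h4' := hc.symm.dvd_of_dvd_mul_left h1'
      have key : ∀ N u w : ℕ, u < N → w < N → (N : ℤ) ∣ (u : ℤ) - w → u = w := by
        intro N u w hu hw hd
        have := Int.eq_zero_of_abs_lt_dvd hd (by rw [abs_lt]; constructor <;> omega)
        omega
      rw [key m y y' hi.1 hj.1 h4, key n z z' hi.2 hj.2 h4'])
  unfold quarticSum
  rw [← h, Finset.sum_product, Finset.sum_mul_sum]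
  refine Finset.sum_congr rfl fun y _ => Finset.sum_congr rfl fun z _ => ?_
  rw [← ez_mul_left hn (a * (n : ℤ) ^ 3 * (y : ℤ) ^ 4 + b * y),
    ← ez_mul_left hm (a * (m : ℤ) ^ 3 * (z : ℤ) ^ 4 + b * z), mul_comm n m, ← ez_add]
  apply ez_congr
  refine ⟨a * (4 * ((n : ℤ) * y) ^ 2 * (y * z) + 6 * (n * y) * (m * z) * (y * z)
    + 4 * (m * z) ^ 2 * (y * z)), ?_⟩
  push_cast
  ring

/-! ### Complete sums to a prime modulus -/

section Mordell

variable {p : ℕ} [Fact p.Prime]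

/-- The complete quartic sum over `ℤ/pℤ`. -/
noncomputable def zmodQuarticSum (p : ℕ) [NeZero p] (a b : ZMod p) : ℂ :=
  ∑ x : ZMod p, ZMod.stdAddChar (a * x ^ 4 + b * x)

lemma sum_range_eq_sum_zmod {M : Type*} [AddCommMonoid M] (q : ℕ) [NeZero q] (F : ZMod q → M) :
    ∑ x ∈ Finset.range q, F (x : ZMod q) = ∑ x : ZMod q, F x := by
  refine Finset.sum_bij (fun x _ => (x : ZMod q)) (fun _ _ => Finset.mem_univ _) ?_ ?_ ?_
  · intro x hx y hy h
    rw [Finset.mem_range] at hx hy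
    have := congrArg ZMod.val h
    rwa [ZMod.val_natCast_of_lt hx, ZMod.val_natCast_of_lt hy] at this
  · intro y _
    exact ⟨y.val, Finset.mem_range.2 (ZMod.val_lt y), ZMod.natCast_zmod_val y⟩
  · intro _ _; rfl

lemma quarticSum_eq_zmod (q : ℕ) [NeZero q] (a b : ℤ) :
    quarticSum q a b = zmodQuarticSum q a b := by
  unfold quarticSum zmodQuarticSum
  rw [← sum_range_eq_sum_zmod q]
  refine Finset.sum_congr rfl fun x _ => ?_
  rw [ez_eq_stdAddChar]
  push_cast
  rfl

lemma stdAddChar_sum_mul {q : ℕ} [NeZero q] (c : ZMod q) :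
    ∑ a : ZMod q, (ZMod.stdAddChar (a * c) : ℂ) = if c = 0 then (q : ℂ) else 0 := by
  have := AddChar.sum_mulShift c (ZMod.isPrimitive_stdAddChar q)
  rw [this, ZMod.card]
  split_ifs <;> simp

lemma card_roots_le {F : Type*} [Field F] [Fintype F] [DecidableEq F] (f : Polynomial F) (n : ℕ)
    (hf : f ≠ 0) (hn : f.natDegree ≤ n) :
    (Finset.univ.filter fun y => f.eval y = 0).card ≤ n := by
  refine le_trans ?_ ((Polynomial.card_roots' f).trans hn)
  refine (Finset.card_le_card ?_).trans (Multiset.toFinset_card_le _)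
  intro y hy
  rw [Multiset.mem_toFinset, Polynomial.mem_roots hf]
  exact (Finset.mem_filter.1 hy).2

lemma norm_pow_four (z : ℂ) : ((‖z‖ ^ 4 : ℝ) : ℂ) = z * z * ((starRingEnd ℂ) z * (starRingEnd ℂ) z) := by
  have := Complex.mul_conj z
  rw [show z * z * ((starRingEnd ℂ) z * (starRingEnd ℂ) z) =
    (z * (starRingEnd ℂ) z) * (z * (starRingEnd ℂ) z) by ring, this, Complex.normSq_eq_norm_sq]
  push_cast; ring

lemma conj_zmodQuarticSum (a b : ZMod p) :
    (starRingEnd ℂ) (zmodQuarticSum p a b) =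
      ∑ x : ZMod p, (ZMod.stdAddChar (-(a * x ^ 4 + b * x)) : ℂ) := by
  unfold zmodQuarticSum
  rw [map_sum]
  refine Finset.sum_congr rfl fun x _ => ?_
  rw [AddChar.map_neg_eq_conj]

/-- Orthogonality in both `a` and `b`: averaging over the linear coefficient as well brings in a
linear equation beside the quartic one. -/
lemma sum_norm_zmodQuarticSum_pow_four :
    ((∑ a : ZMod p, ∑ b : ZMod p, ‖zmodQuarticSum p a b‖ ^ 4 : ℝ) : ℂ) =
      (p : ℂ) ^ 2 * ((Finset.univ.filter fun x : (ZMod p × ZMod p) × (ZMod p × ZMod p) =>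
        x.1.1 + x.1.2 - x.2.1 - x.2.2 = 0 ∧
        x.1.1 ^ 4 + x.1.2 ^ 4 - x.2.1 ^ 4 - x.2.2 ^ 4 = 0).card : ℂ) := by
  have h1 : ∀ a b : ZMod p, ((‖zmodQuarticSum p a b‖ ^ 4 : ℝ) : ℂ) =
      ∑ x : (ZMod p × ZMod p) × (ZMod p × ZMod p),
        (ZMod.stdAddChar (a * (x.1.1 ^ 4 + x.1.2 ^ 4 - x.2.1 ^ 4 - x.2.2 ^ 4)) : ℂ) *
        ZMod.stdAddChar (b * (x.1.1 + x.1.2 - x.2.1 - x.2.2)) := by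
    intro a b
    rw [norm_pow_four, conj_zmodQuarticSum]
    unfold zmodQuarticSum
    rw [Fintype.sum_mul_sum, Fintype.sum_mul_sum, ← Fintype.sum_prod_type',
      ← Fintype.sum_prod_type', Fintype.sum_mul_sum, ← Fintype.sum_prod_type']
    refine Finset.sum_congr rfl fun x _ => ?_
    simp only [← AddChar.map_add_eq_mul]
    congr 1
    ring
  push_cast at h1 ⊢
  simp_rw [h1]
  rw [Finset.sum_congr rfl fun a _ => Finset.sum_comm, Finset.sum_comm]
  rw [Finset.card_filter]
  push_cast
  rw [Finset.mul_sum]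
  refine Finset.sum_congr rfl fun x _ => ?_
  rw [← Finset.sum_mul_sum, stdAddChar_sum_mul, stdAddChar_sum_mul]
  split_ifs <;> simp_all
  ring

/-- Given the first pair, the linear equation eliminates one unknown of the second and leaves a
quartic in the other. Its leading coefficient is 2, nonzero for odd `p`, so there are at most four
choices. -/
lemma card_quartic_system_le (hp : p ≠ 2) :
    (Finset.univ.filter fun x : (ZMod p × ZMod p) × (ZMod p × ZMod p) =>
        x.1.1 + x.1.2 - x.2.1 - x.2.2 = 0 ∧
        x.1.1 ^ 4 + x.1.2 ^ 4 - x.2.1 ^ 4 - x.2.2 ^ 4 = 0).card ≤ 4 * p ^ 2 := by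
  have htwo : (2 : ZMod p) ≠ 0 := by
    intro h
    have h2 : ((2 : ℕ) : ZMod p) = 0 := by exact_mod_cast h
    rw [ZMod.natCast_eq_zero_iff] at h2
    exact hp ((Nat.prime_dvd_prime_iff_eq Fact.out Nat.prime_two).1 h2)
  have h1 : ∀ u : ZMod p × ZMod p, (Finset.univ.filter fun y : ZMod p =>
      u.1 ^ 4 + u.2 ^ 4 - y ^ 4 - (u.1 + u.2 - y) ^ 4 = 0).card ≤ 4 := by
    intro u
    open Polynomial in
    set f : (ZMod p)[X] := C 2 * X ^ 4 + C (-4 * (u.1 + u.2)) * X ^ 3 + C (6 * (u.1 + u.2) ^ 2) * X ^ 2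
      + C (-4 * (u.1 + u.2) ^ 3) * X + C ((u.1 + u.2) ^ 4 - u.1 ^ 4 - u.2 ^ 4) with hf
    have hdeg : f.natDegree = 4 := by rw [hf]; compute_degree!
    have hne : f ≠ 0 := by rintro h; rw [h] at hdeg; simp at hdeg
    refine le_trans (Finset.card_le_card ?_) (card_roots_le f 4 hne hdeg.le)
    intro y hy
    rw [Finset.mem_filter] at hy ⊢
    refine ⟨hy.1, ?_⟩
    rw [hf]
    simp only [Polynomial.eval_add, Polynomial.eval_mul, Polynomial.eval_C, Polynomial.eval_pow,
      Polynomial.eval_X]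
    linear_combination -hy.2
  refine (Finset.card_le_mul_card_image (f := Prod.fst) _ 4 ?_).trans ?_
  · intro u _
    refine le_trans ?_ (h1 u)
    refine Finset.card_le_card_of_injOn (fun x => x.2.1) ?_ ?_
    · rintro ⟨⟨x1, x2⟩, ⟨y1, y2⟩⟩ hx
      simp only [Finset.coe_filter, Finset.mem_filter, Finset.mem_univ, true_and,
        Set.mem_ofPred_eq] at hx ⊢
      obtain ⟨⟨h2, h3⟩, rfl⟩ := hx
      have h4 : x1 + x2 - y1 = y2 := by linear_combination h2
      simp only [h4, h3]
    · rintro ⟨⟨x1, x2⟩, ⟨y1, y2⟩⟩ hx ⟨⟨x1', x2'⟩, ⟨y1', y2'⟩⟩ hx' hy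
      simp only [Finset.coe_filter, Finset.mem_filter, Finset.mem_univ, true_and,
        Set.mem_ofPred_eq] at hx hx' hy
      obtain ⟨⟨h2, -⟩, h4⟩ := hx
      obtain ⟨⟨h2', -⟩, h4'⟩ := hx'
      rw [← h4', Prod.mk.injEq] at h4
      obtain ⟨rfl, rfl⟩ := h4
      subst hy
      have : y2 = y2' := by linear_combination h2' - h2
      rw [this]
  · have : (Finset.univ : Finset (ZMod p × ZMod p)).card = p ^ 2 := by
      rw [Finset.card_univ, Fintype.card_prod, ZMod.card, sq]
    have h2 := Finset.card_le_univ (Finset.image Prod.fst (Finset.univ.filter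
      fun x : (ZMod p × ZMod p) × (ZMod p × ZMod p) =>
        x.1.1 + x.1.2 - x.2.1 - x.2.2 = 0 ∧
        x.1.1 ^ 4 + x.1.2 ^ 4 - x.2.1 ^ 4 - x.2.2 ^ 4 = 0))
    rw [← Finset.card_univ, this] at h2
    exact Nat.mul_le_mul_left 4 h2

lemma zmodQuarticSum_dilate (a b l : ZMod p) (hl : l ≠ 0) :
    zmodQuarticSum p (a * l ^ 4) (b * l) = zmodQuarticSum p a b := by
  unfold zmodQuarticSum
  rw [← Equiv.sum_comp (Equiv.mulLeft₀ l hl)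
    (fun x => (ZMod.stdAddChar (a * x ^ 4 + b * x) : ℂ))]
  refine Finset.sum_congr rfl fun x _ => ?_
  simp only [Equiv.mulLeft₀_apply]
  congr 1
  ring

/-- Mordell's argument: `x ↦ lx` shows that the same sum belongs to all pairs `(a l⁴, b l)` with `l
≠ 0`, and each pair arises at most four times as `a ≠ 0`. So `(p - 1)|S|⁴` is at most four times the
fourth moment, that is `4 · p² · 4p²`; then use `p - 1 ≥ p/2`. -/
lemma norm_zmodQuarticSum_pow_four_le (hp : p ≠ 2) (a b : ZMod p) (ha : a ≠ 0) :
    ‖zmodQuarticSum p a b‖ ^ 4 ≤ 32 * (p : ℝ) ^ 3 := by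
  have hp2 := (Fact.out : p.Prime).two_le
  set U : Finset (ZMod p) := Finset.univ.filter fun l => l ≠ 0 with hU
  have hUcard : (U.card : ℝ) = p - 1 := by
    have : U = Finset.univ.erase 0 := by ext; simp [hU]
    rw [this, Finset.card_erase_of_mem (Finset.mem_univ _), Finset.card_univ, ZMod.card,
      Nat.cast_sub (by omega)]
    simp
  have h1 : ∑ l ∈ U, ‖zmodQuarticSum p a b‖ ^ 4 ≤
      ∑ x : ZMod p × ZMod p, 4 * ‖zmodQuarticSum p x.1 x.2‖ ^ 4 := by
    have h2 : ∑ l ∈ U, ‖zmodQuarticSum p a b‖ ^ 4 =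
        ∑ l ∈ U, ‖zmodQuarticSum p (a * l ^ 4) (b * l)‖ ^ 4 :=
      Finset.sum_congr rfl fun l hl => by
        rw [zmodQuarticSum_dilate a b l (Finset.mem_filter.1 hl).2]
    rw [h2, ← Finset.sum_fiberwise_of_maps_to (s := U) (t := Finset.univ)
      (g := fun l => (a * l ^ 4, b * l)) (fun _ _ => Finset.mem_univ _)]
    refine Finset.sum_le_sum fun x _ => ?_
    rw [Finset.sum_congr rfl (g := fun _ => ‖zmodQuarticSum p x.1 x.2‖ ^ 4) (by
      intro l hl
      rw [← (Finset.mem_filter.1 hl).2]), Finset.sum_const, nsmul_eq_mul]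
    refine mul_le_mul_of_nonneg_right ?_ (by positivity)
    have h3 : (Finset.univ.filter fun l : ZMod p => a * l ^ 4 - x.1 = 0).card ≤ 4 := by
      open Polynomial in
      set f : (ZMod p)[X] := C a * X ^ 4 - C x.1 with hf
      have hdeg : f.natDegree = 4 := by rw [hf]; compute_degree!
      have hne : f ≠ 0 := by rintro h; rw [h] at hdeg; simp at hdeg
      refine le_trans (Finset.card_le_card ?_) (card_roots_le f 4 hne hdeg.le)
      intro y hy
      rw [Finset.mem_filter] at hy ⊢
      refine ⟨hy.1, ?_⟩
      rw [hf]
      simp only [Polynomial.eval_sub, Polynomial.eval_mul, Polynomial.eval_C,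
        Polynomial.eval_pow, Polynomial.eval_X]
      exact hy.2
    have h4 := (Finset.card_le_card (s := U.filter fun l => (a * l ^ 4, b * l) = x) (by
      intro l hl
      have := (Finset.mem_filter.1 hl).2
      rw [Finset.mem_filter]
      exact ⟨Finset.mem_univ _, by rw [← this]; simp⟩)).trans h3
    exact_mod_cast h4
  rw [Finset.sum_const, nsmul_eq_mul, hUcard, ← Finset.mul_sum, Fintype.sum_prod_type] at h1
  have h5 := sum_norm_zmodQuarticSum_pow_four (p := p)
  have h6 := card_quartic_system_le hp
  set N := (Finset.univ.filter fun x : (ZMod p × ZMod p) × (ZMod p × ZMod p) =>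
        x.1.1 + x.1.2 - x.2.1 - x.2.2 = 0 ∧
        x.1.1 ^ 4 + x.1.2 ^ 4 - x.2.1 ^ 4 - x.2.2 ^ 4 = 0).card
  have h7 : (∑ a : ZMod p, ∑ b : ZMod p, ‖zmodQuarticSum p a b‖ ^ 4) = (p : ℝ) ^ 2 * N := by
    exact_mod_cast h5
  rw [h7] at h1
  have h8 : (N : ℝ) ≤ 4 * (p : ℝ) ^ 2 := by exact_mod_cast h6
  have hpr : (2 : ℝ) ≤ p := by exact_mod_cast hp2
  have h9 : ((p : ℝ) / 2) * ‖zmodQuarticSum p a b‖ ^ 4 ≤ (p : ℝ) / 2 * (32 * (p : ℝ) ^ 3) := by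
    calc ((p : ℝ) / 2) * ‖zmodQuarticSum p a b‖ ^ 4
        ≤ (p - 1) * ‖zmodQuarticSum p a b‖ ^ 4 :=
          mul_le_mul_of_nonneg_right (by linarith) (by positivity)
      _ ≤ 4 * ((p : ℝ) ^ 2 * N) := h1
      _ ≤ 4 * ((p : ℝ) ^ 2 * (4 * (p : ℝ) ^ 2)) := by gcongr
      _ = _ := by ring
  exact le_of_mul_le_mul_left h9 (by linarith)

end Mordell

/-- Mordell's bound for quartic sums to a prime modulus. -/
theorem norm_quarticSum_prime_le {p : ℕ} (hp : p.Prime) (hp2 : p ≠ 2) (a b : ℤ)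
    (ha : ¬ (p : ℤ) ∣ a) : ‖quarticSum p a b‖ ≤ 3 * (p : ℝ) ^ (3 / 4 : ℝ) := by
  have : Fact p.Prime := ⟨hp⟩
  have h := norm_zmodQuarticSum_pow_four_le hp2 (a : ZMod p) (b : ZMod p) (by
    rwa [Ne, ZMod.intCast_zmod_eq_zero_iff_dvd])
  rw [quarticSum_eq_zmod]
  refine le_of_pow_le_pow_left₀ (n := 4) (by norm_num) (by positivity) (h.trans ?_)
  rw [mul_pow, ← Real.rpow_natCast ((p : ℝ) ^ (3 / 4 : ℝ)) 4, ← Real.rpow_mul (by positivity)]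
  norm_num
  gcongr
  norm_num

/-! ### Complete sums to a prime power modulus -/

/-- These are the stationary points of `a x⁴ + c x`. For odd `p` the unit group is cyclic, so the
ratio of two of them is one of at most three cube roots of unity. For `p = 2` cubing is injective on
odd residues, but the factor 4 loses two binary digits, which leaves four choices. -/
lemma card_cube_roots_le {p k : ℕ} (hp : p.Prime) (a c : ℤ) (ha : ¬ (p : ℤ) ∣ a) :
    ((Finset.range (p ^ k)).filter fun y : ℕ => ¬ p ∣ y ∧
      ((p ^ k : ℕ) : ℤ) ∣ 4 * a * (y : ℤ) ^ 3 + c).card ≤ 4 := by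
  set T := (Finset.range (p ^ k)).filter fun y : ℕ => ¬ p ∣ y ∧
      ((p ^ k : ℕ) : ℤ) ∣ 4 * a * (y : ℤ) ^ 3 + c with hT
  have hsub : ∀ y ∈ T, ∀ w ∈ T, ((p ^ k : ℕ) : ℤ) ∣ 4 * (a * ((y : ℤ) ^ 3 - (w : ℤ) ^ 3)) := by
    intro y hy w hw
    have := dvd_sub (Finset.mem_filter.1 hy).2.2 (Finset.mem_filter.1 hw).2.2
    rwa [show 4 * a * (y : ℤ) ^ 3 + c - (4 * a * (w : ℤ) ^ 3 + c) =
      4 * (a * ((y : ℤ) ^ 3 - (w : ℤ) ^ 3)) by ring] at this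
  have hpa : IsCoprime ((p : ℤ)) a := (Nat.prime_iff_prime_int.1 hp).coprime_iff_not_dvd.2 ha
  by_cases hp2 : p = 2
  · subst hp2
    rcases lt_or_ge k 2 with hk | hk
    · refine (Finset.card_filter_le _ _).trans ?_
      rw [Finset.card_range]
      interval_cases k <;> norm_num
    · obtain ⟨j, rfl⟩ := Nat.exists_eq_add_of_le hk
      have hmod : ∀ y ∈ T, ∀ w ∈ T, y % 2 ^ j = w % 2 ^ j := by
        intro y hy w hw
        have h1 := hsub y hy w hw
        rw [show ((2 ^ (2 + j) : ℕ) : ℤ) = 4 * (2 : ℤ) ^ j by push_cast; ring] at h1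
        have h2 := Int.dvd_of_mul_dvd_mul_left (by norm_num : (4 : ℤ) ≠ 0) h1 
        have h3 : (2 : ℤ) ^ j ∣ (y : ℤ) ^ 3 - (w : ℤ) ^ 3 :=
          (IsCoprime.pow_left (by exact_mod_cast hpa)).dvd_of_dvd_mul_left h2
        rw [show (y : ℤ) ^ 3 - (w : ℤ) ^ 3 = ((y : ℤ) ^ 2 + y * w + w ^ 2) * (y - w) by ring] at h3
        have hodd : ¬ (2 : ℤ) ∣ (y : ℤ) ^ 2 + y * w + w ^ 2 := by
          have hy2 := (Finset.mem_filter.1 hy).2.1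
          have hw2 := (Finset.mem_filter.1 hw).2.1
          rw [← even_iff_two_dvd] at hy2 hw2 ⊢
          have hy3 : ¬ Even (y : ℤ) := by exact_mod_cast hy2
          have hw3 : ¬ Even (w : ℤ) := by exact_mod_cast hw2
          simp [Int.even_add, Int.even_mul, Int.even_pow, hy3, hw3]
        have hc : IsCoprime (2 : ℤ) ((y : ℤ) ^ 2 + y * w + w ^ 2) :=
          Int.prime_two.coprime_iff_not_dvd.2 hodd
        have h4 : (2 : ℤ) ^ j ∣ (y : ℤ) - w := (IsCoprime.pow_left hc).dvd_of_dvd_mul_left h3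
        have h5 : (w : ℤ) ≡ y [ZMOD ((2 ^ j : ℕ) : ℤ)] := Int.modEq_iff_dvd.2 (by exact_mod_cast h4)
        exact ((Int.natCast_modEq_iff).1 h5).symm
      calc T.card ≤ (Finset.range 4).card := by
            refine Finset.card_le_card_of_injOn (fun y => y / 2 ^ j) ?_ ?_
            · intro y hy
              have := Finset.mem_range.1 (Finset.mem_filter.1 hy).1
              rw [Finset.coe_range, Set.mem_Iio, Nat.div_lt_iff_lt_mul (by positivity)]
              rw [pow_add] at this
              omega
            · intro y hy w hw h
              have h1 := hmod y hy w hw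
              simp only at h
              rw [← Nat.div_add_mod y (2 ^ j), ← Nat.div_add_mod w (2 ^ j), h, h1]
        _ = 4 := by simp
  · rcases T.eq_empty_or_nonempty with h0 | ⟨w, hw⟩
    · rw [h0]; simp
    have := ZMod.isCyclic_units_of_prime_pow p hp hp2 k
    have : NeZero (p ^ k) := ⟨(pow_pos hp.pos k).ne'⟩
    have hcop : ∀ y ∈ T, Nat.Coprime y (p ^ k) := fun y hy =>
      ((hp.coprime_iff_not_dvd.2 (Finset.mem_filter.1 hy).2.1).symm).pow_right k
    have h3 := IsCyclic.card_pow_eq_one_le (α := (ZMod (p ^ k))ˣ) (n := 3) (by norm_num)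
    refine le_trans (Finset.card_le_card_of_injOn (t := Finset.univ.filter
      fun g : (ZMod (p ^ k))ˣ => g ^ 3 = 1)
      (fun y => if h : y ∈ T then ZMod.unitOfCoprime y (hcop y h) *
        (ZMod.unitOfCoprime w (hcop w hw))⁻¹ else 1) ?_ ?_) (h3.trans (by norm_num))
    · intro y hy
      have hy' : y ∈ T := hy
      simp only [hy', dif_pos, Finset.coe_filter, Finset.mem_univ, true_and, Set.mem_ofPred_eq]
      rw [mul_pow, inv_pow, mul_inv_eq_one]
      ext
      simp only [Units.val_pow_eq_pow_val, ZMod.coe_unitOfCoprime]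
      have h1 := hsub y hy' w hw
      have hc4 : IsCoprime (p : ℤ) 4 := by
        have : IsCoprime (p : ℤ) 2 := by
          rw [show (2 : ℤ) = ((2 : ℕ) : ℤ) by norm_num, Nat.isCoprime_iff_coprime]
          exact (Nat.coprime_primes hp Nat.prime_two).2 hp2
        simpa using IsCoprime.pow_right (n := 2) this
      push_cast at h1
      have h2 := (IsCoprime.pow_left hpa).dvd_of_dvd_mul_left
        ((IsCoprime.pow_left (m := k) hc4).dvd_of_dvd_mul_left h1)
      have h5 : ((((y : ℤ) ^ 3 - (w : ℤ) ^ 3 : ℤ)) : ZMod (p ^ k)) = 0 := by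
        rw [ZMod.intCast_zmod_eq_zero_iff_dvd]; exact_mod_cast h2
      push_cast at h5
      exact sub_eq_zero.1 h5
    · intro y hy z hz h
      have hy' : y ∈ T := hy
      have hz' : z ∈ T := hz
      simp only [hy', hz', dif_pos] at h
      have h1 := congrArg Units.val (mul_right_cancel h)
      simp only [ZMod.coe_unitOfCoprime] at h1
      rw [ZMod.natCast_eq_natCast_iff] at h1
      exact Nat.ModEq.eq_of_lt_of_lt h1 (Finset.mem_range.1 (Finset.mem_filter.1 hy').1)
        (Finset.mem_range.1 (Finset.mem_filter.1 hz').1)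

/-- Stationary phase: with `x = y + p^m z` and `2m ≥ h` the phase is linear in `z`. The inner sum
vanishes unless `4ay³ + b ≡ 0` modulo `p^{m'}`, where `m + m' = h`. That condition sees `y` only
modulo `p^{m'}`, so at most `4 p^{m-m'}` values of `y` contribute `p^{m'}` each. -/
lemma norm_sum_units_quartic_le {p h : ℕ} (hp : p.Prime) (hh : 2 ≤ h) (a b : ℤ)
    (ha : ¬ (p : ℤ) ∣ a) :
    ‖∑ x ∈ Finset.range (p ^ h), if p ∣ x then 0 else ez (p ^ h) (a * (x : ℤ) ^ 4 + b * x)‖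
      ≤ 4 * (p : ℝ) ^ (h - h / 2) := by
  set m' := h / 2 with hm'
  set m := h - m' with hm
  have hmm : p ^ h = p ^ m * p ^ m' := by rw [← pow_add]; congr 1; omega
  have hm1 : p ∣ p ^ m := dvd_pow_self p (by omega)
  have hm1' : p ∣ p ^ m' := dvd_pow_self p (by omega)
  have hpp : ∀ j, 0 < p ^ j := fun j => pow_pos hp.pos j
  have hA : ((p ^ h : ℕ) : ℤ) ∣ ((p ^ m : ℕ) : ℤ) ^ 2 := by
    have : p ^ h ∣ (p ^ m) ^ 2 := by rw [← pow_mul]; exact pow_dvd_pow p (by omega)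
    exact_mod_cast this
  have hphase : ∀ y z : ℕ, ez (p ^ h) (a * ((y + p ^ m * z : ℕ) : ℤ) ^ 4 + b * (y + p ^ m * z : ℕ))
      = ez (p ^ h) (a * (y : ℤ) ^ 4 + b * y) * ez (p ^ m') ((4 * a * (y : ℤ) ^ 3 + b) * z) := by
    intro y z
    rw [← ez_mul_left (hpp m) ((4 * a * (y : ℤ) ^ 3 + b) * z), ← hmm, ← ez_add]
    apply ez_congr
    refine hA.trans ⟨a * (6 * y ^ 2 * z ^ 2 + 4 * y * (p ^ m : ℕ) * z ^ 3 +
      (p ^ m : ℕ) ^ 2 * z ^ 4), ?_⟩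
    push_cast
    ring
  set S := (Finset.range (p ^ m')).filter fun y : ℕ => ¬ p ∣ y ∧
      ((p ^ m' : ℕ) : ℤ) ∣ 4 * a * (y : ℤ) ^ 3 + b with hS
  have hSc := card_cube_roots_le (k := m') hp a b ha
  rw [hmm, sum_range_mul_eq]
  rw [← hmm]
  have h1 : ∀ y ∈ Finset.range (p ^ m), ‖∑ z ∈ Finset.range (p ^ m'),
      (if p ∣ y + p ^ m * z then (0 : ℂ) else
        ez (p ^ h) (a * ((y + p ^ m * z : ℕ) : ℤ) ^ 4 + b * (y + p ^ m * z : ℕ)))‖ ≤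
      if ¬ p ∣ y ∧ ((p ^ m' : ℕ) : ℤ) ∣ 4 * a * (y : ℤ) ^ 3 + b then (p : ℝ) ^ m' else 0 := by
    intro y _
    have hdvd : ∀ z, p ∣ y + p ^ m * z ↔ p ∣ y := fun z =>
      (Nat.dvd_add_left (hm1.mul_right z))
    simp only [hdvd]
    by_cases hy : p ∣ y
    · simp [hy]
    · simp only [hy, if_false, not_false_eq_true, true_and, hphase]
      rw [← Finset.mul_sum, sum_ez_mul (hpp m'), norm_mul, norm_ez, one_mul]
      split_ifs <;> simp
  refine (norm_sum_le _ _).trans ((Finset.sum_le_sum h1).trans ?_)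
  rw [show p ^ m = p ^ m' * p ^ (m - m') by rw [← pow_add]; congr 1; omega, sum_range_mul_eq]
  have h2 : ∀ y z : ℕ, (¬ p ∣ y + p ^ m' * z ∧
      ((p ^ m' : ℕ) : ℤ) ∣ 4 * a * ((y + p ^ m' * z : ℕ) : ℤ) ^ 3 + b) ↔
      (¬ p ∣ y ∧ ((p ^ m' : ℕ) : ℤ) ∣ 4 * a * (y : ℤ) ^ 3 + b) := by
    intro y z
    have hd : ((p ^ m' : ℕ) : ℤ) ∣ (4 * a * ((y + p ^ m' * z : ℕ) : ℤ) ^ 3 + b) -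
        (4 * a * (y : ℤ) ^ 3 + b) := by
      refine ⟨4 * a * z * (3 * y ^ 2 + 3 * y * ((p ^ m' : ℕ) * z) + ((p ^ m' : ℕ) * z) ^ 2), ?_⟩
      push_cast
      ring
    rw [Nat.dvd_add_left (hm1'.mul_right z), ← dvd_iff_dvd_of_dvd_sub hd]
  simp only [h2, Finset.sum_const, Finset.card_range]
  rw [← Finset.smul_sum, ← Finset.sum_filter, ← hS, Finset.sum_const, nsmul_eq_mul, nsmul_eq_mul]
  have h3 : (S.card : ℝ) ≤ 4 := by exact_mod_cast hSc
  calc ((p ^ (m - m') : ℕ) : ℝ) * (S.card * (p : ℝ) ^ m')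
      ≤ ((p ^ (m - m') : ℕ) : ℝ) * (4 * (p : ℝ) ^ m') := by gcongr
    _ = 4 * ((p : ℝ) ^ (m - m') * (p : ℝ) ^ m') := by push_cast; ring
    _ = 4 * (p : ℝ) ^ m := by rw [← pow_add]; congr 2; omega

lemma sum_range_dvd {p h : ℕ} (hp : p.Prime) (hh : 1 ≤ h) (F : ℕ → ℂ) :
    ∑ x ∈ Finset.range (p ^ h), (if p ∣ x then F x else 0) =
      ∑ z ∈ Finset.range (p ^ (h - 1)), F (p * z) := by
  obtain ⟨k, rfl⟩ := Nat.exists_eq_add_of_le hh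
  rw [show p ^ (1 + k) = p * p ^ k by ring, sum_range_mul_eq, Nat.add_sub_cancel_left]
  rw [Finset.sum_eq_single 0]
  · simp
  · intro y hy hy0
    refine Finset.sum_eq_zero fun z _ => if_neg ?_
    rw [Nat.dvd_add_left (Dvd.intro _ rfl)]
    exact fun h => absurd (Nat.le_of_dvd (by omega) h) (by rw [Finset.mem_range] at hy; omega)
  · intro h
    exact absurd (Finset.mem_range.2 hp.pos) h

/-- For `x = p(y + p^{h-4} z)` the quartic part depends on `y` alone. The sum over `z` modulo `p³`
is therefore a complete linear sum, which forces `p³ ∣ b` and leaves a quartic sum to modulus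
`p^{h-4}`. -/
lemma sum_dvd_quartic_eq {p h : ℕ} (hp : p.Prime) (hh : 5 ≤ h) (a b : ℤ) :
    ∑ x ∈ Finset.range (p ^ h), (if p ∣ x then ez (p ^ h) (a * (x : ℤ) ^ 4 + b * x) else 0) =
      if ((p : ℤ) ^ 3 ∣ b) then (p : ℂ) ^ 3 * quarticSum (p ^ (h - 4)) a (b / p ^ 3) else 0 := by
  obtain ⟨k, rfl⟩ := Nat.exists_eq_add_of_le (show 4 ≤ h by omega)
  have hpp : ∀ j, 0 < p ^ j := fun j => pow_pos hp.pos j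
  rw [sum_range_dvd hp (by omega) fun x => ez (p ^ (4 + k)) (a * (x : ℤ) ^ 4 + b * x),
    show p ^ (4 + k - 1) = p ^ k * p ^ 3 by rw [← pow_add]; congr 1; omega, sum_range_mul_eq,
    Nat.add_sub_cancel_left]
  have h1 : ∀ y z : ℕ, ez (p ^ (4 + k)) (a * ((p * (y + p ^ k * z) : ℕ) : ℤ) ^ 4 +
      b * (p * (y + p ^ k * z) : ℕ)) =
      ez (p ^ (k + 3)) (a * (p : ℤ) ^ 3 * (y : ℤ) ^ 4 + b * y) * ez (p ^ 3) (b * z) := by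
    intro y z
    rw [← ez_mul_left (hpp k) (b * z), ← ez_mul_left hp.pos (a * (p : ℤ) ^ 3 * (y : ℤ) ^ 4 + b * y),
      ← ez_mul_left hp.pos (((p ^ k : ℕ) : ℤ) * (b * z)), ← pow_add, ← pow_succ', ← ez_add,
      show k + 3 + 1 = 4 + k by ring]
    apply ez_congr
    refine ⟨a * (4 * y ^ 3 * z + 6 * y ^ 2 * z ^ 2 * (p : ℤ) ^ k + 4 * y * z ^ 3 * (p : ℤ) ^ (2 * k)
      + z ^ 4 * (p : ℤ) ^ (3 * k)), ?_⟩
    push_cast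
    ring
  simp only [h1]
  rw [Finset.sum_congr rfl fun y _ => by
    rw [← Finset.mul_sum, sum_ez_mul (hpp 3)], ← Finset.sum_mul]
  push_cast
  split_ifs with hb
  · obtain ⟨c, rfl⟩ := hb
    rw [Int.mul_ediv_cancel_left _ (by exact_mod_cast (hpp 3).ne'), mul_comm]
    unfold quarticSum
    congr 1
    refine Finset.sum_congr rfl fun y _ => ?_
    rw [← ez_mul_left (hpp 3) (a * (y : ℤ) ^ 4 + c * y), ← pow_add, add_comm 3 k]
    congr 1
    push_cast
    ring
  · simp

/-- `V` stands for the contribution of the multiples of `p`: trivially estimated for `h ≤ 4`,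
recursive from `h = 5` on. It is left free so that small and large primes can balance it
differently. -/
lemma norm_quarticSum_prime_pow_step {p h : ℕ} (hp : p.Prime) (hh : 2 ≤ h) (a b : ℤ)
    (ha : ¬ (p : ℤ) ∣ a) {V : ℝ} (hV : h ≤ 4 → (p : ℝ) ^ (h - 1) ≤ V)
    (hV' : 5 ≤ h → ∀ c, (p : ℝ) ^ 3 * ‖quarticSum (p ^ (h - 4)) a c‖ ≤ V) :
    ‖quarticSum (p ^ h) a b‖ ≤ 4 * (p : ℝ) ^ (h - h / 2) + V := by
  have h0 : quarticSum (p ^ h) a b =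
      (∑ x ∈ Finset.range (p ^ h), if p ∣ x then 0 else ez (p ^ h) (a * (x : ℤ) ^ 4 + b * x)) +
      ∑ x ∈ Finset.range (p ^ h), if p ∣ x then ez (p ^ h) (a * (x : ℤ) ^ 4 + b * x) else 0 := by
    unfold quarticSum
    rw [← Finset.sum_add_distrib]
    refine Finset.sum_congr rfl fun x _ => ?_
    split_ifs <;> simp
  rw [h0]
  refine (norm_add_le _ _).trans (add_le_add (norm_sum_units_quartic_le hp hh a b ha) ?_)
  rcases le_or_gt h 4 with h4 | h4
  · refine le_trans ?_ (hV h4)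
    rw [sum_range_dvd hp (by omega) fun x => ez (p ^ h) (a * (x : ℤ) ^ 4 + b * x)]
    refine (norm_sum_le _ _).trans ?_
    simp
  · rw [sum_dvd_quartic_eq hp h4]
    split_ifs
    · have := hV' h4 (b / p ^ 3)
      simpa using this
    · have := hV' h4 0
      rw [norm_zero]
      exact le_trans (by positivity) this

lemma exists_prime_pow_bound {p : ℕ} (hp : p.Prime) :
    ∃ K : ℝ, 1 ≤ K ∧ ∀ h : ℕ, ∀ a b : ℤ, ¬ (p : ℤ) ∣ a →
      ‖quarticSum (p ^ h) a b‖ ≤ K * ((p ^ h : ℕ) : ℝ) ^ (151 / 200 : ℝ) := by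
  have hp1 : (1 : ℝ) < p := by exact_mod_cast hp.one_lt
  have hp0 : (0 : ℝ) < p := by linarith
  set r : ℝ := (p : ℝ) ^ (-(1 / 50) : ℝ) with hr
  have hr1 : r < 1 := Real.rpow_lt_one_of_one_lt_of_neg hp1 (by norm_num)
  have hr0 : 0 < r := by positivity
  -- A step from `h - 4` to `h` costs `p³` and gains `p^{4·151/200}`, a net factor `r = p^{-1/50}`.
  -- The value `4/(1 - r)` is the fixed point of `K = 4 + rK`; `p⁴` covers `h ≤ 4` trivially.
  refine ⟨max ((p : ℝ) ^ 4) (4 / (1 - r)), le_max_of_le_left (one_le_pow₀ hp1.le), ?_⟩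
  set K := max ((p : ℝ) ^ 4) (4 / (1 - r)) with hK
  have hK2 : 4 + r * K ≤ K := by
    have : 4 / (1 - r) ≤ K := le_max_right _ _
    rw [div_le_iff₀ (by linarith)] at this
    linarith
  have hK0 : 0 < K := lt_of_lt_of_le (by positivity) (le_max_left _ _)
  intro h
  induction h using Nat.strong_induction_on with
  | _ h ih =>
  intro a b ha
  push_cast
  rw [← Real.rpow_natCast_mul hp0.le]
  rcases le_or_gt h 4 with h4 | h4
  · calc ‖quarticSum (p ^ h) a b‖ ≤ ((p ^ h : ℕ) : ℝ) := norm_quarticSum_le _ _ _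
      _ ≤ (p : ℝ) ^ 4 := by push_cast; exact pow_le_pow_right₀ hp1.le h4
      _ ≤ K * 1 := by rw [mul_one]; exact le_max_left _ _
      _ ≤ _ := by
        gcongr
        exact Real.one_le_rpow hp1.le (by positivity)
  · have h4' : (5 : ℝ) ≤ h := by exact_mod_cast h4
    refine (norm_quarticSum_prime_pow_step (V := r * K * (p : ℝ) ^ ((h : ℝ) * (151 / 200)))
      hp (by omega) a b ha (by omega) ?_).trans ?_
    · intro _ c
      have h5 := ih (h - 4) (by omega) a c ha
      push_cast at h5
      rw [← Real.rpow_natCast_mul hp0.le, Nat.cast_sub (by omega)] at h5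
      calc (p : ℝ) ^ 3 * ‖quarticSum (p ^ (h - 4)) a c‖
          ≤ (p : ℝ) ^ 3 * (K * (p : ℝ) ^ (((h : ℝ) - (4 : ℕ)) * (151 / 200))) := by gcongr
        _ = K * ((p : ℝ) ^ (3 : ℝ) * (p : ℝ) ^ (((h : ℝ) - (4 : ℕ)) * (151 / 200))) := by
          rw [show (p : ℝ) ^ (3 : ℝ) = (p : ℝ) ^ 3 by norm_cast]; ring
        _ = K * ((p : ℝ) ^ (-(1 / 50) : ℝ) * (p : ℝ) ^ ((h : ℝ) * (151 / 200))) := by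
          rw [← Real.rpow_add hp0, ← Real.rpow_add hp0]; congr 2; push_cast; ring
        _ = _ := by rw [hr]; ring
    · have h6 : (p : ℝ) ^ (h - h / 2) ≤ (p : ℝ) ^ ((h : ℝ) * (151 / 200)) := by
        rw [← Real.rpow_natCast]
        apply Real.rpow_le_rpow_of_exponent_le hp1.le
        have : 2 * (h - h / 2) ≤ h + 1 := by omega
        have : 2 * ((h - h / 2 : ℕ) : ℝ) ≤ h + 1 := by exact_mod_cast this
        linarith
      calc _ ≤ 4 * (p : ℝ) ^ ((h : ℝ) * (151 / 200)) + r * K * (p : ℝ) ^ ((h : ℝ) * (151 / 200)) := by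
            gcongr
        _ = (4 + r * K) * (p : ℝ) ^ ((h : ℝ) * (151 / 200)) := by ring
        _ ≤ _ := by gcongr

/-- For all but finitely many primes the constant has to be exactly 1, since constants multiply over
the primes dividing `q`. The factor `5 = 4 + 1` of the recursive step is absorbed by a spare
`p^{1/200}`. The tightest case is `h = 4`, where `p³` must not exceed `p^{3.015}`. -/
lemma large_prime_pow_bound {p : ℕ} (hp : p.Prime) (hp5 : 5 ≤ (p : ℝ) ^ (1 / 200 : ℝ)) (h : ℕ) :
    ∀ a b : ℤ, ¬ (p : ℤ) ∣ a →
      ‖quarticSum (p ^ h) a b‖ ≤ ((p ^ h : ℕ) : ℝ) ^ (151 / 200 : ℝ) := by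
  have hp1 : (1 : ℝ) < p := by exact_mod_cast hp.one_lt
  have hp0 : (0 : ℝ) < p := by linarith
  induction h using Nat.strong_induction_on with
  | _ h ih =>
  intro a b ha
  push_cast
  rw [← Real.rpow_natCast_mul hp0.le]
  rcases Nat.lt_or_ge h 2 with h2 | h2
  · interval_cases h
    · simp [quarticSum]
    · have hp2 : p ≠ 2 := by
        rintro rfl
        have : ((2 : ℕ) : ℝ) ^ (1 / 200 : ℝ) ≤ ((2 : ℕ) : ℝ) ^ (1 : ℝ) :=
          Real.rpow_le_rpow_of_exponent_le (by norm_num) (by norm_num)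
        norm_num at this hp5
        linarith
      rw [pow_one]
      refine (norm_quarticSum_prime_le hp hp2 a b ha).trans ?_
      calc 3 * (p : ℝ) ^ (3 / 4 : ℝ) ≤ (p : ℝ) ^ (1 / 200 : ℝ) * (p : ℝ) ^ (3 / 4 : ℝ) := by
            gcongr; linarith
        _ = _ := by rw [← Real.rpow_add hp0]; norm_num
  · have h2' : (2 : ℝ) ≤ h := by exact_mod_cast h2
    set W : ℝ := (p : ℝ) ^ ((h : ℝ) * (151 / 200) - 1 / 200) with hW
    have hstep : ‖quarticSum (p ^ h) a b‖ ≤ 4 * (p : ℝ) ^ (h - h / 2) + W := by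
      apply norm_quarticSum_prime_pow_step hp h2 a b ha
      · intro h4
        rw [← Real.rpow_natCast, Nat.cast_sub (by omega)]
        apply Real.rpow_le_rpow_of_exponent_le hp1.le
        have : (h : ℝ) ≤ 4 := by exact_mod_cast h4
        push_cast
        linarith
      · intro h5 c
        have h6 := ih (h - 4) (by omega) a c ha
        push_cast at h6
        rw [← Real.rpow_natCast_mul hp0.le, Nat.cast_sub (by omega)] at h6
        calc (p : ℝ) ^ 3 * ‖quarticSum (p ^ (h - 4)) a c‖
            ≤ (p : ℝ) ^ (3 : ℝ) * (p : ℝ) ^ (((h : ℝ) - (4 : ℕ)) * (151 / 200)) := by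
              rw [show (p : ℝ) ^ (3 : ℝ) = (p : ℝ) ^ 3 by norm_cast]; gcongr
          _ = (p : ℝ) ^ (3 + ((h : ℝ) - (4 : ℕ)) * (151 / 200)) := by rw [← Real.rpow_add hp0]
          _ ≤ _ := by
            apply Real.rpow_le_rpow_of_exponent_le hp1.le
            push_cast
            linarith
    have hm : (p : ℝ) ^ (h - h / 2) ≤ W := by
      rw [← Real.rpow_natCast]
      apply Real.rpow_le_rpow_of_exponent_le hp1.le
      rcases h2.eq_or_lt with rfl | h3
      · norm_num
      · have h3' : (3 : ℝ) ≤ h := by exact_mod_cast h3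
        have : 2 * (h - h / 2) ≤ h + 1 := by omega
        have : 2 * ((h - h / 2 : ℕ) : ℝ) ≤ h + 1 := by exact_mod_cast this
        linarith
    calc ‖quarticSum (p ^ h) a b‖ ≤ 5 * W := by linarith
      _ ≤ (p : ℝ) ^ (1 / 200 : ℝ) * W := by gcongr
      _ = _ := by rw [hW, ← Real.rpow_add hp0]; congr 1; ring

/-- Hua's bound (up to an arbitrarily small power) for complete quartic sums. -/
theorem exists_quarticSum_bound : ∃ K : ℝ, 0 < K ∧ ∀ q : ℕ, 0 < q → ∀ a b : ℤ,
    IsCoprime a (q : ℤ) → ‖quarticSum q a b‖ ≤ K * (q : ℝ) ^ (151 / 200 : ℝ) := by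
  classical
  have hex : ∀ p : ℕ, ∃ K : ℝ, 1 ≤ K ∧ (5 ≤ (p : ℝ) ^ (1 / 200 : ℝ) → K = 1) ∧
      (p.Prime → ∀ h : ℕ, ∀ a b : ℤ, ¬ (p : ℤ) ∣ a →
        ‖quarticSum (p ^ h) a b‖ ≤ K * ((p ^ h : ℕ) : ℝ) ^ (151 / 200 : ℝ)) := by
    intro p
    by_cases hp5 : 5 ≤ (p : ℝ) ^ (1 / 200 : ℝ)
    · refine ⟨1, le_rfl, fun _ => rfl, fun hp h a b ha => ?_⟩
      rw [one_mul]
      exact large_prime_pow_bound hp hp5 h a b ha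
    · by_cases hp : p.Prime
      · obtain ⟨K, hK, h⟩ := exists_prime_pow_bound hp
        exact ⟨K, hK, fun h => absurd h hp5, fun _ => h⟩
      · exact ⟨1, le_rfl, fun _ => rfl, fun h => absurd h hp⟩
  choose K hK1 hKl hK using hex
  have hmain : ∀ q : ℕ, 0 < q → ∀ a b : ℤ, IsCoprime a (q : ℤ) →
      ‖quarticSum q a b‖ ≤ (∏ p ∈ q.primeFactors, K p) * (q : ℝ) ^ (151 / 200 : ℝ) := by
    intro q
    induction q using Nat.recOnPosPrimePosCoprime with
    | prime_pow p n hp hn =>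
      intro _ a b hab
      rw [Nat.primeFactors_prime_pow hn.ne' hp, Finset.prod_singleton]
      refine hK p hp n a b fun hd => ?_
      have h1 : IsCoprime a (p : ℤ) := by
        push_cast at hab
        exact (IsCoprime.pow_right_iff hn).1 hab
      exact (Nat.prime_iff_prime_int.1 hp).not_isUnit (h1.symm.isUnit_of_dvd' dvd_rfl hd)
    | zero => intro h; exact absurd h (lt_irrefl 0)
    | one => intro _ a b _; simp [quarticSum]
    | coprime m n hm hn hmn ihm ihn =>
      intro _ a b hab
      have hm0 : 0 < m := by omega
      have hn0 : 0 < n := by omega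
      push_cast at hab
      have hc : IsCoprime (m : ℤ) n := Nat.isCoprime_iff_coprime.2 hmn
      have ham : IsCoprime a (m : ℤ) := hab.of_mul_right_left
      have han : IsCoprime a (n : ℤ) := hab.of_mul_right_right
      rw [quarticSum_mul hm0 hn0 hmn, norm_mul, hmn.primeFactors_mul,
        Finset.prod_union hmn.disjoint_primeFactors]
      push_cast
      rw [Real.mul_rpow (by positivity) (by positivity)]
      calc _ ≤ ((∏ p ∈ m.primeFactors, K p) * (m : ℝ) ^ (151 / 200 : ℝ)) *
            ((∏ p ∈ n.primeFactors, K p) * (n : ℝ) ^ (151 / 200 : ℝ)) := by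
            refine mul_le_mul (ihm hm0 _ _ (ham.mul_left hc.symm.pow_left))
              (ihn hn0 _ _ (han.mul_left hc.pow_left)) (norm_nonneg _) ?_
            exact mul_nonneg (Finset.prod_nonneg fun p _ => by linarith [hK1 p]) (by positivity)
        _ = _ := by ring
  -- Beyond `5^200` one has `p^{1/200} ≥ 5` and the local constant is 1, so the product over the
  -- primes dividing `q` is bounded independently of `q`.
  set B : Finset ℕ := Finset.range (5 ^ 200) with hB
  refine ⟨∏ p ∈ B, K p, Finset.prod_pos fun p _ => by linarith [hK1 p], fun q hq a b hab => ?_⟩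
  refine (hmain q hq a b hab).trans (mul_le_mul_of_nonneg_right ?_ (by positivity))
  calc ∏ p ∈ q.primeFactors, K p = ∏ p ∈ q.primeFactors.filter (· ∈ B), K p := by
        rw [Finset.prod_filter]
        refine Finset.prod_congr rfl fun p _ => ?_
        split_ifs with h
        · rfl
        · apply hKl
          rw [hB, Finset.mem_range, not_lt] at h
          have h5 : ((5 : ℝ) ^ 200) ≤ p := by exact_mod_cast h
          calc (5 : ℝ) = ((5 : ℝ) ^ 200) ^ (1 / 200 : ℝ) := by
                rw [← Real.rpow_natCast, ← Real.rpow_mul (by norm_num)]; norm_num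
            _ ≤ _ := by gcongr
    _ ≤ ∏ p ∈ B, K p := by
        have hsub : q.primeFactors.filter (· ∈ B) ⊆ B := fun p hp => (Finset.mem_filter.1 hp).2
        rw [← Finset.prod_sdiff hsub]
        exact le_mul_of_one_le_left (Finset.prod_nonneg fun p _ => by linarith [hK1 p])
          (Finset.prod_induction _ (fun x : ℝ => 1 ≤ x) (fun _ _ => one_le_mul_of_one_le_of_one_le)
            le_rfl fun p _ => hK1 p)

/-! ### Weyl sums on the major arcs: upper bounds -/

/-- Fourier inversion modulo `q`. The window of frequencies may start at any `b₀`, so that it can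
later be centred where the phase derivative lies. -/
lemma sum_quarticSum_mul {q : ℕ} (hq : 0 < q) (a b₀ : ℤ) (x : ℕ) :
    ∑ i ∈ Finset.range q, quarticSum q a (b₀ + i) * ez q (-((b₀ + i) * x)) =
      q * ez q (a * (x : ℤ) ^ 4) := by
  unfold quarticSum
  simp only [Finset.sum_mul]
  rw [Finset.sum_comm]
  have h1 : ∀ y ∈ Finset.range q, ∑ i ∈ Finset.range q,
      ez q (a * (y : ℤ) ^ 4 + (b₀ + i) * y) * ez q (-((b₀ + i) * x)) =
      if y = x % q then (q : ℂ) * ez q (a * (x : ℤ) ^ 4) else 0 := by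
    intro y hy
    have h2 : ∀ i : ℕ, ez q (a * (y : ℤ) ^ 4 + (b₀ + i) * y) * ez q (-((b₀ + i) * x)) =
        ez q (a * (y : ℤ) ^ 4 + b₀ * ((y : ℤ) - x)) * ez q (((y : ℤ) - x) * i) := by
      intro i; rw [← ez_add, ← ez_add]; congr 1; ring
    rw [Finset.sum_congr rfl fun i _ => h2 i, ← Finset.mul_sum, sum_ez_mul hq]
    have h3 : (q : ℤ) ∣ (y : ℤ) - x ↔ y = x % q := by
      rw [← Int.modEq_iff_dvd, Int.natCast_modEq_iff]
      unfold Nat.ModEq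
      rw [Nat.mod_eq_of_lt (Finset.mem_range.1 hy)]
      exact eq_comm
    by_cases h : y = x % q
    · rw [if_pos (h3.2 h), if_pos h, mul_comm]
      congr 1
      apply ez_congr
      have := quartic_dvd a 0 _ _ (h3.2 h)
      have h4 := (h3.2 h).mul_left b₀
      have h5 := dvd_add this h4
      rwa [show a * (y : ℤ) ^ 4 + 0 * y - (a * (x : ℤ) ^ 4 + 0 * x) + b₀ * ((y : ℤ) - x) =
        a * (y : ℤ) ^ 4 + b₀ * ((y : ℤ) - x) - a * (x : ℤ) ^ 4 by ring] at h5
    · rw [if_neg (fun h' => h (h3.1 h')), if_neg h, mul_zero]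
  rw [Finset.sum_congr rfl h1, Finset.sum_ite_eq' , if_pos]
  exact Finset.mem_range.2 (Nat.mod_lt _ hq)

lemma sum_inv_le_one_add_log {ι : Type*} (S : Finset ι) (φ : ι → ℕ) (q : ℕ)
    (hinj : Set.InjOn φ S) (h : ∀ i ∈ S, 1 ≤ φ i ∧ φ i ≤ q) :
    ∑ i ∈ S, (1 / (φ i : ℝ)) ≤ 1 + Real.log q := by
  rw [← Finset.sum_image (f := fun n : ℕ => (1 / (n : ℝ))) hinj]
  have h1 := harmonic_le_one_add_log q
  rw [harmonic_eq_sum_Icc] at h1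
  push_cast at h1
  refine le_trans ?_ h1
  simp only [one_div]
  apply Finset.sum_le_sum_of_subset_of_nonneg
  · intro n hn
    obtain ⟨i, hi, rfl⟩ := Finset.mem_image.1 hn
    exact Finset.mem_Icc.2 (h i hi)
  · intro n _ _; positivity

/-- A quartic Weyl sum over a short block: completion modulo `q`, the Kusmin–Landau inequality
for all but two frequencies and the van der Corput bound `R` for these two. -/
lemma norm_block_sum_le {q : ℕ} (hq : 0 < q) (a : ℤ) {B : ℝ}
    (hB : ∀ b, ‖quarticSum q a b‖ ≤ B) {t R : ℝ} (N L : ℕ)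
    (hR : (L : ℝ) ≤ R ∨ (0 < t ∧ 8 * (1 + 1 / t) ≤ R))
    (hvar : ∀ n ≤ L, t ^ 4 * ((((N + n : ℕ) : ℝ) + 1) ^ 4 - ((N + n : ℕ) : ℝ) ^ 4 -
      (((N : ℝ) + 1) ^ 4 - (N : ℝ) ^ 4)) ≤ 1 / (8 * q)) :
    ‖∑ n ∈ Finset.range L, ez q (a * ((N + n : ℕ) : ℤ) ^ 4) * e (t ^ 4 * ((N + n : ℕ) : ℝ) ^ 4)‖
      ≤ B / q * (2 * R + 4 * q * (1 + Real.log q)) := by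
  have hq0 : (0 : ℝ) < q := by exact_mod_cast hq
  have hq1 : (1 : ℝ) ≤ q := by exact_mod_cast hq
  have hB0 : 0 ≤ B := (norm_nonneg _).trans (hB 0)
  set μ : ℝ := t ^ 4 * (((N : ℝ) + 1) ^ 4 - (N : ℝ) ^ 4) with hμ
  -- The `q` frequencies `b₀, …, b₀ + q - 1` lie within `q/2` of `qμ`. As `D` exceeds `μ` by at most
  -- `1/(8q) ≤ 1/8`, all differences `D n - b/q` are at most `5/8` in absolute value.
  set b₀ : ℤ := ⌈q * μ - q / 2⌉ with hb₀
  set β : ℤ := ⌊q * μ⌋ with hβ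
  set ψ : ℤ → ℕ → ℝ := fun b n => t ^ 4 * ((N + n : ℕ) : ℝ) ^ 4 - b * ((N + n : ℕ) : ℝ) / q with hψ
  set D : ℕ → ℝ := fun n => t ^ 4 * ((((N + n : ℕ) : ℝ) + 1) ^ 4 - ((N + n : ℕ) : ℝ) ^ 4) with hD
  have hdiff : ∀ b n, ψ b (n + 1) - ψ b n = D n - b / q := by
    intro b n
    simp only [hψ, hD]
    push_cast
    field_simp
    ring
  have hgrow : ∀ m n : ℕ, m ≤ n → 4 * t ^ 4 * ((n : ℝ) - m) ^ 3 ≤ D n - D m := by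
    intro m n hmn
    have h1 : (m : ℝ) ≤ n := by exact_mod_cast hmn
    have h2 : (0 : ℝ) ≤ N := by positivity
    have h3 : (0 : ℝ) ≤ m := by positivity
    obtain ⟨d, hd⟩ : ∃ d : ℝ, (n : ℝ) = m + d := ⟨n - m, by ring⟩
    have hd0 : 0 ≤ d := by linarith
    have h4 : D n - D m - 4 * t ^ 4 * ((n : ℝ) - m) ^ 3 =
        t ^ 4 * (12 * (N + m) ^ 2 * d + 12 * (N + m) * d ^ 2 + 12 * (N + m) * d + 6 * d ^ 2
          + 4 * d) := by
      simp only [hD]; push_cast; rw [hd]; ring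
    have h5 : 0 ≤ t ^ 4 * (12 * (N + m) ^ 2 * d + 12 * (N + m) * d ^ 2 + 12 * (N + m) * d
        + 6 * d ^ 2 + 4 * d) := by positivity
    linarith
  have hDlo : ∀ n, μ ≤ D n := by
    intro n
    have h1 := hgrow 0 n (Nat.zero_le _)
    have h2 : 0 ≤ 4 * t ^ 4 * ((n : ℝ) - (0 : ℕ)) ^ 3 := by push_cast; rw [sub_zero]; positivity
    have h3 : D 0 = μ := by simp [hD, hμ]
    linarith
  have hDhi : ∀ n < L, D n ≤ μ + 1 / (8 * q) := by
    intro n hn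
    have := hvar n hn.le
    simp only [hD, hμ]
    linarith
  have hmonoD : ∀ b n, ψ b (n + 1) - ψ b n ≤ ψ b (n + 2) - ψ b (n + 1) := by
    intro b n
    rw [show n + 2 = (n + 1) + 1 by ring, hdiff, hdiff]
    have h1 := hgrow n (n + 1) (Nat.le_succ _)
    have h2 : 0 ≤ 4 * t ^ 4 * (((n + 1 : ℕ) : ℝ) - n) ^ 3 := by
      push_cast; rw [add_sub_cancel_left]; positivity
    linarith
  have h8 : 1 / (8 * (q : ℝ)) ≤ 1 / 8 := by
    apply one_div_le_one_div_of_le <;> linarith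
  have hblo : ∀ i : ℕ, q * μ - q / 2 ≤ ((b₀ + i : ℤ) : ℝ) := by
    intro i
    have := Int.le_ceil (q * μ - q / 2)
    push_cast
    have hi : (0 : ℝ) ≤ i := by positivity
    linarith
  have hbhi : ∀ i < q, ((b₀ + i : ℤ) : ℝ) ≤ q * μ + q / 2 := by
    intro i hi
    have := Int.ceil_lt_add_one (q * μ - q / 2)
    have hi : (i : ℝ) + 1 ≤ q := by exact_mod_cast hi
    push_cast
    linarith
  have hbd : ∀ i < q, ∀ n < L, |ψ (b₀ + i) (n + 1) - ψ (b₀ + i) n| ≤ 5 / 8 := by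
    intro i hi n hn
    rw [hdiff, abs_le]
    have h1 := hblo i
    have h2 := hbhi i hi
    have h3 : μ - 1 / 2 ≤ ((b₀ + i : ℤ) : ℝ) / q := by
      rw [le_div_iff₀ hq0]; linarith
    have h4 : ((b₀ + i : ℤ) : ℝ) / q ≤ μ + 1 / 2 := by
      rw [div_le_iff₀ hq0]; linarith
    constructor <;> linarith [hDlo n, hDhi n hn]
  set E : ℤ → ℂ := fun b => ∑ n ∈ Finset.range L, e (ψ b n) with hE
  have hres : ∀ i < q, ‖E (b₀ + i)‖ ≤ R := by
    intro i hi
    rcases hR with hR | ⟨ht0, hR⟩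
    · refine le_trans ((norm_sum_le _ _).trans ?_) hR
      simp
    · refine le_trans (norm_sum_e_le_of_cubic_growth ht0 (hbd i hi) ?_) hR
      intro m n hmn _
      rw [hdiff, hdiff]
      linarith [hgrow m n hmn]
  -- Only `β` and `β + 1`, the neighbours of `qμ`, may have a stationary point in the block, and
  -- these get the bound `R`. For `β - j` and `β + 1 + j`, since `μ ≤ D n ≤ μ + 1/(8q)`, the
  -- differences keep a distance `j/(2q)` from 0 on one side. Kusmin–Landau then gives `2q/j`, and
  -- summing over `j` costs a logarithm.
  have hβ1 : (β : ℝ) ≤ q * μ := Int.floor_le _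
  have hβ2 : q * μ < β + 1 := Int.lt_floor_add_one _
  have hleft : ∀ i < q, b₀ + i < β → 1 ≤ (β - (b₀ + i)).toNat ∧ (β - (b₀ + i)).toNat ≤ q ∧
      ‖E (b₀ + i)‖ ≤ 2 * q * (1 / ((β - (b₀ + i)).toNat : ℝ)) := by
    intro i hi hlt
    obtain ⟨j, hj⟩ : ∃ j : ℕ, β - (b₀ + i) = j := ⟨_, (Int.toNat_of_nonneg (by omega)).symm⟩
    rw [hj, Int.toNat_natCast]
    have hj1 : 1 ≤ j := by omega
    have hj1' : (1 : ℝ) ≤ j := by exact_mod_cast hj1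
    have hbj : ((b₀ + i : ℤ) : ℝ) = β - j := by
      have : b₀ + i = β - j := by omega
      rw [this]; push_cast; ring
    have hjq : (j : ℝ) ≤ q / 2 := by
      have := hblo i
      rw [hbj] at this
      linarith
    refine ⟨hj1, by exact_mod_cast (by linarith : (j : ℝ) ≤ q), ?_⟩
    have h1 : 2 * (q : ℝ) * (1 / j) = 1 / (j / (2 * q)) := by field_simp
    rw [h1]
    apply kusmin_landau_signed (by positivity)
    · rw [div_le_iff₀ (by positivity)]; linarith
    · intro n _; exact hmonoD _ n
    · left
      intro n hn
      refine ⟨?_, (abs_le.1 (hbd i hi n hn)).2⟩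
      rw [hdiff, hbj, div_le_iff₀ (by positivity), sub_mul]
      have h3 := hDlo n
      have h2 : (β - j : ℝ) / q * (2 * q) = 2 * (β - j) := by field_simp
      rw [h2]
      nlinarith
  have hright : ∀ i < q, β + 1 < b₀ + i → 1 ≤ (b₀ + i - (β + 1)).toNat ∧
      (b₀ + i - (β + 1)).toNat ≤ q ∧
      ‖E (b₀ + i)‖ ≤ 2 * q * (1 / ((b₀ + i - (β + 1)).toNat : ℝ)) := by
    intro i hi hlt
    obtain ⟨j, hj⟩ : ∃ j : ℕ, b₀ + i - (β + 1) = j := ⟨_, (Int.toNat_of_nonneg (by omega)).symm⟩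
    rw [hj, Int.toNat_natCast]
    have hj1 : 1 ≤ j := by omega
    have hj1' : (1 : ℝ) ≤ j := by exact_mod_cast hj1
    have hbj : ((b₀ + i : ℤ) : ℝ) = β + 1 + j := by
      have : b₀ + i = β + 1 + j := by omega
      rw [this]; push_cast; ring
    have hjq : (j : ℝ) ≤ q / 2 := by
      have := hbhi i hi
      rw [hbj] at this
      linarith
    refine ⟨hj1, by exact_mod_cast (by linarith : (j : ℝ) ≤ q), ?_⟩
    have h1 : 2 * (q : ℝ) * (1 / j) = 1 / (j / (2 * q)) := by field_simp
    rw [h1]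
    apply kusmin_landau_signed (by positivity)
    · rw [div_le_iff₀ (by positivity)]; linarith
    · intro n _; exact hmonoD _ n
    · right
      intro n hn
      refine ⟨?_, (abs_le.1 (hbd i hi n hn)).1⟩
      rw [hdiff, hbj, le_neg, div_le_iff₀ (by positivity), neg_mul, sub_mul]
      have h3 := hDhi n hn
      have h2 : (β + 1 + j : ℝ) / q * (2 * q) = 2 * (β + 1 + j) := by field_simp
      have h4 : (μ + 1 / (8 * q)) * (2 * q) = 2 * (q * μ) + 1 / 4 := by field_simp; ring
      have h5 : D n * (2 * q) ≤ (μ + 1 / (8 * q)) * (2 * q) :=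
        mul_le_mul_of_nonneg_right h3 (by positivity)
      rw [h2]
      linarith
  have hR0 : 0 ≤ R := (norm_nonneg _).trans (hres 0 hq)
  have hsumE : ∑ i ∈ Finset.range q, ‖E (b₀ + i)‖ ≤ 2 * R + 4 * q * (1 + Real.log q) := by
    have hsplit : ∀ i ∈ Finset.range q, ‖E (b₀ + i)‖ ≤
        ((if b₀ + i = β then R else 0) + (if b₀ + i = β + 1 then R else 0)) +
        ((if b₀ + i < β then 2 * q * (1 / ((β - (b₀ + i)).toNat : ℝ)) else 0) +
        (if β + 1 < b₀ + i then 2 * q * (1 / ((b₀ + i - (β + 1)).toNat : ℝ)) else 0)) := by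
      intro i hi
      rw [Finset.mem_range] at hi
      rcases lt_trichotomy (b₀ + (i : ℤ)) β with h | h | h
      · have h1 := (hleft i hi h).2.2
        rw [if_neg h.ne, if_neg (by omega), if_pos h, if_neg (by omega)]
        linarith
      · have h1 := hres i hi
        rw [if_pos h, if_neg (by omega), if_neg (by omega), if_neg (by omega)]
        linarith
      · rcases (show β + 1 ≤ b₀ + (i : ℤ) by omega).eq_or_lt with h' | h'
        · have h1 := hres i hi
          rw [if_neg h.ne', if_pos h'.symm, if_neg (by omega), if_neg (by omega)]
          linarith
        · have h1 := (hright i hi h').2.2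
          rw [if_neg h.ne', if_neg (by omega), if_neg (by omega), if_pos h']
          linarith
    refine (Finset.sum_le_sum hsplit).trans ?_
    rw [Finset.sum_add_distrib, Finset.sum_add_distrib, Finset.sum_add_distrib]
    have hone : ∀ c : ℤ, ∑ i ∈ Finset.range q, (if b₀ + i = c then R else 0) ≤ R := by
      intro c
      rw [← Finset.sum_filter, Finset.sum_const, nsmul_eq_mul]
      refine mul_le_of_le_one_left hR0 ?_
      have : ((Finset.range q).filter fun i : ℕ => b₀ + i = c).card ≤ 1 := by
        rw [Finset.card_le_one]
        intro i hi j hj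
        have h1 := (Finset.mem_filter.1 hi).2
        have h2 := (Finset.mem_filter.1 hj).2
        omega
      exact_mod_cast this
    have hl : ∑ i ∈ Finset.range q, (if b₀ + i < β then
        2 * q * (1 / ((β - (b₀ + i)).toNat : ℝ)) else 0) ≤ 2 * q * (1 + Real.log q) := by
      rw [← Finset.sum_filter, ← Finset.mul_sum]
      refine mul_le_mul_of_nonneg_left (sum_inv_le_one_add_log _ _ q ?_ ?_) (by positivity)
      · intro i hi j hj hij
        have h1 := (Finset.mem_filter.1 hi).2
        have h2 := (Finset.mem_filter.1 hj).2
        simp only at hij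
        omega
      · intro i hi
        obtain ⟨h1, h2⟩ := Finset.mem_filter.1 hi
        have := hleft i (Finset.mem_range.1 h1) h2
        exact ⟨this.1, this.2.1⟩
    have hr : ∑ i ∈ Finset.range q, (if β + 1 < b₀ + i then
        2 * q * (1 / ((b₀ + i - (β + 1)).toNat : ℝ)) else 0) ≤ 2 * q * (1 + Real.log q) := by
      rw [← Finset.sum_filter, ← Finset.mul_sum]
      refine mul_le_mul_of_nonneg_left (sum_inv_le_one_add_log _ _ q ?_ ?_) (by positivity)
      · intro i hi j hj hij
        have h1 := (Finset.mem_filter.1 hi).2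
        have h2 := (Finset.mem_filter.1 hj).2
        simp only at hij
        omega
      · intro i hi
        obtain ⟨h1, h2⟩ := Finset.mem_filter.1 hi
        have := hright i (Finset.mem_range.1 h1) h2
        exact ⟨this.1, this.2.1⟩
    linarith [hone β, hone (β + 1)]
  have hid : (q : ℂ) * ∑ n ∈ Finset.range L,
      ez q (a * ((N + n : ℕ) : ℤ) ^ 4) * e (t ^ 4 * ((N + n : ℕ) : ℝ) ^ 4) =
      ∑ i ∈ Finset.range q, quarticSum q a (b₀ + i) * E (b₀ + i) := by
    rw [Finset.mul_sum]
    simp only [hE, Finset.mul_sum]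
    rw [Finset.sum_comm]
    refine Finset.sum_congr rfl fun n _ => ?_
    rw [← mul_assoc, ← sum_quarticSum_mul hq a b₀ (N + n), Finset.sum_mul]
    refine Finset.sum_congr rfl fun i _ => ?_
    rw [mul_assoc]
    congr 1
    unfold ez
    rw [← e_add]
    congr 1
    simp only [hψ]
    push_cast
    ring
  have hfin : (q : ℝ) * ‖∑ n ∈ Finset.range L,
      ez q (a * ((N + n : ℕ) : ℤ) ^ 4) * e (t ^ 4 * ((N + n : ℕ) : ℝ) ^ 4)‖ ≤
      B * (2 * R + 4 * q * (1 + Real.log q)) := by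
    calc _ = ‖∑ i ∈ Finset.range q, quarticSum q a (b₀ + i) * E (b₀ + i)‖ := by
          rw [← hid, norm_mul]; simp
      _ ≤ ∑ i ∈ Finset.range q, B * ‖E (b₀ + i)‖ := by
          refine (norm_sum_le _ _).trans (Finset.sum_le_sum fun i _ => ?_)
          rw [norm_mul]
          exact mul_le_mul_of_nonneg_right (hB _) (norm_nonneg _)
      _ ≤ _ := by
          rw [← Finset.mul_sum]
          exact mul_le_mul_of_nonneg_left hsumE hB0
  rw [div_mul_eq_mul_div, le_div_iff₀ hq0, mul_comm]
  exact hfin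

lemma norm_sum_range_le_of_blocks (F : ℕ → ℂ) (H : ℕ) (B : ℝ) (j : ℕ) :
    ∀ N₀, N₀ ≤ j * H →
      (∀ N L, L ≤ H → N + L ≤ N₀ → ‖∑ n ∈ Finset.range L, F (N + n)‖ ≤ B) →
      ‖∑ n ∈ Finset.range N₀, F n‖ ≤ j * B := by
  induction j with
  | zero => intro N₀ h _; have : N₀ = 0 := by omega
            simp [this]
  | succ j ih =>
    intro N₀ h hB
    have h1 := ih (min N₀ (j * H)) (min_le_right _ _) fun N L hL hN => hB N L hL (by omega)
    have h2 := hB (min N₀ (j * H)) (N₀ - min N₀ (j * H)) (by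
      rw [Nat.succ_mul] at h; omega) (by omega)
    have h3 : N₀ = min N₀ (j * H) + (N₀ - min N₀ (j * H)) := by omega
    rw [h3, Finset.sum_range_add]
    push_cast
    rw [add_mul, one_mul]
    exact (norm_add_le _ _).trans (add_le_add h1 h2)

lemma weylSum_neg (k : ℕ) (P α : ℝ) : weylSum k P (-α) = (starRingEnd ℂ) (weylSum k P α) := by
  unfold weylSum
  rw [map_sum]
  refine Finset.sum_congr rfl fun x _ => ?_
  rw [← e_neg, neg_mul]

lemma norm_weylSum_le {k : ℕ} {P : ℝ} (hP : 1 ≤ P) (α : ℝ) : ‖weylSum k P α‖ ≤ 2 * P := by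
  unfold weylSum
  refine (norm_sum_le _ _).trans ?_
  simp only [norm_e, Finset.sum_const, nsmul_eq_mul, mul_one, Nat.card_Icc]
  have h1 : ((⌊P⌋₊ + 1 - k : ℕ) : ℝ) ≤ (⌊P⌋₊ + 1 : ℕ) := by exact_mod_cast Nat.sub_le _ _
  have h2 := Nat.floor_le (by linarith : 0 ≤ P)
  push_cast at h1
  linarith

lemma norm_weylSum_sub_range_le {k : ℕ} (hk : k ≤ 1) (P α : ℝ) :
    ‖weylSum k P α - ∑ x ∈ Finset.range (⌊P⌋₊ + 1), e (α * (x : ℝ) ^ 4)‖ ≤ 1 := by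
  have h : ∑ x ∈ Finset.range (⌊P⌋₊ + 1), e (α * (x : ℝ) ^ 4) = weylSum 0 P α := by
    unfold weylSum
    rw [Finset.range_eq_Ico]
    rfl
  rw [h]
  interval_cases k
  · simp
  · unfold weylSum
    rw [← Finset.add_sum_Ioc_eq_sum_Icc (Nat.zero_le _)]
    rw [show Finset.Icc 1 ⌊P⌋₊ = Finset.Ioc 0 ⌊P⌋₊ from rfl]
    simp

/-- The block estimate needs the phase derivative to vary by at most `1/(8q)`. Under `ht` blocks of
length `⌊P/c⌋` achieve this, and at most `4c + 1` of them cover the range. -/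
lemma norm_weylSum_rational_le {k : ℕ} (hk : k ≤ 1) {q : ℕ} (hq : 0 < q) (a : ℤ) {B : ℝ}
    (hB : ∀ b, ‖quarticSum q a b‖ ≤ B) {P c t R : ℝ} (hc : 1 ≤ c) (hP : c ≤ P)
    (ht : t ^ 4 * (608 * P ^ 3) ≤ c / q)
    (hR : 2 * P ≤ R ∨ (0 < t ∧ 8 * (1 + 1 / t) ≤ R)) :
    ‖weylSum k P (a / q + t ^ 4)‖ ≤
      (4 * c + 1) * (B / q * (2 * R + 4 * q * (1 + Real.log q))) + 1 := by
  have hq0 : (0 : ℝ) < q := by exact_mod_cast hq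
  have hq1 : (1 : ℝ) ≤ q := by exact_mod_cast hq
  have hP1 : 1 ≤ P := hc.trans hP
  have hB0 : 0 ≤ B := (norm_nonneg _).trans (hB 0)
  have h0 := norm_weylSum_sub_range_le hk P (a / q + t ^ 4)
  set N₀ := ⌊P⌋₊ + 1 with hN₀
  set H := ⌊P / c⌋₊ with hH
  have hfl : (⌊P⌋₊ : ℝ) ≤ P := Nat.floor_le (by linarith)
  have hPc : 1 ≤ P / c := by rw [le_div_iff₀ (by linarith)]; linarith
  have hH1 : 1 ≤ H := Nat.le_floor (by simpa using hPc)
  have hHle : (H : ℝ) ≤ P / c := Nat.floor_le (by linarith)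
  have hHge : P / c < 2 * H := by
    have h1 := Nat.lt_floor_add_one (P / c)
    have h2 : (1 : ℝ) ≤ H := by exact_mod_cast hH1
    linarith
  set F : ℕ → ℂ := fun x => ez q (a * (x : ℤ) ^ 4) * e (t ^ 4 * (x : ℝ) ^ 4) with hF
  have hFe : ∀ x : ℕ, e ((a / q + t ^ 4) * (x : ℝ) ^ 4) = F x := by
    intro x
    simp only [hF]
    unfold ez
    rw [← e_add]
    congr 1
    push_cast
    ring
  rw [Finset.sum_congr rfl fun x _ => hFe x] at h0
  set V := B / q * (2 * R + 4 * q * (1 + Real.log q)) with hV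
  have hblock : ∀ N L, L ≤ H → N + L ≤ N₀ → ‖∑ n ∈ Finset.range L, F (N + n)‖ ≤ V := by
    intro N L hL hN
    have hN' : ((N : ℝ) + L) ≤ 2 * P := by
      have : ((N + L : ℕ) : ℝ) ≤ (N₀ : ℕ) := by exact_mod_cast hN
      rw [hN₀] at this
      push_cast at this
      linarith
    have hNnn : (0 : ℝ) ≤ N := by positivity
    have hLnn : (0 : ℝ) ≤ L := by positivity
    apply norm_block_sum_le hq a hB
    · rcases hR with hR | hR
      · left; linarith
      · exact Or.inr hR
    · intro n hn
      have hn' : (n : ℝ) ≤ L := by exact_mod_cast hn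
      have hL' : (L : ℝ) ≤ P / c := le_trans (by exact_mod_cast hL) hHle
      have hnn : (0 : ℝ) ≤ n := by positivity
      have hx : (N : ℝ) + n ≤ 2 * P := by linarith
      -- All arguments are at most `2P`, so the cofactor of `n` is at most `48P² + 24P + 4 ≤ 76P²`.
      -- The constant `608` in `ht` is `8 · 76`.
      have h1 : (((N + n : ℕ) : ℝ) + 1) ^ 4 - ((N + n : ℕ) : ℝ) ^ 4 -
          (((N : ℝ) + 1) ^ 4 - (N : ℝ) ^ 4) ≤ n * (76 * P ^ 2) := by
        have h2 : (((N + n : ℕ) : ℝ) + 1) ^ 4 - ((N + n : ℕ) : ℝ) ^ 4 -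
          (((N : ℝ) + 1) ^ 4 - (N : ℝ) ^ 4) =
          n * (4 * ((N + n) ^ 2 + (N + n) * N + N ^ 2) + 6 * (N + n + N) + 4) := by
          push_cast; ring
        rw [h2]
        refine mul_le_mul_of_nonneg_left ?_ hnn
        have hx0 : (0 : ℝ) ≤ N + n := by positivity
        have hNP : (N : ℝ) ≤ 2 * P := by linarith
        have e1 : ((N : ℝ) + n) ^ 2 ≤ (2 * P) ^ 2 := pow_le_pow_left₀ hx0 hx 2
        have e2 : (N : ℝ) ^ 2 ≤ (2 * P) ^ 2 := pow_le_pow_left₀ hNnn hNP 2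
        have e3 : ((N : ℝ) + n) * N ≤ (2 * P) * (2 * P) :=
          mul_le_mul hx hNP hNnn (by linarith)
        nlinarith
      have ht4 : (0 : ℝ) ≤ t ^ 4 := by positivity
      calc t ^ 4 * ((((N + n : ℕ) : ℝ) + 1) ^ 4 - ((N + n : ℕ) : ℝ) ^ 4 -
          (((N : ℝ) + 1) ^ 4 - (N : ℝ) ^ 4)) ≤ t ^ 4 * (P / c * (76 * P ^ 2)) := by
            refine mul_le_mul_of_nonneg_left (h1.trans ?_) ht4
            exact mul_le_mul_of_nonneg_right (hn'.trans hL') (by positivity)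
        _ = t ^ 4 * (608 * P ^ 3) / (8 * c) := by ring
        _ ≤ c / q / (8 * c) := by gcongr
        _ = 1 / (8 * q) := by field_simp
  have hV0 : 0 ≤ V := (norm_nonneg _).trans (hblock 0 0 (Nat.zero_le _) (Nat.zero_le _))
  have hj : N₀ ≤ (N₀ / H + 1) * H := by
    have := Nat.lt_div_mul_add (a := N₀) hH1
    rw [add_mul, one_mul]; omega
  have h2 := norm_sum_range_le_of_blocks F H V (N₀ / H + 1) N₀ hj hblock
  have h3 : ((N₀ / H + 1 : ℕ) : ℝ) ≤ 4 * c + 1 := by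
    push_cast
    have h4 : ((N₀ / H : ℕ) : ℝ) ≤ (N₀ : ℝ) / H := Nat.cast_div_le
    have h5 : (N₀ : ℝ) / H ≤ 4 * c := by
      have hHp : (0 : ℝ) < H := by exact_mod_cast hH1
      rw [div_le_iff₀ hHp, hN₀]
      push_cast
      rw [div_lt_iff₀ (by linarith)] at hHge
      nlinarith
    linarith
  have h4 : ‖weylSum k P (a / q + t ^ 4)‖ ≤ ‖∑ n ∈ Finset.range N₀, F n‖ + 1 := by
    have := norm_le_norm_add_norm_sub' (weylSum k P (a / q + t ^ 4)) (∑ n ∈ Finset.range N₀, F n)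
    linarith
  calc _ ≤ _ := h4
    _ ≤ ((N₀ / H + 1 : ℕ) : ℝ) * V + 1 := by linarith
    _ ≤ _ := by
      have := mul_le_mul_of_nonneg_right h3 hV0
      linarith

/-- The bound `f(a/q + ξ) ≪ P (q (1 + P⁴|ξ|))^{-6/25}` on the major arcs. -/
theorem exists_weylSum_bound {C : ℝ} (hC : 1 ≤ C) : ∃ K : ℝ, 0 < K ∧ ∀ (k : ℕ) (P : ℝ) (q : ℕ)
    (a : ℤ) (ξ : ℝ), k ≤ 1 → 1 ≤ P → 0 < q → (q : ℝ) ≤ P → IsCoprime a (q : ℤ) →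
    |ξ| ≤ C / (q * P ^ 3) →
    ‖weylSum k P (a / q + ξ)‖ ≤ K * P * (q * (1 + P ^ 4 * |ξ|)) ^ (-(6 / 25) : ℝ) := by
  obtain ⟨K₀, hK₀, hS⟩ := exists_quarticSum_bound
  set c : ℝ := 608 * C with hc
  have hc1 : 1 ≤ c := by linarith
  set K₁ : ℝ := (4 * c + 1) * (K₀ * (64 * C)) + ((4 * c + 1) * (K₀ * 804) + 1) * (1 + C) with hK₁
  have hK₁0 : 0 < K₁ := by positivity
  set K₂ : ℝ := 2 * ((1 + C) * c) with hK₂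
  refine ⟨K₁ + K₂, by positivity, ?_⟩
  -- by complex conjugation it suffices to treat `ξ = t⁴ ≥ 0`
  have main : ∀ (k : ℕ) (P : ℝ) (q : ℕ) (a : ℤ) (t : ℝ), k ≤ 1 → 1 ≤ P → 0 < q → (q : ℝ) ≤ P →
      IsCoprime a (q : ℤ) → 0 ≤ t → t ^ 4 ≤ C / (q * P ^ 3) →
      ‖weylSum k P (a / q + t ^ 4)‖ ≤ (K₁ + K₂) * P * (q * (1 + P ^ 4 * t ^ 4)) ^ (-(6 / 25) : ℝ) := by
    intro k P q a t hk hP hq hqP ha ht0 ht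
    have hP0 : 0 < P := by linarith
    have hq0 : (0 : ℝ) < q := by exact_mod_cast hq
    have hq1 : (1 : ℝ) ≤ q := by exact_mod_cast hq
    set T : ℝ := 1 + P ^ 4 * t ^ 4 with hT
    have hT1 : 1 ≤ T := by rw [hT]; have : 0 ≤ P ^ 4 * t ^ 4 := by positivity
                           linarith
    have hT0 : 0 < T := by linarith
    -- This is where the width `C/(qP³)` of the arc is used: it makes `P^{-6/25}` at most a constant
    -- times `(qT)^{-6/25}`, so an error of size `P^{19/25}` is harmless.
    have hQ : q * T ≤ (1 + C) * P := by
      have h1 : q * (P ^ 4 * t ^ 4) ≤ q * (P ^ 4 * (C / (q * P ^ 3))) := by gcongr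
      have h2 : q * (P ^ 4 * (C / (q * P ^ 3))) = C * P := by field_simp
      rw [hT]; linarith
    have hQ0 : 0 < q * T := by positivity
    have hQpow : P ^ (-(6 / 25) : ℝ) ≤ (1 + C) * (q * T) ^ (-(6 / 25) : ℝ) := by
      have h1 : ((1 + C) * P) ^ (-(6 / 25) : ℝ) ≤ (q * T) ^ (-(6 / 25) : ℝ) :=
        Real.rpow_le_rpow_of_nonpos hQ0 hQ (by norm_num)
      rw [Real.mul_rpow (by linarith) hP0.le, Real.rpow_neg (by linarith : 0 ≤ 1 + C)] at h1
      have h3 : 0 < (1 + C) ^ (6 / 25 : ℝ) := Real.rpow_pos_of_pos (by linarith) _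
      have h2 : (1 + C) ^ (6 / 25 : ℝ) ≤ 1 + C := by
        calc (1 + C) ^ (6 / 25 : ℝ) ≤ (1 + C) ^ (1 : ℝ) :=
              Real.rpow_le_rpow_of_exponent_le (by linarith) (by norm_num)
          _ = _ := Real.rpow_one _
      rw [inv_mul_le_iff₀ h3] at h1
      exact h1.trans (mul_le_mul_of_nonneg_right h2 (by positivity))
    have hW0 : 0 < (q * T) ^ (-(6 / 25) : ℝ) := by positivity
    rcases lt_or_ge P c with hPc | hPc
    · have h1 : 1 ≤ ((1 + C) * c) * (q * T) ^ (-(6 / 25) : ℝ) := by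
        have h2 : c⁻¹ ≤ P ^ (-(6 / 25) : ℝ) := by
          calc c⁻¹ = c ^ (-1 : ℝ) := by rw [Real.rpow_neg_one]
            _ ≤ P ^ (-1 : ℝ) := Real.rpow_le_rpow_of_nonpos hP0 hPc.le (by norm_num)
            _ ≤ _ := Real.rpow_le_rpow_of_exponent_le hP (by norm_num)
        have h3 := h2.trans hQpow
        rw [inv_le_iff_one_le_mul₀ (by linarith)] at h3
        linarith
      calc ‖weylSum k P (a / q + t ^ 4)‖ ≤ 2 * P * 1 := by rw [mul_one]; exact norm_weylSum_le hP _
        _ ≤ 2 * P * (((1 + C) * c) * (q * T) ^ (-(6 / 25) : ℝ)) := by gcongr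
        _ = K₂ * P * (q * T) ^ (-(6 / 25) : ℝ) := by rw [hK₂]; ring
        _ ≤ _ := by gcongr; linarith
    -- `R` dominates `min(P, 1/t)` up to a constant. If `Pt ≤ 1` then `T ≤ 2` and the trivial bound
    -- fits. Otherwise `1/t ≤ 2P T^{-1/4}`, and the additive 1 in `8(1 + 1/t)` is absorbed because
    -- `t ≤ C`.
    · set R : ℝ := 32 * C * P * T ^ (-(6 / 25) : ℝ) with hR
      have hTle : T ^ (-(1 / 4) : ℝ) ≤ T ^ (-(6 / 25) : ℝ) :=
        Real.rpow_le_rpow_of_exponent_le hT1 (by norm_num)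
      have hRcond : 2 * P ≤ R ∨ (0 < t ∧ 8 * (1 + 1 / t) ≤ R) := by
        rcases le_or_gt (P ^ 4 * t ^ 4) 1 with h | h
        · left
          have h1 : T ≤ 2 := by linarith
          have h2 : (1 / 2 : ℝ) ≤ T ^ (-(6 / 25) : ℝ) := by
            calc (1 / 2 : ℝ) = 2 ^ (-1 : ℝ) := by norm_num [Real.rpow_neg_one]
              _ ≤ 2 ^ (-(6 / 25) : ℝ) :=
                Real.rpow_le_rpow_of_exponent_le (by norm_num) (by norm_num)
              _ ≤ _ := Real.rpow_le_rpow_of_nonpos hT0 h1 (by norm_num)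
          calc 2 * P ≤ 32 * C * P * (1 / 2) := by nlinarith
            _ ≤ R := by rw [hR]; gcongr
        · right
          have ht1 : 0 < t := by
            rcases ht0.eq_or_lt with h' | h'
            · rw [← h'] at h; norm_num at h
            · exact h'
          refine ⟨ht1, ?_⟩
          have hPt : P * t ≤ 2 * T ^ (1 / 4 : ℝ) := by
            have h1 : (P * t) ^ 4 ≤ T := by rw [mul_pow]; linarith
            have h2 : P * t ≤ T ^ (1 / 4 : ℝ) := by
              calc P * t = ((P * t) ^ 4) ^ (1 / 4 : ℝ) := by
                    rw [← Real.rpow_natCast, ← Real.rpow_mul (by positivity)]; norm_num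
                _ ≤ _ := by gcongr
            have h3 : 0 < T ^ (1 / 4 : ℝ) := by positivity
            linarith
          have hinv : 1 / t ≤ 2 * P * T ^ (-(1 / 4) : ℝ) := by
            have h1 : T ≤ (2 * (P * t)) ^ 4 := by
              have : (2 * (P * t)) ^ 4 = 16 * (P ^ 4 * t ^ 4) := by ring
              rw [this]; linarith
            have h2 : T ^ (1 / 4 : ℝ) ≤ 2 * (P * t) := by
              calc T ^ (1 / 4 : ℝ) ≤ ((2 * (P * t)) ^ 4) ^ (1 / 4 : ℝ) := by gcongr
                _ = _ := by
                  rw [← Real.rpow_natCast, ← Real.rpow_mul (by positivity)]; norm_num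
            have h3 : 0 < T ^ (1 / 4 : ℝ) := by positivity
            rw [Real.rpow_neg hT0.le, div_le_iff₀ ht1]
            rw [show 2 * P * (T ^ (1 / 4 : ℝ))⁻¹ * t = (2 * (P * t)) / T ^ (1 / 4 : ℝ) by
              field_simp, le_div_iff₀ h3]
            linarith
          have htC : t ≤ C := by
            by_contra hcon
            push Not at hcon
            have h1 : t ≤ t ^ 4 := le_self_pow₀ (by linarith) (by norm_num)
            have h2 : C / (q * P ^ 3) ≤ C := by
              apply div_le_self (by linarith)
              exact one_le_mul_of_one_le_of_one_le hq1 (one_le_pow₀ hP)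
            linarith
          have h1 : 1 ≤ C * (1 / t) := by
            rw [mul_one_div, le_div_iff₀ ht1]; linarith
          have h0 : 0 < 1 / t := by positivity
          calc 8 * (1 + 1 / t) ≤ 16 * C * (1 / t) := by nlinarith
            _ ≤ 16 * C * (2 * P * T ^ (-(6 / 25) : ℝ)) := by
              have := hinv.trans (mul_le_mul_of_nonneg_left hTle (by linarith : 0 ≤ 2 * P))
              gcongr
            _ = R := by rw [hR]; ring
      have htc : t ^ 4 * (608 * P ^ 3) ≤ c / q := by
        calc t ^ 4 * (608 * P ^ 3) ≤ C / (q * P ^ 3) * (608 * P ^ 3) := by gcongr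
          _ = c / q := by rw [hc]; field_simp
      have h1 := norm_weylSum_rational_le hk hq a (fun b => hS q hq a b ha) hc1 hPc htc hRcond
      -- The exponents are tuned for this: `151/200 + 1/200 = 19/25 = 1 - 6/25`.
      have hlog : 1 + Real.log q ≤ 201 * (q : ℝ) ^ (1 / 200 : ℝ) := by
        have h2 := Real.log_le_rpow_div hq0.le (show (0 : ℝ) < 1 / 200 by norm_num)
        have h3 : 1 ≤ (q : ℝ) ^ (1 / 200 : ℝ) := Real.one_le_rpow hq1 (by norm_num)
        rw [div_div_eq_mul_div, div_one] at h2
        linarith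
      have hterm1 : K₀ * (q : ℝ) ^ (151 / 200 : ℝ) / q * (2 * R) ≤
          K₀ * (64 * C) * (P * (q * T) ^ (-(6 / 25) : ℝ)) := by
        have h2 : (q : ℝ) ^ (151 / 200 : ℝ) / q ≤ (q : ℝ) ^ (-(6 / 25) : ℝ) := by
          rw [← Real.rpow_sub_one hq0.ne']
          exact Real.rpow_le_rpow_of_exponent_le hq1 (by norm_num)
        rw [Real.mul_rpow hq0.le hT0.le, hR]
        calc _ = K₀ * (64 * C) * (P * ((q : ℝ) ^ (151 / 200 : ℝ) / q * T ^ (-(6 / 25) : ℝ))) := by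
              ring
          _ ≤ _ := by gcongr
      have hPpow : P * P ^ (-(6 / 25) : ℝ) = P ^ (19 / 25 : ℝ) := by
        rw [← Real.rpow_one_add' hP0.le (by norm_num)]; norm_num
      have hterm2 : K₀ * (q : ℝ) ^ (151 / 200 : ℝ) / q * (4 * q * (1 + Real.log q)) ≤
          K₀ * 804 * (P * P ^ (-(6 / 25) : ℝ)) := by
        calc _ = K₀ * 4 * ((q : ℝ) ^ (151 / 200 : ℝ) * (1 + Real.log q)) := by field_simp
          _ ≤ K₀ * 4 * ((q : ℝ) ^ (151 / 200 : ℝ) * (201 * (q : ℝ) ^ (1 / 200 : ℝ))) := by gcongr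
          _ = K₀ * 804 * ((q : ℝ) ^ (151 / 200 : ℝ) * (q : ℝ) ^ (1 / 200 : ℝ)) := by ring
          _ = K₀ * 804 * (q : ℝ) ^ (19 / 25 : ℝ) := by
            rw [← Real.rpow_add hq0]; norm_num
          _ ≤ K₀ * 804 * P ^ (19 / 25 : ℝ) := by gcongr
          _ = _ := by rw [hPpow]
      have hone : 1 ≤ P * P ^ (-(6 / 25) : ℝ) := by
        rw [hPpow]; exact Real.one_le_rpow hP (by norm_num)
      set W := (q * T) ^ (-(6 / 25) : ℝ) with hW
      calc ‖weylSum k P (a / q + t ^ 4)‖ ≤ _ := h1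
        _ = (4 * c + 1) * (K₀ * (q : ℝ) ^ (151 / 200 : ℝ) / q * (2 * R) +
            K₀ * (q : ℝ) ^ (151 / 200 : ℝ) / q * (4 * q * (1 + Real.log q))) + 1 := by ring
        _ ≤ (4 * c + 1) * (K₀ * (64 * C) * (P * W) + K₀ * 804 * (P * P ^ (-(6 / 25) : ℝ))) +
            P * P ^ (-(6 / 25) : ℝ) := by gcongr
        _ = (4 * c + 1) * (K₀ * (64 * C)) * (P * W) +
            ((4 * c + 1) * (K₀ * 804) + 1) * (P * P ^ (-(6 / 25) : ℝ)) := by ring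
        _ ≤ (4 * c + 1) * (K₀ * (64 * C)) * (P * W) +
            ((4 * c + 1) * (K₀ * 804) + 1) * (P * ((1 + C) * W)) := by gcongr
        _ = K₁ * P * W := by rw [hK₁]; ring
        _ ≤ (K₁ + K₂) * P * W := by
          have : 0 ≤ K₂ := by positivity
          gcongr; linarith
  intro k P q a ξ hk hP hq hqP ha hξ
  obtain ⟨t, ht0, ht⟩ : ∃ t : ℝ, 0 ≤ t ∧ t ^ 4 = |ξ| :=
    ⟨|ξ| ^ (1 / 4 : ℝ), by positivity, by
      rw [← Real.rpow_natCast, ← Real.rpow_mul (abs_nonneg _)]; norm_num⟩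
  rcases le_total 0 ξ with h | h
  · rw [abs_of_nonneg h] at ht hξ ⊢
    rw [← ht] at hξ ⊢
    exact main k P q a t hk hP hq hqP ha ht0 hξ
  · rw [abs_of_nonpos h] at ht hξ ⊢
    have h1 := main k P q (-a) t hk hP hq hqP ha.neg_left ht0 (by rw [ht]; exact hξ)
    rw [ht] at h1
    have h2 : weylSum k P (a / q + ξ) =
        (starRingEnd ℂ) (weylSum k P (((-a : ℤ) : ℝ) / q + -ξ)) := by
      rw [← weylSum_neg]; congr 1; push_cast; ring
    rw [h2, RCLike.norm_conj]
    exact h1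

/-! ### Weyl sums near a rational with small denominator: approximation -/

/-- The continuous generating function `∫_{-1}^1 e(γ t⁴) dt`. -/
noncomputable def quarticIntegral (γ : ℝ) : ℂ := ∫ t in (-1 : ℝ)..1, e (γ * t ^ 4)

lemma integral_zero_eq_quarticIntegral {P : ℝ} (hP : 0 < P) (ξ : ℝ) :
    ∫ t in (0 : ℝ)..P, e (ξ * t ^ 4) = (P / 2 : ℂ) * quarticIntegral (P ^ 4 * ξ) := by
  unfold quarticIntegral
  have hint : ∀ x y : ℝ, IntervalIntegrable (fun t => e (P ^ 4 * ξ * t ^ 4)) volume x y :=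
    fun x y => Continuous.intervalIntegrable (by fun_prop) _ _
  have h1 : ∫ t in (-1 : ℝ)..0, e (P ^ 4 * ξ * t ^ 4) = ∫ t in (0 : ℝ)..1, e (P ^ 4 * ξ * t ^ 4) := by
    have := intervalIntegral.integral_comp_neg (a := 0) (b := 1)
      (fun t : ℝ => e (P ^ 4 * ξ * t ^ 4))
    rw [neg_zero] at this
    rw [← this]
    refine intervalIntegral.integral_congr fun t _ => ?_
    congr 1
    ring
  rw [← intervalIntegral.integral_add_adjacent_intervals (hint (-1) 0) (hint 0 1), h1]
  have h2 := intervalIntegral.integral_comp_mul_left (a := 0) (b := 1)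
    (fun t : ℝ => e (ξ * t ^ 4)) hP.ne'
  have h3 : ∫ t in (0 : ℝ)..1, e (ξ * (P * t) ^ 4) = ∫ t in (0 : ℝ)..1, e (P ^ 4 * ξ * t ^ 4) :=
    intervalIntegral.integral_congr fun t _ => by congr 1; ring
  rw [h3] at h2
  rw [h2, mul_zero, mul_one, Complex.real_smul]
  have : (P : ℂ) ≠ 0 := by exact_mod_cast hP.ne'
  push_cast
  field_simp
  ring

lemma norm_sum_range_sub_le {q : ℕ} (hq : 0 < q) (a : ℤ) (N : ℕ) :
    ‖∑ n ∈ Finset.range N, ez q (a * (n : ℤ) ^ 4) - (N / q : ℂ) * quarticSum q a 0‖ ≤ 2 * q := by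
  have hq' : (q : ℂ) ≠ 0 := by exact_mod_cast hq.ne'
  have hS : quarticSum q a 0 = ∑ n ∈ Finset.range q, ez q (a * (n : ℤ) ^ 4) := by
    unfold quarticSum; simp
  have hper : ∀ m n : ℕ, ez q (a * ((q * m + n : ℕ) : ℤ) ^ 4) = ez q (a * (n : ℤ) ^ 4) := by
    intro m n
    apply ez_congr
    have := quartic_dvd (q := q) a 0 ((q * m + n : ℕ) : ℤ) n ⟨m, by push_cast; ring⟩
    simpa using this
  have hmul : ∀ m : ℕ, ∑ n ∈ Finset.range (q * m), ez q (a * (n : ℤ) ^ 4) = m * quarticSum q a 0 := by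
    intro m
    induction m with
    | zero => simp
    | succ m ih =>
      rw [Nat.mul_succ, Finset.sum_range_add, ih, Finset.sum_congr rfl fun n _ => hper m n, ← hS]
      push_cast; ring
  have hN := Nat.div_add_mod N q
  set m := N / q
  set r := N % q with hr
  have hrq : r < q := Nat.mod_lt _ hq
  have hrq' : (r : ℝ) ≤ q := by exact_mod_cast hrq.le
  rw [← hN, Finset.sum_range_add, hmul, Finset.sum_congr rfl fun n _ => hper m n]
  have h1 : (m : ℂ) * quarticSum q a 0 + ∑ n ∈ Finset.range r, ez q (a * (n : ℤ) ^ 4) -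
      (((q * m + r : ℕ) : ℂ) / q) * quarticSum q a 0 =
      ∑ n ∈ Finset.range r, ez q (a * (n : ℤ) ^ 4) - (r / q : ℂ) * quarticSum q a 0 := by
    push_cast; field_simp; ring
  rw [h1]
  refine (norm_sub_le _ _).trans ?_
  have h2 : ‖∑ n ∈ Finset.range r, ez q (a * (n : ℤ) ^ 4)‖ ≤ r := by
    refine (norm_sum_le _ _).trans ?_
    simp
  have h3 : ‖(r / q : ℂ) * quarticSum q a 0‖ ≤ r := by
    rw [norm_mul, norm_div, Complex.norm_natCast, Complex.norm_natCast]
    have hq0 : (0 : ℝ) < q := by exact_mod_cast hq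
    calc (r : ℝ) / q * ‖quarticSum q a 0‖ ≤ r / q * q := by
          gcongr; exact norm_quarticSum_le _ _ _
      _ = r := by field_simp
  linarith

lemma hasDerivAt_e_quartic (ξ t : ℝ) : HasDerivAt (fun t : ℝ => e (ξ * t ^ 4))
    ((8 * Real.pi * ξ * t ^ 3 : ℝ) * Complex.I * e (ξ * t ^ 4)) t := by
  unfold e
  have h1 : HasDerivAt (fun t : ℝ => (2 * Real.pi * Complex.I * ((ξ * t ^ 4 : ℝ) : ℂ)))
      (2 * Real.pi * Complex.I * ((ξ * (4 * t ^ 3) : ℝ) : ℂ)) t := by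
    apply HasDerivAt.const_mul
    apply HasDerivAt.ofReal_comp
    apply HasDerivAt.const_mul
    simpa using hasDerivAt_pow 4 t
  convert h1.cexp using 1
  push_cast
  ring

/-- Partial summation: the summatory function of `e(an⁴/q)` is `(S/q) t + O(q)` by periodicity, and
the derivative of `e(ξt⁴)` has total mass `O(P⁴|ξ|)` on `[0, P]`. -/
lemma norm_weylSum_sub_main_le {k : ℕ} (hk : k ≤ 1) {P : ℝ} (hP : 1 ≤ P) {q : ℕ} (hq : 0 < q)
    (a : ℤ) (ξ : ℝ) :
    ‖weylSum k P (a / q + ξ) - (quarticSum q a 0 / q) * ((P / 2 : ℂ) * quarticIntegral (P ^ 4 * ξ))‖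
      ≤ 100 * (q * (1 + P ^ 4 * |ξ|)) := by
  have hP0 : 0 < P := by linarith
  have hq0 : (0 : ℝ) < q := by exact_mod_cast hq
  have hq1 : (1 : ℝ) ≤ q := by exact_mod_cast hq
  set f : ℝ → ℂ := fun t => e (ξ * t ^ 4) with hf
  set f' : ℝ → ℂ := fun t => (8 * Real.pi * ξ * t ^ 3 : ℝ) * Complex.I * e (ξ * t ^ 4) with hf'
  have hderiv : ∀ t, HasDerivAt f (f' t) t := hasDerivAt_e_quartic ξ
  have hderiv' : deriv f = f' := funext fun t => (hderiv t).deriv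
  have hcont' : Continuous f' := by rw [hf']; fun_prop
  have hcont : Continuous f := by rw [hf]; fun_prop
  set c : ℕ → ℂ := fun n => ez q (a * (n : ℤ) ^ 4) with hc
  set A : ℝ → ℂ := fun t => ∑ n ∈ Finset.Icc 0 ⌊t⌋₊, c n with hA
  set S := quarticSum q a 0 with hS
  have hSq : ‖S / q‖ ≤ 1 := by
    rw [norm_div, Complex.norm_natCast, div_le_one hq0]
    exact norm_quarticSum_le _ _ _
  have hAb : ∀ t, 0 ≤ t → ‖A t - (S / q) * t‖ ≤ 3 * q := by
    intro t ht
    have h1 := norm_sum_range_sub_le hq a (⌊t⌋₊ + 1)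
    have h2 : A t = ∑ n ∈ Finset.range (⌊t⌋₊ + 1), ez q (a * (n : ℤ) ^ 4) := by
      rw [hA, Finset.range_eq_Ico]; rfl
    have h3 : A t - (S / q) * t = (∑ n ∈ Finset.range (⌊t⌋₊ + 1), ez q (a * (n : ℤ) ^ 4) -
        (((⌊t⌋₊ + 1 : ℕ) : ℂ) / q) * S) + (S / q) * (((⌊t⌋₊ + 1 : ℕ) - t : ℝ) : ℂ) := by
      rw [h2]; push_cast; ring
    have h4 : ‖(((⌊t⌋₊ + 1 : ℕ) - t : ℝ) : ℂ)‖ ≤ 1 := by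
      rw [Complex.norm_real, Real.norm_eq_abs, abs_le]
      have := Nat.floor_le ht
      have := Nat.lt_floor_add_one t
      push_cast
      constructor <;> linarith
    rw [h3]
    refine (norm_add_le _ _).trans ?_
    rw [norm_mul]
    have h5 := mul_le_mul hSq h4 (norm_nonneg _) zero_le_one
    linarith
  have habel := sum_mul_eq_sub_integral_mul (𝕜 := ℂ) c hP0.le (f := f)
    (fun t _ => (hderiv t).differentiableAt) (by
      rw [hderiv']; exact hcont'.integrableOn_Icc)
  rw [hderiv'] at habel
  have hAint : IntegrableOn (fun t => f' t * A t) (Set.Ioc 0 P) := by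
    have := integrableOn_mul_sum_Icc (𝕜 := ℂ) (m := 0) (a := 0) (b := P) c le_rfl
      (g := f') hcont'.integrableOn_Icc
    exact this.mono_set Set.Ioc_subset_Icc_self
  have hparts : ∫ t in (0 : ℝ)..P, f t = P * f P - ∫ t in Set.Ioc 0 P, (t : ℂ) * f' t := by
    have h1 := intervalIntegral.integral_mul_deriv_eq_deriv_mul (a := 0) (b := P)
      (u := fun t : ℝ => (t : ℂ)) (v := f) (u' := fun _ => 1) (v' := f')
      (fun t _ => HasDerivAt.ofReal_comp (hasDerivAt_id t)) (fun t _ => hderiv t)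
      (Continuous.intervalIntegrable (by fun_prop) _ _) (hcont'.intervalIntegrable _ _)
    rw [intervalIntegral.integral_of_le hP0.le] at h1
    simp only [one_mul] at h1
    rw [h1]
    simp
  have hsum : ∑ x ∈ Finset.range (⌊P⌋₊ + 1), e ((a / q + ξ) * (x : ℝ) ^ 4) =
      ∑ n ∈ Finset.Icc 0 ⌊P⌋₊, f n * c n := by
    rw [Finset.range_eq_Ico]
    refine Finset.sum_congr rfl fun x _ => ?_
    simp only [hf, hc]
    unfold ez
    rw [← e_add]
    congr 1
    push_cast
    ring
  have h0 := norm_weylSum_sub_range_le hk P (a / q + ξ)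
  rw [hsum, habel] at h0
  have hPint := integral_zero_eq_quarticIntegral hP0 ξ
  rw [← hPint, hparts]
  have htint : IntegrableOn (fun t : ℝ => (t : ℂ) * f' t) (Set.Ioc 0 P) :=
    (Continuous.integrableOn_Icc (by fun_prop)).mono_set Set.Ioc_subset_Icc_self
  have hdiff : ‖∫ t in Set.Ioc 0 P, f' t * (A t - (S / q) * t)‖ ≤
      (8 * Real.pi * |ξ| * P ^ 3) * (3 * q) * P := by
    have h1 := norm_setIntegral_le_of_norm_le_const (μ := volume) (s := Set.Ioc (0 : ℝ) P)
      (f := fun t => f' t * (A t - (S / q) * t))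
      (C := (8 * Real.pi * |ξ| * P ^ 3) * (3 * q)) (by simp) (by
        intro t ht
        rw [norm_mul]
        refine mul_le_mul ?_ (hAb t ht.1.le) (norm_nonneg _) (by positivity)
        simp only [hf']
        rw [norm_mul, norm_mul, Complex.norm_I, norm_e, mul_one, mul_one, Complex.norm_real,
          Real.norm_eq_abs, abs_mul, abs_mul, abs_of_nonneg (by positivity : 0 ≤ 8 * Real.pi),
          abs_of_nonneg (pow_nonneg ht.1.le 3)]
        have := pow_le_pow_left₀ ht.1.le ht.2 3
        gcongr)
    simpa [hP0.le] using h1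
  have heq : ∫ t in Set.Ioc 0 P, f' t * (A t - (S / q) * t) =
      (∫ t in Set.Ioc 0 P, f' t * A t) - (S / q) * ∫ t in Set.Ioc 0 P, (t : ℂ) * f' t := by
    rw [← integral_const_mul, ← integral_sub hAint (htint.const_mul _)]
    refine integral_congr_ae (Filter.Eventually.of_forall fun t => ?_)
    simp only
    ring
  have hfin : weylSum k P (a / q + ξ) -
      (S / q) * (P * f P - ∫ t in Set.Ioc 0 P, (t : ℂ) * f' t) =
      (weylSum k P (a / q + ξ) - (f P * A P - ∫ t in Set.Ioc 0 P, f' t * A t)) +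
      (f P * (A P - (S / q) * P) - ∫ t in Set.Ioc 0 P, f' t * (A t - (S / q) * t)) := by
    rw [heq]; ring
  rw [hfin]
  refine (norm_add_le _ _).trans ?_
  have h6 : ‖f P * (A P - (S / q) * P) - ∫ t in Set.Ioc 0 P, f' t * (A t - (S / q) * t)‖ ≤
      3 * q + (8 * Real.pi * |ξ| * P ^ 3) * (3 * q) * P := by
    refine (norm_sub_le _ _).trans (add_le_add ?_ hdiff)
    rw [norm_mul, hf]
    simp only [norm_e, one_mul]
    exact hAb P hP0.le
  have h7 : (8 * Real.pi * |ξ| * P ^ 3) * (3 * q) * P ≤ 96 * (q * (P ^ 4 * |ξ|)) := by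
    have : Real.pi ≤ 4 := Real.pi_le_four
    calc (8 * Real.pi * |ξ| * P ^ 3) * (3 * q) * P = Real.pi * (24 * (q * (P ^ 4 * |ξ|))) := by ring
      _ ≤ 4 * (24 * (q * (P ^ 4 * |ξ|))) := by gcongr
      _ = _ := by ring
  have h8 : 0 ≤ q * (P ^ 4 * |ξ|) := by positivity
  rw [mul_add (q : ℝ)]
  linarith

/-- The decay is inherited from the discrete sums. With `q = 1` and `ξ = γ/P⁴` the Weyl sum is
`(P/2)` times the integral up to `O(1 + |γ|)`; divide by `P` and let `P → ∞`. -/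
lemma exists_quarticIntegral_bound : ∃ K : ℝ, 0 < K ∧ ∀ γ : ℝ,
    ‖quarticIntegral γ‖ ≤ K * (1 + |γ|) ^ (-(6 / 25) : ℝ) := by
  obtain ⟨K, hK, h⟩ := exists_weylSum_bound (C := 1) le_rfl
  refine ⟨2 * K, by positivity, fun γ => ?_⟩
  have key : ∀ P : ℝ, 1 + |γ| ≤ P → ‖quarticIntegral γ‖ ≤
      2 * K * (1 + |γ|) ^ (-(6 / 25) : ℝ) + 200 * (1 + |γ|) * P⁻¹ := by
    intro P hP
    have hP1 : 1 ≤ P := by linarith [abs_nonneg γ]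
    have hP0 : 0 < P := by linarith
    have hγ : P ^ 4 * |γ / P ^ 4| = |γ| := by
      rw [abs_div, abs_of_pos (by positivity : 0 < P ^ 4)]; field_simp
    have h1 := h 0 P 1 0 (γ / P ^ 4) zero_le_one hP1 one_pos (by simpa using hP1)
      (by rw [Nat.cast_one]; exact isCoprime_one_right) (by
        rw [abs_div, abs_of_pos (by positivity : 0 < P ^ 4), div_le_div_iff₀ (by positivity)
          (by positivity)]
        calc |γ| * ((1 : ℕ) * P ^ 3) ≤ P * ((1 : ℕ) * P ^ 3) := by gcongr; linarith
          _ = 1 * P ^ 4 := by push_cast; ring)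
    have h2 := norm_weylSum_sub_main_le (k := 0) zero_le_one hP1 one_pos 0 (γ / P ^ 4)
    rw [hγ] at h1 h2
    rw [mul_div_cancel₀ _ (by positivity : P ^ 4 ≠ 0)] at h2
    have hS : quarticSum 1 0 0 = 1 := by simp [quarticSum]
    rw [hS] at h2
    simp only [Nat.cast_one, one_mul, div_one] at h1 h2
    have h3 : ‖(P / 2 : ℂ) * quarticIntegral γ‖ ≤
        K * P * (1 + |γ|) ^ (-(6 / 25) : ℝ) + 100 * (1 + |γ|) := by
      have := norm_le_norm_add_norm_sub (weylSum 0 P (((0 : ℤ) : ℝ) + γ / P ^ 4))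
        ((P / 2 : ℂ) * quarticIntegral γ)
      linarith
    rw [norm_mul, norm_div, Complex.norm_real, Real.norm_eq_abs, abs_of_pos hP0] at h3
    norm_num at h3
    have h4 : ‖quarticIntegral γ‖ = (P / 2 * ‖quarticIntegral γ‖) * (2 * P⁻¹) := by field_simp
    rw [h4]
    calc _ ≤ (K * P * (1 + |γ|) ^ (-(6 / 25) : ℝ) + 100 * (1 + |γ|)) * (2 * P⁻¹) := by
          gcongr
      _ = _ := by field_simp; ring
  have hlim : Tendsto (fun P : ℝ => 2 * K * (1 + |γ|) ^ (-(6 / 25) : ℝ) + 200 * (1 + |γ|) * P⁻¹)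
      atTop (𝓝 (2 * K * (1 + |γ|) ^ (-(6 / 25) : ℝ) + 200 * (1 + |γ|) * 0)) :=
    (tendsto_inv_atTop_zero.const_mul _).const_add _
  rw [mul_zero, add_zero] at hlim
  exact ge_of_tendsto hlim ((eventually_ge_atTop (1 + |γ|)).mono key)

lemma continuous_quarticIntegral : Continuous quarticIntegral := by
  unfold quarticIntegral
  exact intervalIntegral.continuous_parametric_intervalIntegral_of_continuous' (by fun_prop) _ _

/-! ### The linear forms `a_j x + b_j y` -/

section Forms

variable {s : ℕ} (a b : Fin s → ℤ)

/-- The size of the coefficients. -/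
noncomputable def coeffSize : ℝ := 1 + ∑ j, (|(a j : ℝ)| + |(b j : ℝ)|)

lemma one_le_coeffSize : 1 ≤ coeffSize a b := by
  unfold coeffSize
  have : 0 ≤ ∑ j, (|(a j : ℝ)| + |(b j : ℝ)|) := Finset.sum_nonneg fun j _ => by positivity
  linarith

lemma abs_add_abs_le_coeffSize (j : Fin s) : |(a j : ℝ)| + |(b j : ℝ)| ≤ coeffSize a b := by
  unfold coeffSize
  have := Finset.single_le_sum (f := fun j => |(a j : ℝ)| + |(b j : ℝ)|)
    (fun j _ => by positivity) (Finset.mem_univ j)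
  linarith

lemma abs_form_le (j : Fin s) (x : ℝ × ℝ) : |a j * x.1 + b j * x.2| ≤ coeffSize a b * ‖x‖ := by
  have h1 : |x.1| ≤ ‖x‖ := norm_fst_le x
  have h2 : |x.2| ≤ ‖x‖ := norm_snd_le x
  calc |a j * x.1 + b j * x.2| ≤ |(a j : ℝ)| * |x.1| + |(b j : ℝ)| * |x.2| := by
        rw [← abs_mul, ← abs_mul]; exact abs_add_le _ _
    _ ≤ |(a j : ℝ)| * ‖x‖ + |(b j : ℝ)| * ‖x‖ := by gcongr
    _ = (|(a j : ℝ)| + |(b j : ℝ)|) * ‖x‖ := by ring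
    _ ≤ _ := by gcongr; exact abs_add_abs_le_coeffSize a b j

variable {a b}

lemma card_independent (hab : ∀ j, (a j, b j) ≠ (0, 0)) (hq : 15 ≤ q0 a b) (j : Fin s) :
    15 ≤ (Finset.univ.filter fun i : Fin s => a i * b j - a j * b i ≠ 0).card := by
  refine hq.trans (Nat.sInf_le ⟨b j, -a j, ?_, ?_⟩)
  · intro h
    apply hab j
    simp only [Prod.mk.injEq, neg_eq_zero] at h ⊢
    exact ⟨h.2, h.1⟩
  · congr 1
    ext i
    simp only [Finset.mem_filter, Finset.mem_univ, true_and]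
    rw [show b j * a i + -a j * b i = a i * b j - a j * b i by ring]

lemma fifteen_le (hq : 15 ≤ q0 a b) : 15 ≤ s := by
  have h1 : q0 a b ≤ (Finset.univ.filter fun j : Fin s => 1 * a j + 0 * b j ≠ 0).card :=
    Nat.sInf_le ⟨1, 0, by simp, rfl⟩
  have h2 := Finset.card_le_univ (Finset.univ.filter fun j : Fin s => 1 * a j + 0 * b j ≠ 0)
  rw [Fintype.card_fin] at h2
  omega

/-- Take the form `j₀` of smallest absolute value at `x`. Every form independent of it is at least
as large, and two independent forms determine `x`, so each of 15 such forms is `≫ ‖x‖`. The other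
factors are at least 1. -/
lemma exists_prod_forms_ge (hab : ∀ j, (a j, b j) ≠ (0, 0)) (hq : 15 ≤ q0 a b)
    {X : ℝ} (hX : 0 ≤ X) (x : ℝ × ℝ) :
    (1 + X * ‖x‖) ^ 15 ≤ (2 * coeffSize a b) ^ 15 * ∏ j, (1 + X * |a j * x.1 + b j * x.2|) := by
  have hs := fifteen_le hq
  have hM := one_le_coeffSize a b
  set M := coeffSize a b
  obtain ⟨j₀, -, hj₀⟩ := Finset.exists_min_image (Finset.univ : Finset (Fin s))
    (fun j => |a j * x.1 + b j * x.2|) ⟨⟨0, by omega⟩, Finset.mem_univ _⟩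
  obtain ⟨I, hI, hIc⟩ := Finset.exists_subset_card_eq (card_independent hab hq j₀)
  have h1 : ∀ i ∈ I, (1 + X * ‖x‖) ≤ 2 * M * (1 + X * |a i * x.1 + b i * x.2|) := by
    intro i hi
    have hdet : a i * b j₀ - a j₀ * b i ≠ 0 := (Finset.mem_filter.1 (hI hi)).2
    have hdet1 : (1 : ℝ) ≤ |((a i * b j₀ - a j₀ * b i : ℤ) : ℝ)| := by
      rw [← Int.cast_abs]; exact_mod_cast Int.one_le_abs hdet
    set Li := a i * x.1 + b i * x.2
    set L0 := a j₀ * x.1 + b j₀ * x.2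
    have h0 : |L0| ≤ |Li| := hj₀ i (Finset.mem_univ _)
    have hmi := abs_add_abs_le_coeffSize a b i
    have hm0 := abs_add_abs_le_coeffSize a b j₀
    -- Cramer's rule for the two coordinates of `x`; the determinant is a nonzero integer, hence at
    -- least 1 in absolute value.
    have key : ∀ y c₁ c₂ : ℝ, ((a i * b j₀ - a j₀ * b i : ℤ) : ℝ) * y = c₁ * Li - c₂ * L0 →
        |c₁| ≤ M → |c₂| ≤ M → |y| ≤ 2 * M * |Li| := by
      intro y c₁ c₂ h hc₁ hc₂
      calc |y| ≤ |((a i * b j₀ - a j₀ * b i : ℤ) : ℝ)| * |y| :=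
            le_mul_of_one_le_left (abs_nonneg _) hdet1
        _ = |c₁ * Li - c₂ * L0| := by rw [← abs_mul, h]
        _ ≤ |c₁| * |Li| + |c₂| * |L0| := by rw [← abs_mul, ← abs_mul]; exact abs_sub _ _
        _ ≤ M * |Li| + M * |Li| := by gcongr
        _ = _ := by ring
    have hx : ‖x‖ ≤ 2 * M * |Li| := by
      rw [Prod.norm_def]
      refine max_le (key x.1 (b j₀) (b i) ?_ ?_ ?_) (key x.2 (-a j₀) (-a i) ?_ ?_ ?_)
      · push_cast; ring
      · linarith [abs_nonneg (a j₀ : ℝ)]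
      · linarith [abs_nonneg (a i : ℝ)]
      · push_cast; ring
      · rw [abs_neg]; linarith [abs_nonneg (b j₀ : ℝ)]
      · rw [abs_neg]; linarith [abs_nonneg (b i : ℝ)]
    have := mul_le_mul_of_nonneg_left hx hX
    nlinarith
  calc (1 + X * ‖x‖) ^ 15 = ∏ i ∈ I, (1 + X * ‖x‖) := by rw [Finset.prod_const, hIc]
    _ ≤ ∏ i ∈ I, (2 * M * (1 + X * |a i * x.1 + b i * x.2|)) :=
      Finset.prod_le_prod (fun i _ => by positivity) h1
    _ = (2 * M) ^ 15 * ∏ i ∈ I, (1 + X * |a i * x.1 + b i * x.2|) := by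
      rw [Finset.prod_mul_distrib, Finset.prod_const, hIc]
    _ ≤ _ := by
      refine mul_le_mul_of_nonneg_left ?_ (by positivity)
      rw [← Finset.prod_sdiff (Finset.subset_univ I)]
      refine le_mul_of_one_le_left (Finset.prod_nonneg fun i _ => by positivity) ?_
      refine Finset.prod_induction _ (fun x : ℝ => 1 ≤ x) (fun _ _ => one_le_mul_of_one_le_of_one_le)
        le_rfl fun i _ => ?_
      have : 0 ≤ X * |a i * x.1 + b i * x.2| := by positivity
      linarith

/-- The denominator of `n/q` in lowest terms. -/
def redDenom (q : ℕ) (n : ℤ) : ℕ := q / Int.gcd n q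

lemma redDenom_mul_gcd (q : ℕ) (n : ℤ) : redDenom q n * Int.gcd n q = q :=
  Nat.div_mul_cancel (by exact_mod_cast Int.gcd_dvd_right n (q : ℤ))

lemma redDenom_pos {q : ℕ} (hq : 0 < q) (n : ℤ) : 0 < redDenom q n := by
  rcases Nat.eq_zero_or_pos (redDenom q n) with h | h
  · have := redDenom_mul_gcd q n
    rw [h, zero_mul] at this
    omega
  · exact h

lemma redDenom_le (q : ℕ) (n : ℤ) : redDenom q n ≤ q := Nat.div_le_self _ _

lemma gcd_pos_of_pos {q : ℕ} (hq : 0 < q) (n : ℤ) : 0 < Int.gcd n q :=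
  Int.gcd_pos_of_ne_zero_right _ (by exact_mod_cast hq.ne')

lemma isCoprime_redDenom {q : ℕ} (hq : 0 < q) (n : ℤ) :
    IsCoprime (n / Int.gcd n q) (redDenom q n : ℤ) := by
  rw [Int.isCoprime_iff_gcd_eq_one]
  unfold redDenom
  push_cast
  exact Int.gcd_ediv_gcd_ediv_gcd (gcd_pos_of_pos hq n)

lemma div_eq_redDenom {q : ℕ} (hq : 0 < q) (n : ℤ) :
    (n : ℝ) / q = ((n / Int.gcd n q : ℤ) : ℝ) / redDenom q n := by
  have hg := gcd_pos_of_pos hq n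
  have h1 : (n / (Int.gcd n q : ℤ)) * (Int.gcd n q : ℤ) = n :=
    Int.ediv_mul_cancel (Int.gcd_dvd_left n (q : ℤ))
  have h2 := redDenom_mul_gcd q n
  have hr := redDenom_pos hq n
  have hg' : ((Int.gcd n q : ℕ) : ℝ) ≠ 0 := by positivity
  calc (n : ℝ) / q = (((n / (Int.gcd n q : ℤ)) * (Int.gcd n q : ℤ) : ℤ) : ℝ) /
        ((redDenom q n * Int.gcd n q : ℕ) : ℝ) := by rw [h1, h2]
    _ = _ := by
      push_cast
      exact mul_div_mul_right _ _ hg'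

/-- The product of all nonzero `2 × 2` minors of the coefficient matrix. -/
def minorProd (a b : Fin s → ℤ) : ℕ :=
  ∏ j, ∏ i, if a i * b j - a j * b i = 0 then 1 else (a i * b j - a j * b i).natAbs

lemma minorProd_pos (a b : Fin s → ℤ) : 0 < minorProd a b := by
  refine Finset.prod_pos fun j _ => Finset.prod_pos fun i _ => ?_
  split_ifs with h
  · exact one_pos
  · exact Int.natAbs_pos.2 h

/-- The `p`-adic counterpart of `exists_prod_forms_ge`, prime by prime. Let `j₀` be the form whose
value at `(u,v)` shares the largest power of `p` with `q`. If `i` is independent of `j₀`, the power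
of `p` shared by form `i` divides both values, hence the minor times `u` and times `v`, hence the
minor itself. The reduced denominators of 15 forms thus keep all of the `p`-part of `q` up to
minors. -/
lemma pow_fifteen_dvd (hab : ∀ j, (a j, b j) ≠ (0, 0)) (hq : 15 ≤ q0 a b) {q u v : ℕ}
    (hq0 : 0 < q) (huv : Nat.gcd (Nat.gcd u v) q = 1) :
    q ^ 15 ∣ minorProd a b * ∏ j, redDenom q (a j * u + b j * v) := by
  have hs := fifteen_le hq
  have hprod0 : ∏ j, redDenom q (a j * u + b j * v) ≠ 0 :=
    Finset.prod_ne_zero_iff.2 fun j _ => (redDenom_pos hq0 _).ne'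
  rw [← Nat.factorization_le_iff_dvd (by positivity)
    (mul_ne_zero (minorProd_pos a b).ne' hprod0)]
  intro p
  by_cases hp : p.Prime
  swap
  · simp [Nat.factorization_eq_zero_of_not_prime _ hp]
  set g : Fin s → ℕ := fun j => Int.gcd (a j * u + b j * v) q with hg
  have hg0 : ∀ j, g j ≠ 0 := fun j => (gcd_pos_of_pos hq0 _).ne'
  obtain ⟨j₀, -, hj₀⟩ := Finset.exists_max_image (Finset.univ : Finset (Fin s))
    (fun j => (g j).factorization p) ⟨⟨0, by omega⟩, Finset.mem_univ _⟩
  set I := Finset.univ.filter fun i : Fin s => a i * b j₀ - a j₀ * b i ≠ 0 with hI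
  have hIc := card_independent hab hq j₀
  set d : Fin s → ℕ := fun i => if a i * b j₀ - a j₀ * b i = 0 then 1 else
    (a i * b j₀ - a j₀ * b i).natAbs with hd
  have hd0 : ∀ i, d i ≠ 0 := by
    intro i
    simp only [hd]
    split_ifs with h
    · exact one_ne_zero
    · exact Int.natAbs_ne_zero.2 h
  have hred : ∀ j, q.factorization p =
      (redDenom q (a j * u + b j * v)).factorization p + (g j).factorization p := by
    intro j
    have h := redDenom_mul_gcd q (a j * u + b j * v)
    conv_lhs => rw [← h]
    rw [Nat.factorization_mul (redDenom_pos hq0 _).ne' (hg0 j)]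
    rfl
  have hkey : ∀ i ∈ I, (g i).factorization p ≤ (d i).factorization p := by
    intro i hi
    have hdet : a i * b j₀ - a j₀ * b i ≠ 0 := (Finset.mem_filter.1 hi).2
    rcases Nat.eq_zero_or_pos ((g i).factorization p) with h0 | h0
    · rw [h0]; exact Nat.zero_le _
    rw [← hp.pow_dvd_iff_le_factorization (hd0 i)]
    set f := (g i).factorization p with hf
    have hdi : d i = (a i * b j₀ - a j₀ * b i).natAbs := by simp only [hd]; rw [if_neg hdet]
    rw [hdi, ← Int.natCast_dvd]
    have hpi : ((p ^ f : ℕ) : ℤ) ∣ (g i : ℤ) := by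
      exact_mod_cast (hp.pow_dvd_iff_le_factorization (hg0 i)).2 le_rfl
    have hpj : ((p ^ f : ℕ) : ℤ) ∣ (g j₀ : ℤ) := by
      exact_mod_cast (hp.pow_dvd_iff_le_factorization (hg0 j₀)).2 (hj₀ i (Finset.mem_univ _))
    have hLi := hpi.trans (Int.gcd_dvd_left (a i * u + b i * v) (q : ℤ))
    have hLj := hpj.trans (Int.gcd_dvd_left (a j₀ * u + b j₀ * v) (q : ℤ))
    have hpq : p ∣ q := by
      have h1 : p ∣ g i := (dvd_pow_self p h0.ne').trans
        ((hp.pow_dvd_iff_le_factorization (hg0 i)).2 le_rfl)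
      exact h1.trans (by exact_mod_cast Int.gcd_dvd_right (a i * u + b i * v) (q : ℤ))
    have hu : ((p ^ f : ℕ) : ℤ) ∣ (a i * b j₀ - a j₀ * b i) * u := by
      have := dvd_sub (hLi.mul_left (b j₀)) (hLj.mul_left (b i))
      rwa [show b j₀ * (a i * u + b i * v) - b i * (a j₀ * u + b j₀ * v) =
        (a i * b j₀ - a j₀ * b i) * u by ring] at this
    have hv : ((p ^ f : ℕ) : ℤ) ∣ (a i * b j₀ - a j₀ * b i) * v := by
      have := dvd_sub (hLj.mul_left (a i)) (hLi.mul_left (a j₀))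
      rwa [show a i * (a j₀ * u + b j₀ * v) - a j₀ * (a i * u + b i * v) =
        (a i * b j₀ - a j₀ * b i) * v by ring] at this
    have hcop : ∀ w : ℕ, ¬ p ∣ w → IsCoprime ((p ^ f : ℕ) : ℤ) w := by
      intro w hw
      rw [Nat.isCoprime_iff_coprime]
      exact Nat.Coprime.pow_left _ (hp.coprime_iff_not_dvd.2 hw)
    by_cases hpu : p ∣ u
    · have hpv : ¬ p ∣ v := fun hpv => hp.not_dvd_one (by
        rw [← huv]; exact Nat.dvd_gcd (Nat.dvd_gcd hpu hpv) hpq)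
      exact (hcop v hpv).dvd_of_dvd_mul_right hv
    · exact (hcop u hpu).dvd_of_dvd_mul_right hu
  rw [Nat.factorization_pow, Nat.factorization_mul (minorProd_pos a b).ne' hprod0,
    Nat.factorization_prod fun j _ => (redDenom_pos hq0 _).ne']
  have hminor : ∑ i, (d i).factorization p ≤ (minorProd a b).factorization p := by
    have h1 : (∏ i, d i) ∣ minorProd a b :=
      Finset.dvd_prod_of_mem (fun j => ∏ i, if a i * b j - a j * b i = 0 then 1 else
        (a i * b j - a j * b i).natAbs) (Finset.mem_univ j₀)
    have h2 := (Nat.factorization_le_iff_dvd (Finset.prod_ne_zero_iff.2 fun i _ => hd0 i)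
      (minorProd_pos a b).ne').2 h1 p
    rw [Nat.factorization_prod fun i _ => hd0 i] at h2
    simpa using h2
  have h3 : ∑ i ∈ I, (d i).factorization p ≤ ∑ i, (d i).factorization p :=
    Finset.sum_le_sum_of_subset (Finset.subset_univ I)
  have h4 : ∑ i ∈ I, (redDenom q (a i * u + b i * v)).factorization p ≤
      ∑ i, (redDenom q (a i * u + b i * v)).factorization p :=
    Finset.sum_le_sum_of_subset (Finset.subset_univ I)
  have h5 : I.card * q.factorization p ≤
      ∑ i ∈ I, ((redDenom q (a i * u + b i * v)).factorization p + (d i).factorization p) := by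
    rw [← smul_eq_mul, ← Finset.sum_const]
    refine Finset.sum_le_sum fun i hi => ?_
    have := hred i
    have := hkey i hi
    omega
  rw [Finset.sum_add_distrib] at h5
  have h6 : 15 * q.factorization p ≤ I.card * q.factorization p := Nat.mul_le_mul_right _ hIc
  simp only [Finsupp.coe_smul, Pi.smul_apply, smul_eq_mul, Finsupp.coe_add, Pi.add_apply,
    Finsupp.coe_finsetSum, Finset.sum_apply]
  omega

/-- The finite and the archimedean estimate are combined so that one lemma serves three purposes: `X
= 0` for the complete sums, `q = 1` for the integrals, `X = P⁴` for the generating function. -/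
lemma prod_forms_rpow_le (hab : ∀ j, (a j, b j) ≠ (0, 0)) (hq : 15 ≤ q0 a b) :
    ∃ K : ℝ, 0 < K ∧ ∀ (q u v : ℕ) (X : ℝ) (x : ℝ × ℝ), 0 < q → Nat.gcd (Nat.gcd u v) q = 1 →
      0 ≤ X → ∏ j, ((redDenom q (a j * u + b j * v) : ℝ) *
        (1 + X * |a j * x.1 + b j * x.2|)) ^ (-(6 / 25) : ℝ) ≤
      K * (q * (1 + X * ‖x‖)) ^ (-(18 / 5) : ℝ) := by
  set D : ℝ := minorProd a b * (2 * coeffSize a b) ^ 15 with hD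
  have hM := one_le_coeffSize a b
  have hD0 : 0 < D := by
    have : (0 : ℝ) < minorProd a b := by exact_mod_cast minorProd_pos a b
    positivity
  refine ⟨D ^ (6 / 25 : ℝ), by positivity, fun q u v X x hq0 huv hX => ?_⟩
  have hq0' : (0 : ℝ) < q := by exact_mod_cast hq0
  have hr0 : ∀ j, (0 : ℝ) < redDenom q (a j * u + b j * v) := fun j => by
    exact_mod_cast redDenom_pos hq0 _
  have hT0 : ∀ j, 0 < 1 + X * |a j * x.1 + b j * x.2| := fun j => by positivity
  rw [Real.finsetProd_rpow _ _ fun j _ => (mul_pos (hr0 j) (hT0 j)).le,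
    Finset.prod_mul_distrib]
  have h1 := Nat.le_of_dvd (Nat.mul_pos (minorProd_pos a b) (Finset.prod_pos fun j _ =>
    redDenom_pos hq0 _)) (pow_fifteen_dvd hab hq hq0 huv)
  have h1' : (q : ℝ) ^ 15 ≤ minorProd a b * ∏ j, (redDenom q (a j * u + b j * v) : ℝ) := by
    exact_mod_cast h1
  have h2 := exists_prod_forms_ge hab hq hX x
  have hx0 : 0 < 1 + X * ‖x‖ := by positivity
  set A := ∏ j, (redDenom q (a j * u + b j * v) : ℝ)
  set B := ∏ j, (1 + X * |a j * x.1 + b j * x.2|)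
  have hA0 : 0 < A := Finset.prod_pos fun j _ => hr0 j
  have hB0 : 0 < B := Finset.prod_pos fun j _ => hT0 j
  have h3 : (q * (1 + X * ‖x‖)) ^ 15 ≤ D * (A * B) := by
    rw [mul_pow]
    calc _ ≤ (minorProd a b * A) * ((2 * coeffSize a b) ^ 15 * B) := by gcongr
      _ = _ := by rw [hD]; ring
  have h4 : (D * (A * B)) ^ (-(6 / 25) : ℝ) ≤ ((q * (1 + X * ‖x‖)) ^ 15) ^ (-(6 / 25) : ℝ) :=
    Real.rpow_le_rpow_of_nonpos (by positivity) h3 (by norm_num)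
  rw [Real.mul_rpow hD0.le (by positivity), ← Real.rpow_natCast, ← Real.rpow_mul (by positivity),
    Real.rpow_neg hD0.le, inv_mul_le_iff₀ (by positivity)] at h4
  norm_num at h4 ⊢
  exact h4

end Forms

/-! ### The generating function on the major arcs -/

section GenFun

variable {s : ℕ} {a b : Fin s → ℤ}

/-- The normalised product of complete sums attached to the arc centred at `(u/q, v/q)`. -/
noncomputable def arcSum (a b : Fin s → ℤ) (q u v : ℕ) : ℂ :=
  ∏ j, (quarticSum q (a j * u + b j * v) 0 / q)

/-- The product of the continuous generating functions. -/
noncomputable def integralProd (a b : Fin s → ℤ) (x : ℝ × ℝ) : ℂ :=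
  ∏ j, quarticIntegral (a j * x.1 + b j * x.2)

lemma continuous_integralProd : Continuous (integralProd a b) := by
  unfold integralProd
  exact continuous_finsetProd _ fun j _ => continuous_quarticIntegral.comp (by fun_prop)

lemma continuous_weylSum (k : ℕ) (P : ℝ) : Continuous (weylSum k P) := by
  unfold weylSum
  fun_prop

lemma continuous_genFun (k : ℕ) (P : ℝ) : Continuous fun x : ℝ × ℝ => genFun a b k P x.1 x.2 := by
  unfold genFun
  exact continuous_finsetProd _ fun j _ => (continuous_weylSum k P).comp (by fun_prop)

lemma quarticSum_mul_left {r g : ℕ} (hg : 0 < g) (n : ℤ) :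
    quarticSum (r * g) (g * n) 0 = g * quarticSum r n 0 := by
  unfold quarticSum
  rw [sum_range_mul_eq, Finset.mul_sum]
  refine Finset.sum_congr rfl fun y _ => ?_
  rw [Finset.sum_congr rfl (g := fun _ => ez r (n * (y : ℤ) ^ 4 + 0 * y)), Finset.sum_const,
    Finset.card_range, nsmul_eq_mul]
  intro z _
  rw [← ez_mul_left hg (n * (y : ℤ) ^ 4 + 0 * y), mul_comm g r]
  apply ez_congr
  obtain ⟨c, hc⟩ := quartic_dvd (q := r) n 0 ((y + r * z : ℕ) : ℤ) y ⟨z, by push_cast; ring⟩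
  refine ⟨c, ?_⟩
  push_cast at hc ⊢
  linear_combination (g : ℤ) * hc

lemma quarticSum_eq_of_gcd {q : ℕ} (hq : 0 < q) (n : ℤ) :
    quarticSum q n 0 / q =
      quarticSum (redDenom q n) (n / Int.gcd n q) 0 / (redDenom q n : ℂ) := by
  set g := Int.gcd n q with hg
  set r := redDenom q n with hr
  have hg0 : 0 < g := gcd_pos_of_pos hq n
  have hr0 : 0 < r := redDenom_pos hq n
  have h1 : (g : ℤ) * (n / (g : ℤ)) = n := Int.mul_ediv_cancel' (Int.gcd_dvd_left n (q : ℤ))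
  have h2 : r * g = q := redDenom_mul_gcd q n
  have h3 : quarticSum q n 0 = g * quarticSum r (n / g) 0 := by
    rw [← quarticSum_mul_left hg0, h1, h2]
  have hgc : (g : ℂ) ≠ 0 := by exact_mod_cast hg0.ne'
  have hrc : (r : ℂ) ≠ 0 := by exact_mod_cast hr0.ne'
  rw [h3, ← h2]
  push_cast
  field_simp

lemma prod_const_mul_le {K : ℝ} {f : Fin s → ℂ} {g : Fin s → ℝ}
    (h : ∀ j, ‖f j‖ ≤ K * g j) : ‖∏ j, f j‖ ≤ K ^ s * ∏ j, g j := by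
  rw [norm_prod]
  calc ∏ j, ‖f j‖ ≤ ∏ j, (K * g j) := Finset.prod_le_prod (fun _ _ => norm_nonneg _) fun j _ => h j
    _ = _ := by rw [Finset.prod_mul_distrib, Finset.prod_const, Finset.card_univ, Fintype.card_fin]

lemma exists_arcSum_bound (hab : ∀ j, (a j, b j) ≠ (0, 0)) (hq : 15 ≤ q0 a b) :
    ∃ K : ℝ, 0 < K ∧ ∀ q u v : ℕ, 0 < q → Nat.gcd (Nat.gcd u v) q = 1 →
      ‖arcSum a b q u v‖ ≤ K * (q : ℝ) ^ (-(18 / 5) : ℝ) := by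
  obtain ⟨K₀, hK₀, hS⟩ := exists_quarticSum_bound
  obtain ⟨K₁, hK₁, hF⟩ := prod_forms_rpow_le hab hq
  refine ⟨K₀ ^ s * K₁, by positivity, fun q u v hq0 huv => ?_⟩
  have h1 := hF q u v 0 0 hq0 huv le_rfl
  simp only [zero_mul, add_zero, mul_one] at h1
  unfold arcSum
  refine (prod_const_mul_le (K := K₀) (g := fun j =>
    (redDenom q (a j * u + b j * v) : ℝ) ^ (-(6 / 25) : ℝ)) fun j => ?_).trans ?_
  · have hr := redDenom_pos hq0 (a j * u + b j * v)
    have hr1 : (1 : ℝ) ≤ redDenom q (a j * u + b j * v) := by exact_mod_cast hr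
    rw [quarticSum_eq_of_gcd hq0, norm_div, Complex.norm_natCast]
    set r : ℕ := redDenom q (a j * u + b j * v)
    calc _ ≤ (K₀ * (r : ℝ) ^ (151 / 200 : ℝ)) / r := by
          gcongr
          exact hS r hr _ 0 (isCoprime_redDenom hq0 _)
      _ = K₀ * (r : ℝ) ^ ((151 / 200 : ℝ) - 1) := by
          rw [Real.rpow_sub_one (by linarith), mul_div_assoc]
      _ ≤ _ := mul_le_mul_of_nonneg_left
          (Real.rpow_le_rpow_of_exponent_le hr1 (by norm_num)) hK₀.le
  · rw [mul_assoc]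
    gcongr

lemma exists_integralProd_bound (hab : ∀ j, (a j, b j) ≠ (0, 0)) (hq : 15 ≤ q0 a b) :
    ∃ K : ℝ, 0 < K ∧ ∀ x : ℝ × ℝ, ‖integralProd a b x‖ ≤ K * (1 + ‖x‖) ^ (-(18 / 5) : ℝ) := by
  obtain ⟨K₀, hK₀, hI⟩ := exists_quarticIntegral_bound
  obtain ⟨K₁, hK₁, hF⟩ := prod_forms_rpow_le hab hq
  refine ⟨K₀ ^ s * K₁, by positivity, fun x => ?_⟩
  have h1 := hF 1 0 0 1 x one_pos (by simp) zero_le_one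
  have hr : ∀ n, redDenom 1 n = 1 := fun n => by simp [redDenom]
  simp only [hr, Nat.cast_one, one_mul] at h1
  unfold integralProd
  refine (prod_const_mul_le fun j => hI _).trans ?_
  rw [mul_assoc]
  gcongr

/-- Each form maps the arc around `(u/q, v/q)` into one around a reduced fraction of denominator `r
≤ q`. Its offset is at most `coeffSize a b/(qP³) ≤ coeffSize a b/(rP³)`, so the one-variable bound
applies with `C = coeffSize a b`. -/
lemma exists_genFun_bound (hab : ∀ j, (a j, b j) ≠ (0, 0)) (hq : 15 ≤ q0 a b) :
    ∃ K : ℝ, 0 < K ∧ ∀ (k : ℕ) (P : ℝ) (q u v : ℕ) (x : ℝ × ℝ), k ≤ 1 → 1 ≤ P → 0 < q →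
      (q : ℝ) ≤ P → Nat.gcd (Nat.gcd u v) q = 1 → ‖x‖ ≤ 1 / (q * P ^ 3) →
      ‖genFun a b k P (u / q + x.1) (v / q + x.2)‖ ≤
        K * P ^ s * (q * (1 + P ^ 4 * ‖x‖)) ^ (-(18 / 5) : ℝ) := by
  have hM := one_le_coeffSize a b
  obtain ⟨K₀, hK₀, hW⟩ := exists_weylSum_bound hM
  obtain ⟨K₁, hK₁, hF⟩ := prod_forms_rpow_le hab hq
  refine ⟨K₀ ^ s * K₁, by positivity, fun k P q u v x hk hP hq0 hqP huv hx => ?_⟩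
  have hP0 : 0 < P := by linarith
  have h1 := hF q u v (P ^ 4) x hq0 huv (by positivity)
  unfold genFun
  refine (prod_const_mul_le (K := K₀ * P) (g := fun j =>
    ((redDenom q (a j * u + b j * v) : ℝ) *
        (1 + P ^ 4 * |a j * x.1 + b j * x.2|)) ^ (-(6 / 25) : ℝ)) fun j => ?_).trans ?_
  · have hr := redDenom_pos hq0 (a j * u + b j * v)
    have hrq : (redDenom q (a j * u + b j * v) : ℝ) ≤ q := by exact_mod_cast redDenom_le q _
    have h2 : (a j : ℝ) * (u / q + x.1) + b j * (v / q + x.2) =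
        (((a j * u + b j * v) / Int.gcd (a j * u + b j * v) q : ℤ) : ℝ) /
          redDenom q (a j * u + b j * v) + (a j * x.1 + b j * x.2) := by
      rw [← div_eq_redDenom hq0]; push_cast; ring
    rw [h2]
    have hr' : (0 : ℝ) < redDenom q (a j * u + b j * v) := by exact_mod_cast hr
    refine hW k P _ _ _ hk hP hr (hrq.trans hqP) (isCoprime_redDenom hq0 _) ?_
    calc |a j * x.1 + b j * x.2| ≤ coeffSize a b * ‖x‖ := abs_form_le a b j x
      _ ≤ coeffSize a b * (1 / (q * P ^ 3)) := by gcongr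
      _ ≤ coeffSize a b * (1 / (redDenom q (a j * u + b j * v) * P ^ 3)) := by gcongr
      _ = _ := by ring
  · rw [mul_pow, show K₀ ^ s * K₁ * P ^ s * (q * (1 + P ^ 4 * ‖x‖)) ^ (-(18 / 5) : ℝ) =
      K₀ ^ s * P ^ s * (K₁ * (q * (1 + P ^ 4 * ‖x‖)) ^ (-(18 / 5) : ℝ)) by ring]
    gcongr

lemma norm_prod_sub_prod_le {ι : Type*} (S : Finset ι) (f g : ι → ℂ) {B E : ℝ} (hB : 0 ≤ B)
    (hE : 0 ≤ E) (hf : ∀ i ∈ S, ‖f i‖ ≤ B) (hg : ∀ i ∈ S, ‖g i‖ ≤ B)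
    (hfg : ∀ i ∈ S, ‖f i - g i‖ ≤ E * B) :
    ‖∏ i ∈ S, f i - ∏ i ∈ S, g i‖ ≤ S.card * E * B ^ S.card := by
  classical
  induction S using Finset.induction_on with
  | empty => simp
  | insert i S hi ih =>
    have ih := ih (fun j hj => hf j (Finset.mem_insert_of_mem hj))
      (fun j hj => hg j (Finset.mem_insert_of_mem hj))
      (fun j hj => hfg j (Finset.mem_insert_of_mem hj))
    have h1 := hfg i (Finset.mem_insert_self i S)
    have h2 := hf i (Finset.mem_insert_self i S)
    have h3 : ‖∏ j ∈ S, g j‖ ≤ B ^ S.card := by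
      rw [norm_prod, ← Finset.prod_const]
      exact Finset.prod_le_prod (fun _ _ => norm_nonneg _) fun j hj =>
        hg j (Finset.mem_insert_of_mem hj)
    rw [Finset.prod_insert hi, Finset.prod_insert hi, Finset.card_insert_of_notMem hi]
    have h4 : f i * ∏ j ∈ S, f j - g i * ∏ j ∈ S, g j =
        f i * (∏ j ∈ S, f j - ∏ j ∈ S, g j) + (f i - g i) * ∏ j ∈ S, g j := by ring
    rw [h4]
    refine (norm_add_le _ _).trans ?_
    rw [norm_mul, norm_mul]
    calc _ ≤ B * (S.card * E * B ^ S.card) + (E * B) * B ^ S.card := by gcongr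
      _ = _ := by push_cast; ring

lemma norm_genFun_sub_main_le {k : ℕ} (hk : k ≤ 1) {P : ℝ} (hP : 1 ≤ P) {q u v : ℕ} (hq : 0 < q)
    (x : ℝ × ℝ) :
    ‖genFun a b k P (u / q + x.1) (v / q + x.2) -
      (P / 2 : ℂ) ^ s * arcSum a b q u v * integralProd a b (P ^ 4 * x.1, P ^ 4 * x.2)‖ ≤
      s * (50 * coeffSize a b * (q * (1 + P ^ 4 * ‖x‖)) / P) * (2 * P) ^ s := by
  have hP0 : 0 < P := by linarith
  have hM := one_le_coeffSize a b
  have hq0 : (0 : ℝ) < q := by exact_mod_cast hq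
  have hint : ∀ γ, ‖quarticIntegral γ‖ ≤ 2 := by
    intro γ
    unfold quarticIntegral
    have := intervalIntegral.norm_integral_le_of_norm_le_const (a := -1) (b := 1) (C := 1)
      (f := fun t => e (γ * t ^ 4)) (fun t _ => (norm_e _).le)
    norm_num at this
    exact this
  have h0 : (P / 2 : ℂ) ^ s * arcSum a b q u v * integralProd a b (P ^ 4 * x.1, P ^ 4 * x.2) =
      ∏ j, ((quarticSum q (a j * u + b j * v) 0 / q) *
        ((P / 2 : ℂ) * quarticIntegral (P ^ 4 * (a j * x.1 + b j * x.2)))) := by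
    rw [Finset.prod_mul_distrib, Finset.prod_mul_distrib, Finset.prod_const, Finset.card_univ,
      Fintype.card_fin]
    unfold arcSum integralProd
    have : ∀ j, quarticIntegral (a j * (P ^ 4 * x.1) + b j * (P ^ 4 * x.2)) =
        quarticIntegral (P ^ 4 * (a j * x.1 + b j * x.2)) := fun j => by congr 1; ring
    simp only [this]
    ring
  rw [h0]
  unfold genFun
  have h := norm_prod_sub_prod_le (Finset.univ : Finset (Fin s))
    (fun j => weylSum k P (a j * (u / q + x.1) + b j * (v / q + x.2)))
    (fun j => (quarticSum q (a j * u + b j * v) 0 / q) *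
        ((P / 2 : ℂ) * quarticIntegral (P ^ 4 * (a j * x.1 + b j * x.2))))
    (B := 2 * P) (E := 50 * coeffSize a b * (q * (1 + P ^ 4 * ‖x‖)) / P) (by positivity)
    (by positivity) (fun j _ => norm_weylSum_le hP _) ?_ ?_
  · rwa [Finset.card_univ, Fintype.card_fin] at h
  · intro j _
    rw [norm_mul, norm_mul, norm_div, norm_div, Complex.norm_natCast, Complex.norm_real,
      Real.norm_eq_abs, abs_of_pos hP0]
    have h1 : ‖quarticSum q (a j * u + b j * v) 0‖ / q ≤ 1 := by
      rw [div_le_one hq0]; exact norm_quarticSum_le _ _ _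
    calc _ ≤ 1 * (P / ‖(2 : ℂ)‖ * 2) := by gcongr; exact hint _
      _ ≤ 2 * P := by norm_num; linarith
  · intro j _
    have h2 : (a j : ℝ) * (u / q + x.1) + b j * (v / q + x.2) =
        ((a j * u + b j * v : ℤ) : ℝ) / q + (a j * x.1 + b j * x.2) := by push_cast; ring
    rw [h2]
    refine (norm_weylSum_sub_main_le hk hP hq _ _).trans ?_
    have h3 := abs_form_le a b j x
    have h4 : 1 + P ^ 4 * |a j * x.1 + b j * x.2| ≤ coeffSize a b * (1 + P ^ 4 * ‖x‖) := by
      have := mul_le_mul_of_nonneg_left h3 (by positivity : 0 ≤ P ^ 4)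
      linarith
    calc 100 * (q * (1 + P ^ 4 * |a j * x.1 + b j * x.2|))
        ≤ 100 * (q * (coeffSize a b * (1 + P ^ 4 * ‖x‖))) := by gcongr
      _ = _ := by field_simp; ring

end GenFun

/-! ### The singular series -/

section SingularSeries

variable {s : ℕ} {a b : Fin s → ℤ}

lemma addChar_sum {A ι : Type*} [AddCommMonoid A] (ψ : AddChar A ℂ) (S : Finset ι) (f : ι → A) :
    ψ (∑ i ∈ S, f i) = ∏ i ∈ S, ψ (f i) := by
  classical
  induction S using Finset.induction_on with
  | empty => simp
  | insert i S hi ih => rw [Finset.sum_insert hi, Finset.prod_insert hi, AddChar.map_add_eq_mul, ih]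

lemma sum_prod_zmodQuarticSum (a b : Fin s → ℤ) (q : ℕ) [NeZero q] :
    ∑ u : ZMod q, ∑ v : ZMod q, ∏ j, zmodQuarticSum q (a j * u + b j * v) 0 =
      (q : ℂ) ^ 2 * numSolMod a b q := by
  classical
  have h1 : ∀ u v : ZMod q, ∏ j, zmodQuarticSum q (a j * u + b j * v) 0 =
      ∑ x : Fin s → ZMod q, (ZMod.stdAddChar (u * ∑ j, (a j : ZMod q) * x j ^ 4) : ℂ) *
        ZMod.stdAddChar (v * ∑ j, (b j : ZMod q) * x j ^ 4) := by
    intro u v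
    unfold zmodQuarticSum
    rw [Fintype.prod_sum]
    refine Finset.sum_congr rfl fun x _ => ?_
    rw [← AddChar.map_add_eq_mul, Finset.mul_sum, Finset.mul_sum, ← Finset.sum_add_distrib,
      addChar_sum]
    refine Finset.prod_congr rfl fun j _ => ?_
    congr 1
    ring
  simp_rw [h1]
  rw [Finset.sum_congr rfl fun u _ => Finset.sum_comm, Finset.sum_comm]
  unfold numSolMod
  rw [Nat.card_eq_fintype_card, Fintype.card_subtype, Finset.card_filter]
  push_cast
  rw [Finset.mul_sum]
  refine Finset.sum_congr rfl fun x _ => ?_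
  rw [← Finset.sum_mul_sum, stdAddChar_sum_mul, stdAddChar_sum_mul]
  split_ifs <;> simp_all
  ring

/-- The coefficient of the singular series: the sum of `arcSum` over all centres with
denominator `q`. -/
noncomputable def arcCoeff (a b : Fin s → ℤ) (q : ℕ) : ℂ :=
  ∑ w ∈ (Finset.range q ×ˢ Finset.range q).filter (fun w => Nat.gcd (Nat.gcd w.1 w.2) q = 1),
    arcSum a b q w.1 w.2

lemma arcSum_mul_left {r g : ℕ} (hr : 0 < r) (hg : 0 < g) (u v : ℕ) :
    arcSum a b (r * g) (g * u) (g * v) = arcSum a b r u v := by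
  unfold arcSum
  refine Finset.prod_congr rfl fun j _ => ?_
  have h : a j * ((g * u : ℕ) : ℤ) + b j * ((g * v : ℕ) : ℤ) = g * (a j * u + b j * v) := by
    push_cast; ring
  rw [h, quarticSum_mul_left hg]
  have hgc : (g : ℂ) ≠ 0 := by exact_mod_cast hg.ne'
  have hrc : (r : ℂ) ≠ 0 := by exact_mod_cast hr.ne'
  push_cast
  field_simp

/-- Orthogonality turns the sum of `arcSum` over all pairs modulo `q` into the solution count. Each
pair reduces to a unique primitive one with denominator `d ∣ q`, and `arcSum` depends only on the
fractions. -/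
lemma sum_divisors_arcCoeff {q : ℕ} (hq : 0 < q) :
    ∑ d ∈ q.divisors, arcCoeff a b d = (q : ℂ) ^ (2 - (s : ℤ)) * numSolMod a b q := by
  have : NeZero q := ⟨hq.ne'⟩
  have hqc : (q : ℂ) ≠ 0 := by exact_mod_cast hq.ne'
  have h1 : ∑ w ∈ Finset.range q ×ˢ Finset.range q, arcSum a b q w.1 w.2 =
      (q : ℂ) ^ (2 - (s : ℤ)) * numSolMod a b q := by
    have h2 := sum_prod_zmodQuarticSum a b q
    rw [zpow_sub₀ hqc, zpow_natCast, div_mul_eq_mul_div, eq_div_iff (pow_ne_zero _ hqc)]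
    rw [show (q : ℂ) ^ (2 : ℤ) = (q : ℂ) ^ 2 by norm_cast, ← h2, Finset.sum_product, Finset.sum_mul,
      ← sum_range_eq_sum_zmod]
    refine Finset.sum_congr rfl fun u _ => ?_
    rw [Finset.sum_mul, ← sum_range_eq_sum_zmod]
    refine Finset.sum_congr rfl fun v _ => ?_
    unfold arcSum
    rw [Finset.prod_div_distrib, Finset.prod_const, Finset.card_univ, Fintype.card_fin,
      div_mul_cancel₀ _ (pow_ne_zero _ hqc)]
    refine Finset.prod_congr rfl fun j _ => ?_
    rw [quarticSum_eq_zmod]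
    push_cast
    rfl
  rw [← h1, ← Finset.sum_fiberwise_of_maps_to (s := Finset.range q ×ˢ Finset.range q)
    (t := q.divisors) (g := fun w => q / Nat.gcd (Nat.gcd w.1 w.2) q)
    (fun w _ => Nat.mem_divisors.2 ⟨Nat.div_dvd_of_dvd (Nat.gcd_dvd_right _ _), hq.ne'⟩)]
  refine Finset.sum_congr rfl fun d hd => ?_
  obtain ⟨⟨g, rfl⟩, -⟩ := Nat.mem_divisors.1 hd
  have hd0 : 0 < d := Nat.pos_of_mul_pos_right hq
  have hg0 : 0 < g := Nat.pos_of_mul_pos_left hq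
  unfold arcCoeff
  have hgcd : ∀ w : ℕ × ℕ, d * g / Nat.gcd (Nat.gcd w.1 w.2) (d * g) = d →
      Nat.gcd (Nat.gcd w.1 w.2) (d * g) = g := by
    intro w hw
    have h2 := Nat.div_mul_cancel (Nat.gcd_dvd_right (Nat.gcd w.1 w.2) (d * g))
    rw [hw] at h2
    exact Nat.eq_of_mul_eq_mul_left hd0 h2
  refine Finset.sum_nbij' (fun w => (g * w.1, g * w.2)) (fun w => (w.1 / g, w.2 / g)) ?_ ?_ ?_ ?_ ?_
  · rintro ⟨u, v⟩ hw
    simp only [Finset.mem_filter, Finset.mem_product, Finset.mem_range] at hw ⊢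
    refine ⟨⟨?_, ?_⟩, ?_⟩
    · rw [mul_comm d g]; exact Nat.mul_lt_mul_of_pos_left hw.1.1 hg0
    · rw [mul_comm d g]; exact Nat.mul_lt_mul_of_pos_left hw.1.2 hg0
    · rw [Nat.gcd_mul_left, mul_comm d g, Nat.gcd_mul_left, hw.2, mul_one,
        Nat.mul_div_cancel_left _ hg0]
  · rintro ⟨u, v⟩ hw
    simp only [Finset.mem_filter, Finset.mem_product, Finset.mem_range] at hw ⊢
    have h2 := hgcd (u, v) hw.2
    simp only at h2
    have h3 : g ∣ Nat.gcd u v := by rw [← h2]; exact Nat.gcd_dvd_left _ _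
    obtain ⟨u', rfl⟩ := h3.trans (Nat.gcd_dvd_left _ _)
    obtain ⟨v', rfl⟩ := h3.trans (Nat.gcd_dvd_right _ _)
    rw [Nat.mul_div_cancel_left _ hg0, Nat.mul_div_cancel_left _ hg0]
    rw [Nat.gcd_mul_left, mul_comm d g, Nat.gcd_mul_left] at h2
    refine ⟨⟨?_, ?_⟩, ?_⟩
    · have := hw.1.1; rw [mul_comm d g] at this; exact Nat.lt_of_mul_lt_mul_left this
    · have := hw.1.2; rw [mul_comm d g] at this; exact Nat.lt_of_mul_lt_mul_left this
    · exact Nat.eq_of_mul_eq_mul_left hg0 (by rw [h2, mul_one])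
  · rintro ⟨u, v⟩ _
    simp [Nat.mul_div_cancel_left _ hg0]
  · rintro ⟨u, v⟩ hw
    simp only [Finset.mem_filter] at hw
    have h2 := hgcd (u, v) hw.2
    simp only at h2
    have h3 : g ∣ Nat.gcd u v := by rw [← h2]; exact Nat.gcd_dvd_left _ _
    simp [Nat.mul_div_cancel' (h3.trans (Nat.gcd_dvd_left _ _)),
      Nat.mul_div_cancel' (h3.trans (Nat.gcd_dvd_right _ _))]
  · rintro ⟨u, v⟩ _
    exact (arcSum_mul_left hd0 hg0 u v).symm

/-- At most `q²` centres, each of size `q^{-18/5}`. -/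
lemma exists_arcCoeff_bound (hab : ∀ j, (a j, b j) ≠ (0, 0)) (hq : 15 ≤ q0 a b) :
    ∃ K : ℝ, 0 < K ∧ ∀ q : ℕ, 0 < q → ‖arcCoeff a b q‖ ≤ K * (q : ℝ) ^ (-(8 / 5) : ℝ) := by
  obtain ⟨K, hK, h⟩ := exists_arcSum_bound hab hq
  refine ⟨K, hK, fun q hq0 => ?_⟩
  have hq0' : (0 : ℝ) < q := by exact_mod_cast hq0
  unfold arcCoeff
  refine (norm_sum_le _ _).trans ?_
  calc _ ≤ ∑ w ∈ (Finset.range q ×ˢ Finset.range q).filter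
        (fun w => Nat.gcd (Nat.gcd w.1 w.2) q = 1), K * (q : ℝ) ^ (-(18 / 5) : ℝ) :=
        Finset.sum_le_sum fun w hw => h q w.1 w.2 hq0 (Finset.mem_filter.1 hw).2
    _ ≤ ∑ w ∈ Finset.range q ×ˢ Finset.range q, K * (q : ℝ) ^ (-(18 / 5) : ℝ) :=
        Finset.sum_le_sum_of_subset_of_nonneg (Finset.filter_subset _ _)
          fun _ _ _ => by positivity
    _ = K * ((q : ℝ) ^ (2 : ℝ) * (q : ℝ) ^ (-(18 / 5) : ℝ)) := by
        rw [Finset.sum_const, Finset.card_product, Finset.card_range, nsmul_eq_mul]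
        rw [show (q : ℝ) ^ (2 : ℝ) = (q : ℝ) ^ 2 by norm_cast]
        push_cast; ring
    _ = _ := by rw [← Real.rpow_add hq0']; norm_num

lemma numSolMod_mul {m n : ℕ} (hmn : Nat.Coprime m n) :
    numSolMod a b (m * n) = numSolMod a b m * numSolMod a b n := by
  unfold numSolMod
  rw [← Nat.card_prod]
  let φ := ZMod.chineseRemainder hmn
  let E : (Fin s → ZMod (m * n)) ≃ (Fin s → ZMod m) × (Fin s → ZMod n) :=
    (Equiv.piCongrRight fun _ => φ.toEquiv).trans (Equiv.arrowProdEquivProdArrow _ _ _)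
  have hE1 : ∀ x j, (E x).1 j = (φ (x j)).1 := fun _ _ => rfl
  have hE2 : ∀ x j, (E x).2 j = (φ (x j)).2 := fun _ _ => rfl
  have hform : ∀ (c : Fin s → ℤ) (x : Fin s → ZMod (m * n)),
      ∑ j, (c j : ZMod (m * n)) * x j ^ 4 = 0 ↔
      (∑ j, (c j : ZMod m) * (E x).1 j ^ 4 = 0 ∧ ∑ j, (c j : ZMod n) * (E x).2 j ^ 4 = 0) := by
    intro c x
    rw [← map_eq_zero_iff φ φ.injective, map_sum, Prod.ext_iff, Prod.fst_sum, Prod.snd_sum]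
    simp only [map_mul, map_pow, map_intCast, Prod.fst_mul, Prod.snd_mul, Prod.pow_fst,
      Prod.pow_snd, Prod.fst_intCast, Prod.snd_intCast, Prod.fst_zero, Prod.snd_zero, hE1, hE2]
  refine Nat.card_congr ((E.subtypeEquiv (q := fun y =>
    (∑ j, (a j : ZMod m) * y.1 j ^ 4 = 0 ∧ ∑ j, (b j : ZMod m) * y.1 j ^ 4 = 0) ∧
    (∑ j, (a j : ZMod n) * y.2 j ^ 4 = 0 ∧ ∑ j, (b j : ZMod n) * y.2 j ^ 4 = 0)) ?_).trans
    (Equiv.subtypeProdEquivProd (p := fun y : Fin s → ZMod m =>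
      ∑ j, (a j : ZMod m) * y j ^ 4 = 0 ∧ ∑ j, (b j : ZMod m) * y j ^ 4 = 0)
      (q := fun y : Fin s → ZMod n =>
      ∑ j, (a j : ZMod n) * y j ^ 4 = 0 ∧ ∑ j, (b j : ZMod n) * y j ^ 4 = 0)))
  intro x
  rw [hform a, hform b]
  tauto

lemma numSolMod_one : numSolMod a b 1 = 1 := by
  unfold numSolMod
  have : Unique {x : Fin s → ZMod 1 //
      ∑ j, (a j : ZMod 1) * x j ^ 4 = 0 ∧ ∑ j, (b j : ZMod 1) * x j ^ 4 = 0} :=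
    ⟨⟨⟨0, Subsingleton.elim _ _, Subsingleton.elim _ _⟩⟩, fun _ => Subsingleton.elim _ _⟩
  exact Nat.card_unique

/-- The normalised number of solutions `q^{2-s} M(q)` as an arithmetic function. -/
noncomputable def normCount (a b : Fin s → ℤ) : ArithmeticFunction ℝ :=
  ⟨fun q => if q = 0 then 0 else (q : ℝ) ^ (2 - (s : ℤ)) * numSolMod a b q, by simp⟩

lemma normCount_apply {q : ℕ} (hq : 0 < q) :
    normCount a b q = (q : ℝ) ^ (2 - (s : ℤ)) * numSolMod a b q := by
  change (if q = 0 then 0 else (q : ℝ) ^ (2 - (s : ℤ)) * numSolMod a b q) = _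
  rw [if_neg hq.ne']

lemma isMultiplicative_normCount : (normCount a b).IsMultiplicative := by
  rw [ArithmeticFunction.IsMultiplicative.iff_ne_zero]
  refine ⟨by rw [normCount_apply one_pos, numSolMod_one]; simp, fun {m n} hm hn hmn => ?_⟩
  rw [normCount_apply (Nat.mul_pos (Nat.pos_of_ne_zero hm) (Nat.pos_of_ne_zero hn)),
    normCount_apply (Nat.pos_of_ne_zero hm), normCount_apply (Nat.pos_of_ne_zero hn),
    numSolMod_mul hmn]
  push_cast
  rw [mul_zpow]
  ring

/-- The real arithmetic function whose values are the coefficients of the singular series. -/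
noncomputable def seriesCoeff (a b : Fin s → ℤ) : ArithmeticFunction ℝ :=
  ((ArithmeticFunction.moebius : ArithmeticFunction ℤ) : ArithmeticFunction ℝ) * normCount a b

lemma isMultiplicative_seriesCoeff : (seriesCoeff a b).IsMultiplicative :=
  ArithmeticFunction.isMultiplicative_moebius.intCast.mul isMultiplicative_normCount

/-- Möbius inversion of `sum_divisors_arcCoeff`. It shows that the coefficients are real, and
transfers to them the multiplicativity that solution counts have by the Chinese remainder theorem.
-/
lemma seriesCoeff_eq_arcCoeff {q : ℕ} (hq : 0 < q) :
    (seriesCoeff a b q : ℂ) = arcCoeff a b q := by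
  have h := (ArithmeticFunction.sum_eq_iff_sum_mul_moebius_eq (f := arcCoeff a b)
    (g := fun q => (q : ℂ) ^ (2 - (s : ℤ)) * numSolMod a b q)).1
    (fun n hn => sum_divisors_arcCoeff hn) q hq
  rw [← h]
  unfold seriesCoeff
  rw [ArithmeticFunction.mul_apply]
  push_cast
  refine Finset.sum_congr rfl fun x hx => ?_
  have hx2 : 0 < x.2 := Nat.pos_of_ne_zero (Nat.ne_zero_of_mem_divisorsAntidiagonal hx).2
  rw [normCount_apply hx2]
  push_cast
  rfl

lemma sum_divisors_seriesCoeff {q : ℕ} (hq : 0 < q) :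
    ∑ d ∈ q.divisors, seriesCoeff a b d = (q : ℝ) ^ (2 - (s : ℤ)) * numSolMod a b q := by
  have h := sum_divisors_arcCoeff (a := a) (b := b) hq
  rw [Finset.sum_congr rfl fun d hd => (seriesCoeff_eq_arcCoeff
    (Nat.pos_of_mem_divisors hd)).symm] at h
  apply Complex.ofReal_injective
  push_cast
  exact h

lemma normalizedCount_eq {p : ℕ} (hp : p.Prime) (h : ℕ) :
    normalizedCount a b p h = ∑ i ∈ Finset.range (h + 1), seriesCoeff a b (p ^ i) := by
  rw [← Nat.sum_divisors_prime_pow hp, sum_divisors_seriesCoeff (pow_pos hp.pos h)]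
  unfold normalizedCount
  push_cast
  rw [mul_comm (2 - (s : ℤ)) (h : ℤ), zpow_mul, zpow_natCast]

lemma summable_seriesCoeff (hab : ∀ j, (a j, b j) ≠ (0, 0)) (hq : 15 ≤ q0 a b) :
    Summable fun n => ‖seriesCoeff a b n‖ := by
  obtain ⟨K, hK, h⟩ := exists_arcCoeff_bound hab hq
  refine Summable.of_nonneg_of_le (fun _ => norm_nonneg _) (fun n => ?_)
    ((Real.summable_nat_rpow.2 (by norm_num : (-(8 / 5) : ℝ) < -1)).mul_left K)
  rcases Nat.eq_zero_or_pos n with rfl | hn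
  · simp
  · have := h n hn
    rwa [← seriesCoeff_eq_arcCoeff hn, Complex.norm_real] at this

lemma tendsto_normalizedCount (hab : ∀ j, (a j, b j) ≠ (0, 0)) (hq : 15 ≤ q0 a b) {p : ℕ}
    (hp : p.Prime) :
    Tendsto (normalizedCount a b p) atTop (𝓝 (∑' i, seriesCoeff a b (p ^ i))) := by
  have hs : Summable fun i => seriesCoeff a b (p ^ i) :=
    (summable_seriesCoeff hab hq).of_norm.comp_injective (Nat.pow_right_injective hp.two_le)
  have := (tendsto_add_atTop_iff_nat 1).2 hs.hasSum.tendsto_sum_nat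
  exact this.congr fun h => (normalizedCount_eq hp h).symm

lemma padicDensity_eq (hab : ∀ j, (a j, b j) ≠ (0, 0)) (hq : 15 ≤ q0 a b) {p : ℕ}
    (hp : p.Prime) : padicDensity a b p = ∑' i, seriesCoeff a b (p ^ i) :=
  (tendsto_normalizedCount hab hq hp).limUnder_eq

lemma hasProd_padicDensity (hab : ∀ j, (a j, b j) ≠ (0, 0)) (hq : 15 ≤ q0 a b) :
    HasProd (fun p : Nat.Primes => padicDensity a b p) (∑' n, seriesCoeff a b n) := by
  have h := isMultiplicative_seriesCoeff.eulerProduct_hasProd (summable_seriesCoeff hab hq)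
  rwa [← funext fun p : Nat.Primes => padicDensity_eq hab hq p.2] at h

lemma singularSeries_eq (hab : ∀ j, (a j, b j) ≠ (0, 0)) (hq : 15 ≤ q0 a b) :
    singularSeries a b = ∑' n, seriesCoeff a b n :=
  (hasProd_padicDensity hab hq).tprod_eq

lemma prime_pow_succ_injective :
    Function.Injective fun x : Nat.Primes × ℕ => (x.1 : ℕ) ^ (x.2 + 1) := by
  rintro ⟨p, i⟩ ⟨r, j⟩ h
  refine Nat.Primes.prodNatEquiv.injective (Subtype.ext ?_)
  rw [Nat.Primes.coe_prodNatEquiv_apply, Nat.Primes.coe_prodNatEquiv_apply]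
  exact h

/-- `𝔰_p - 1` is the sum of the coefficients at the positive powers of `p`. Prime powers with
distinct `(p, i)` are distinct, so everything is dominated by part of one absolutely convergent
series. -/
lemma summable_abs_padicDensity_sub_one (hab : ∀ j, (a j, b j) ≠ (0, 0)) (hq : 15 ≤ q0 a b) :
    Summable fun p : Nat.Primes => |padicDensity a b p - 1| := by
  have hs := summable_seriesCoeff hab hq
  have h1 : Summable fun x : Nat.Primes × ℕ => ‖seriesCoeff a b ((x.1 : ℕ) ^ (x.2 + 1))‖ :=
    hs.comp_injective prime_pow_succ_injective
  have h3 : Summable fun p : Nat.Primes => ∑' i, ‖seriesCoeff a b ((p : ℕ) ^ (i + 1))‖ := h1.prod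
  refine Summable.of_nonneg_of_le (fun _ => abs_nonneg _) (fun p => ?_) h3
  have hsp : Summable fun i => ‖seriesCoeff a b ((p : ℕ) ^ i)‖ :=
    hs.comp_injective (Nat.pow_right_injective p.2.two_le)
  have h2 : padicDensity a b p - 1 = ∑' i, seriesCoeff a b ((p : ℕ) ^ (i + 1)) := by
    rw [padicDensity_eq hab hq p.2, hsp.of_norm.tsum_eq_zero_add, pow_zero,
      isMultiplicative_seriesCoeff.map_one,
      add_sub_cancel_left]
  rw [h2, ← Real.norm_eq_abs]
  exact norm_tsum_le_tsum_norm ((summable_nat_add_iff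
    (f := fun i => ‖seriesCoeff a b ((p : ℕ) ^ i)‖) 1).2 hsp)

end SingularSeries

/-! ### The singular integral -/

section SingularIntegral

variable {s : ℕ} {a b : Fin s → ℤ}

lemma integrable_one_add_norm_rpow {r : ℝ} (hr : 2 < r) :
    Integrable (fun x : ℝ × ℝ => (1 + ‖x‖) ^ (-r)) := by
  apply integrable_one_add_norm
  rw [Module.finrank_prod, Module.finrank_self]
  norm_num
  exact hr

/-- The split `18/5 = 1/2 + 31/10` buys the saving `R^{-1/2}`. The remaining `31/10` is still
integrable over the plane and, after `q²` centres, leaves the summable `q^{-11/10}`. -/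
lemma rpow_tail_le {y R : ℝ} (hR : 0 < R) (h : R ≤ y) :
    y ^ (-(18 / 5) : ℝ) ≤ R ^ (-(1 / 2) : ℝ) * y ^ (-(31 / 10) : ℝ) := by
  have hy : 0 < y := hR.trans_le h
  have h1 : y ^ (-(18 / 5) : ℝ) = y ^ (-(1 / 2) : ℝ) * y ^ (-(31 / 10) : ℝ) := by
    rw [← Real.rpow_add hy]; norm_num
  rw [h1]
  exact mul_le_mul_of_nonneg_right (Real.rpow_le_rpow_of_nonpos hR h (by norm_num)) (by positivity)

lemma integrable_integralProd (hab : ∀ j, (a j, b j) ≠ (0, 0)) (hq : 15 ≤ q0 a b) :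
    Integrable (integralProd a b) := by
  obtain ⟨K, hK, h⟩ := exists_integralProd_bound hab hq
  exact Integrable.mono' ((integrable_one_add_norm_rpow (by norm_num)).const_mul K)
    continuous_integralProd.aestronglyMeasurable (Filter.Eventually.of_forall h)

/-- The region is left general because it is used both for the half-open squares of the truncated
integral and for the closed balls coming from the arcs. -/
lemma exists_setIntegral_tail_bound (hab : ∀ j, (a j, b j) ≠ (0, 0)) (hq : 15 ≤ q0 a b) :
    ∃ K : ℝ, 0 < K ∧ ∀ (R : ℝ) (S : Set (ℝ × ℝ)), 0 < R → MeasurableSet S →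
      (∀ x ∉ S, R ≤ ‖x‖) →
      ‖(∫ x in S, integralProd a b x) - ∫ x, integralProd a b x‖ ≤ K * R ^ (-(1 / 2) : ℝ) := by
  obtain ⟨K, hK, h⟩ := exists_integralProd_bound hab hq
  have hint := integrable_one_add_norm_rpow (r := 31 / 10) (by norm_num)
  set J : ℝ := ∫ x : ℝ × ℝ, (1 + ‖x‖) ^ (-(31 / 10) : ℝ)
  have hJ : 0 ≤ J := integral_nonneg fun x => by positivity
  refine ⟨K * (J + 1), by positivity, fun R S hR hS hRS => ?_⟩
  have hf := integrable_integralProd hab hq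
  rw [← integral_add_compl hS hf, sub_add_cancel_left, norm_neg]
  have h1 : ‖∫ x in Sᶜ, integralProd a b x‖ ≤
      ∫ x in Sᶜ, K * (R ^ (-(1 / 2) : ℝ) * (1 + ‖x‖) ^ (-(31 / 10) : ℝ)) := by
    refine norm_integral_le_of_norm_le ((hint.const_mul _).const_mul _).integrableOn ?_
    refine (ae_restrict_iff' hS.compl).2 (Filter.Eventually.of_forall fun x hx => ?_)
    refine (h x).trans (mul_le_mul_of_nonneg_left ?_ hK.le)
    exact rpow_tail_le hR (by linarith [hRS x hx])
  refine h1.trans ?_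
  rw [integral_const_mul, integral_const_mul]
  have h2 : ∫ x in Sᶜ, (1 + ‖x‖) ^ (-(31 / 10) : ℝ) ≤ J :=
    setIntegral_le_integral hint (Filter.Eventually.of_forall fun x => by positivity)
  have hRp : 0 < R ^ (-(1 / 2) : ℝ) := by positivity
  calc _ ≤ K * (R ^ (-(1 / 2) : ℝ) * (J + 1)) := by gcongr; linarith
    _ = _ := by ring

lemma truncSingularIntegral_eq {T : ℝ} (hT : 0 ≤ T) :
    truncSingularIntegral a b T =
      ∫ x in Set.Ioc (-T) T ×ˢ Set.Ioc (-T) T, integralProd a b x := by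
  have hint : IntegrableOn (integralProd a b) (Set.Ioc (-T) T ×ˢ Set.Ioc (-T) T) := by
    refine (continuous_integralProd.continuousOn.integrableOn_compact
      (isCompact_Icc.prod isCompact_Icc : IsCompact (Set.Icc (-T) T ×ˢ Set.Icc (-T) T))).mono_set ?_
    exact Set.prod_mono Set.Ioc_subset_Icc_self Set.Ioc_subset_Icc_self
  unfold truncSingularIntegral
  rw [intervalIntegral.integral_of_le (by linarith)]
  unfold IntegrableOn at hint
  rw [Measure.volume_eq_prod, ← Measure.prod_restrict] at hint ⊢
  rw [integral_prod_symm _ hint]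
  refine integral_congr_ae (Filter.Eventually.of_forall fun β => ?_)
  simp only
  rw [intervalIntegral.integral_of_le (by linarith)]
  rfl

lemma tendsto_truncSingularIntegral (hab : ∀ j, (a j, b j) ≠ (0, 0)) (hq : 15 ≤ q0 a b) :
    Tendsto (truncSingularIntegral a b) atTop (𝓝 (∫ x, integralProd a b x)) := by
  obtain ⟨K, hK, h⟩ := exists_setIntegral_tail_bound hab hq
  rw [tendsto_iff_norm_sub_tendsto_zero]
  have hlim : Tendsto (fun T : ℝ => K * T ^ (-(1 / 2) : ℝ)) atTop (𝓝 0) := by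
    have := (tendsto_rpow_neg_atTop (by norm_num : (0 : ℝ) < 1 / 2)).const_mul K
    rwa [mul_zero] at this
  refine squeeze_zero' (Filter.Eventually.of_forall fun _ => norm_nonneg _) ?_ hlim
  filter_upwards [eventually_gt_atTop 0] with T hT
  rw [truncSingularIntegral_eq hT.le]
  refine h T _ hT (measurableSet_Ioc.prod measurableSet_Ioc) fun x hx => ?_
  by_contra hcon
  push Not at hcon
  apply hx
  have h1 := abs_lt.1 ((norm_fst_le x).trans_lt hcon)
  have h2 := abs_lt.1 ((norm_snd_le x).trans_lt hcon)
  exact ⟨⟨h1.1, h1.2.le⟩, ⟨h2.1, h2.2.le⟩⟩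

lemma singularIntegral_eq (hab : ∀ j, (a j, b j) ≠ (0, 0)) (hq : 15 ≤ q0 a b) :
    singularIntegral a b = ∫ x, integralProd a b x :=
  (tendsto_truncSingularIntegral hab hq).limUnder_eq

end SingularIntegral

/-! ### Integrals over boxes and squares -/

lemma setIntegral_box_periodic {H : ℝ × ℝ → ℂ} (h1 : ∀ x y, H (x + 1, y) = H (x, y))
    (h2 : ∀ x y, H (x, y + 1) = H (x, y))
    (hint : ∀ c d : ℝ, IntegrableOn H (Set.Ioc c d ×ˢ Set.Ioc c d)) (t : ℝ) :
    ∫ z in Set.Ioc 0 1 ×ˢ Set.Ioc 0 1, H z =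
      ∫ z in Set.Ioc t (t + 1) ×ˢ Set.Ioc t (t + 1), H z := by
  have h01 := hint 0 1
  have htt := hint t (t + 1)
  rw [Measure.volume_eq_prod] at h01 htt ⊢
  rw [setIntegral_prod _ h01, setIntegral_prod _ htt]
  have hinner : ∀ x, ∫ y in Set.Ioc (0 : ℝ) 1, H (x, y) = ∫ y in Set.Ioc t (t + 1), H (x, y) := by
    intro x
    have hp : Function.Periodic (fun y => H (x, y)) 1 := fun y => h2 x y
    have := hp.intervalIntegral_add_eq 0 t
    rwa [zero_add, intervalIntegral.integral_of_le zero_le_one,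
      intervalIntegral.integral_of_le (by linarith)] at this
  simp only [hinner]
  have hp : Function.Periodic (fun x => ∫ y in Set.Ioc t (t + 1), H (x, y)) 1 := by
    intro x
    simp only [h1]
  have := hp.intervalIntegral_add_eq 0 t
  rwa [zero_add, intervalIntegral.integral_of_le zero_le_one,
    intervalIntegral.integral_of_le (by linarith)] at this

lemma setIntegral_closedBall_translate (f : ℝ × ℝ → ℂ) (c : ℝ × ℝ) (r : ℝ) :
    ∫ x in Metric.closedBall c r, f x = ∫ x in Metric.closedBall 0 r, f (c + x) := by
  have h := (measurePreserving_add_left (volume : Measure (ℝ × ℝ)) c).setIntegral_preimage_emb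
    (measurableEmbedding_addLeft c) f (Metric.closedBall c r)
  rw [← h]
  congr 2
  ext x
  simp [Metric.mem_closedBall, dist_eq_norm]

lemma setIntegral_closedBall_scale (f : ℝ × ℝ → ℂ) {r X : ℝ} (hr : 0 < r) :
    ∫ x in Metric.closedBall 0 X, f (r • x) =
      ((r ^ 2)⁻¹ : ℝ) • ∫ x in Metric.closedBall 0 (r * X), f x := by
  rw [Measure.setIntegral_comp_smul_of_pos _ _ _ hr, smul_closedBall' hr.ne', Module.finrank_prod,
    Module.finrank_self, smul_zero, Real.norm_eq_abs, abs_of_pos hr]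

lemma integral_scaled_translate {r : ℝ} (hr : 0 < r) (c : ℝ × ℝ) (f : ℝ → ℝ) :
    ∫ x : ℝ × ℝ, f (r * ‖x - c‖) = (r ^ 2)⁻¹ * ∫ x : ℝ × ℝ, f ‖x‖ := by
  rw [integral_sub_right_eq_self (fun x : ℝ × ℝ => f (r * ‖x‖)) c]
  have h := Measure.integral_comp_smul (volume : Measure (ℝ × ℝ)) (fun x : ℝ × ℝ => f ‖x‖) r
  rw [Module.finrank_prod, Module.finrank_self, abs_of_pos (by positivity)] at h
  simp only [norm_smul, Real.norm_eq_abs, abs_of_pos hr, smul_eq_mul] at h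
  exact h

lemma integrable_scaled_translate {r : ℝ} (hr : 0 < r) (c : ℝ × ℝ) {t : ℝ} (ht : 2 < t) :
    Integrable fun x : ℝ × ℝ => (1 + r * ‖x - c‖) ^ (-t) := by
  have h := ((integrable_one_add_norm_rpow ht).comp_smul hr.ne').comp_sub_right c
  simpa only [norm_smul, Real.norm_eq_abs, abs_of_pos hr] using h

/-! ### The arcs -/

/-- The centre `(u/q, v/q)`. -/
noncomputable def arcCentre (q : ℕ) (u v : ℤ) : ℝ × ℝ := ((u : ℝ) / q, (v : ℝ) / q)

lemma mem_closedBall_arcCentre {q : ℕ} {u v : ℤ} {r : ℝ} {x : ℝ × ℝ} :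
    x ∈ Metric.closedBall (arcCentre q u v) r ↔ |x.1 - u / q| ≤ r ∧ |x.2 - v / q| ≤ r := by
  rw [mem_closedBall_iff_norm, Prod.norm_def, max_le_iff]
  rfl

lemma abs_mul_sub_le_iff {q : ℕ} (hq : 0 < q) {P x : ℝ} (hP : 0 < P) (u : ℤ) :
    |q * x - u| ≤ P ^ (-3 : ℤ) ↔ |x - u / q| ≤ 1 / (q * P ^ 3) := by
  have hq0 : (0 : ℝ) < q := by exact_mod_cast hq
  have h1 : (q : ℝ) * x - u = q * (x - u / q) := by field_simp
  rw [h1, abs_mul, abs_of_pos hq0, zpow_neg, le_div_iff₀ (by positivity),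
    show (P : ℝ) ^ (3 : ℤ) = P ^ 3 by norm_cast, ← one_div, le_div_iff₀ (by positivity)]
  constructor <;> intro h <;> linarith

/-- The set of points of the unit square within `r q` of a centre `(u/q, v/q)` with `q ≤ R`. -/
def arcs (R : ℝ) (r : ℕ → ℝ) : Set (ℝ × ℝ) :=
  {x | x ∈ Set.Icc (0 : ℝ) 1 ×ˢ Set.Icc (0 : ℝ) 1 ∧
    ∃ q u v : ℕ, 1 ≤ q ∧ (q : ℝ) ≤ R ∧ u ≤ q ∧ v ≤ q ∧ Nat.gcd (Nat.gcd u v) q = 1 ∧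
      x ∈ Metric.closedBall (arcCentre q u v) (r q)}

lemma measurableSet_arcs (R : ℝ) (r : ℕ → ℝ) : MeasurableSet (arcs R r) := by
  have h : arcs R r = (Set.Icc (0 : ℝ) 1 ×ˢ Set.Icc (0 : ℝ) 1) ∩
      ⋃ w : ℕ × ℕ × ℕ, ⋃ (_ : 1 ≤ w.1 ∧ (w.1 : ℝ) ≤ R ∧ w.2.1 ≤ w.1 ∧ w.2.2 ≤ w.1 ∧
        Nat.gcd (Nat.gcd w.2.1 w.2.2) w.1 = 1),
        Metric.closedBall (arcCentre w.1 w.2.1 w.2.2) (r w.1) := by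
    ext x
    simp only [arcs, Set.mem_ofPred_eq, Set.mem_inter_iff, Set.mem_iUnion, Prod.exists, exists_prop]
    constructor
    · rintro ⟨hx, q, u, v, h1, h2, h3, h4, h5, h6⟩
      exact ⟨hx, q, u, v, ⟨h1, h2, h3, h4, h5⟩, h6⟩
    · rintro ⟨hx, q, u, v, ⟨h1, h2, h3, h4, h5⟩, h6⟩
      exact ⟨hx, q, u, v, h1, h2, h3, h4, h5, h6⟩
  rw [h]
  exact (measurableSet_Icc.prod measurableSet_Icc).inter
    (MeasurableSet.iUnion fun _ => MeasurableSet.iUnion fun _ =>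
      Metric.isClosed_closedBall.measurableSet)

lemma majorArcs_eq_arcs {P : ℝ} (hP : 0 < P) :
    majorArcs P = arcs P fun q => 1 / (q * P ^ 3) := by
  ext x
  unfold majorArcs arcs
  simp only [Set.mem_ofPred_eq, mem_closedBall_arcCentre]
  refine and_congr_right fun _ => exists_congr fun q => exists_congr fun u => exists_congr fun v =>
    and_congr_right fun hq => ?_
  have h1 := abs_mul_sub_le_iff hq (x := x.1) hP u
  have h2 := abs_mul_sub_le_iff hq (x := x.2) hP v
  push_cast at h1 h2 ⊢
  rw [h1, h2]

section Periodic

variable {s : ℕ} {a b : Fin s → ℤ}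

lemma weylSum_add_int (k : ℕ) (P α : ℝ) (n : ℤ) : weylSum k P (α + n) = weylSum k P α := by
  unfold weylSum
  refine Finset.sum_congr rfl fun x _ => e_congr (n * (x : ℤ) ^ 4) ?_
  push_cast
  ring

lemma genFun_add_one_left (k : ℕ) (P α β : ℝ) :
    genFun a b k P (α + 1) β = genFun a b k P α β := by
  unfold genFun
  refine Finset.prod_congr rfl fun j _ => ?_
  rw [← weylSum_add_int k P (a j * α + b j * β) (a j)]
  congr 1
  ring

lemma genFun_add_one_right (k : ℕ) (P α β : ℝ) :
    genFun a b k P α (β + 1) = genFun a b k P α β := by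
  unfold genFun
  refine Finset.prod_congr rfl fun j _ => ?_
  rw [← weylSum_add_int k P (a j * α + b j * β) (b j)]
  congr 1
  ring

end Periodic

/-! ### The contribution of the outer part of the major arcs -/

section Outer

variable {s : ℕ} {a b : Fin s → ℤ}

lemma sum_rpow_le_tsum (S : Finset ℕ) :
    ∑ q ∈ S, (q : ℝ) ^ (-(11 / 10) : ℝ) ≤ ∑' n : ℕ, (n : ℝ) ^ (-(11 / 10) : ℝ) :=
  (Real.summable_nat_rpow.2 (by norm_num)).sum_le_tsum S fun _ _ => by positivity

/-- Off the inner arcs either `q > R` or `P⁴` times the distance to the centre exceeds `R`. Both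
give `q(1 + P⁴‖·‖) ≥ R`, as `rpow_tail_le` requires. -/
lemma norm_genFun_le_of_mem_outer {K : ℝ} (hK : 0 < K) {k : ℕ} {P R : ℝ} {q u v : ℕ}
    {x : ℝ × ℝ} (hP : 1 ≤ P) (hR : 0 < R) (hq : 0 < q)
    (h : ‖genFun a b k P (u / q + (x - arcCentre q u v).1) (v / q + (x - arcCentre q u v).2)‖ ≤
        K * P ^ s * (q * (1 + P ^ 4 * ‖x - arcCentre q u v‖)) ^ (-(18 / 5) : ℝ))
    (hx : (q : ℝ) ≤ R → R / P ^ 4 < ‖x - arcCentre q u v‖) :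
    ‖genFun a b k P x.1 x.2‖ ≤ K * P ^ s * R ^ (-(1 / 2) : ℝ) * (q : ℝ) ^ (-(31 / 10) : ℝ) *
      (1 + P ^ 4 * ‖x - arcCentre q u v‖) ^ (-(31 / 10) : ℝ) := by
  have hP0 : 0 < P := by linarith
  have hq0 : (0 : ℝ) < q := by exact_mod_cast hq
  have hq1 : (1 : ℝ) ≤ q := by exact_mod_cast hq
  have e1 : (u : ℝ) / q + (x - arcCentre q u v).1 = x.1 := by simp [arcCentre]
  have e2 : (v : ℝ) / q + (x - arcCentre q u v).2 = x.2 := by simp [arcCentre]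
  rw [e1, e2] at h
  set n := ‖x - arcCentre q u v‖
  have hn : 0 ≤ n := norm_nonneg _
  have hRle : R ≤ q * (1 + P ^ 4 * n) := by
    rcases le_or_gt (q : ℝ) R with h1 | h1
    · have h2 := hx h1
      rw [div_lt_iff₀ (by positivity)] at h2
      have h3 : 0 ≤ P ^ 4 * n := by positivity
      nlinarith
    · have h3 : 0 ≤ P ^ 4 * n := by positivity
      nlinarith
  refine h.trans ?_
  calc _ ≤ K * P ^ s * (R ^ (-(1 / 2) : ℝ) * (q * (1 + P ^ 4 * n)) ^ (-(31 / 10) : ℝ)) := by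
        gcongr
        exact rpow_tail_le hR hRle
    _ = _ := by
        rw [Real.mul_rpow hq0.le (by positivity)]; ring

/-- Wide arcs may overlap, which is harmless for an upper bound. The integrand is dominated by the
sum of the majorants of all arcs, each integrated over the whole plane; rescaling by `P⁴` in two
dimensions gives `P^{-8}`. -/
lemma exists_outer_bound (hab : ∀ j, (a j, b j) ≠ (0, 0)) (hq : 15 ≤ q0 a b) :
    ∃ K : ℝ, 0 < K ∧ ∀ (k : ℕ) (P R : ℝ), k ≤ 1 → 1 ≤ P → 0 < R →
      ‖∫ x in majorArcs P \ arcs R (fun _ => R / P ^ 4), genFun a b k P x.1 x.2‖ ≤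
        K * (P ^ s / P ^ 8) * R ^ (-(1 / 2) : ℝ) := by
  obtain ⟨K, hK, h⟩ := exists_genFun_bound hab hq
  set Z : ℝ := ∑' n : ℕ, (n : ℝ) ^ (-(11 / 10) : ℝ)
  have hZ : 0 ≤ Z := tsum_nonneg fun n => by positivity
  have hint := integrable_one_add_norm_rpow (r := 31 / 10) (by norm_num)
  set J : ℝ := ∫ x : ℝ × ℝ, (1 + ‖x‖) ^ (-(31 / 10) : ℝ)
  have hJ : 0 ≤ J := integral_nonneg fun x => by positivity
  refine ⟨K * (4 * Z * J + 1), by positivity, fun k P R hk hP hR => ?_⟩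
  have hP0 : 0 < P := by linarith
  have hP4 : 0 < P ^ 4 := by positivity
  set V := K * P ^ s * R ^ (-(1 / 2) : ℝ) with hV
  have hV0 : 0 < V := by positivity
  set G : ℕ → ℕ → ℕ → ℝ × ℝ → ℝ := fun q u v x => V * (q : ℝ) ^ (-(31 / 10) : ℝ) *
      (1 + P ^ 4 * ‖x - arcCentre q u v‖) ^ (-(31 / 10) : ℝ) with hG
  have hG0 : ∀ q u v x, 0 ≤ G q u v x := fun q u v x => by simp only [hG]; positivity
  have hGint : ∀ q u v, Integrable (G q u v) := fun q u v =>
    (integrable_scaled_translate hP4 _ (by norm_num)).const_mul _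
  have hGval : ∀ q u v, ∫ x, G q u v x = V * (q : ℝ) ^ (-(31 / 10) : ℝ) * ((P ^ 8)⁻¹ * J) := by
    intro q u v
    simp only [hG]
    rw [integral_const_mul, integral_scaled_translate hP4 _ fun y => (1 + y) ^ (-(31 / 10) : ℝ)]
    rw [← pow_mul]
  set T : ℝ × ℝ → ℝ := fun x => ∑ q ∈ Finset.Icc 1 ⌊P⌋₊, ∑ u ∈ Finset.range (q + 1),
    ∑ v ∈ Finset.range (q + 1), G q u v x with hT
  have hTint : Integrable T := integrable_finsetSum _ fun q _ => integrable_finsetSum _ fun u _ =>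
    integrable_finsetSum _ fun v _ => hGint q u v
  have hT0 : ∀ x, 0 ≤ T x := fun x => Finset.sum_nonneg fun q _ => Finset.sum_nonneg fun u _ =>
    Finset.sum_nonneg fun v _ => hG0 q u v x
  set D := majorArcs P \ arcs R (fun _ => R / P ^ 4) with hD
  have hDm : MeasurableSet D := by
    rw [hD, majorArcs_eq_arcs hP0]
    exact (measurableSet_arcs _ _).diff (measurableSet_arcs _ _)
  have hpt : ∀ x ∈ D, ‖genFun a b k P x.1 x.2‖ ≤ T x := by
    intro x hx
    rw [hD, majorArcs_eq_arcs hP0] at hx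
    obtain ⟨⟨hx01, q, u, v, hq1, hqP, huq, hvq, hgcd, hball⟩, hxc⟩ := hx
    rw [mem_closedBall_iff_norm] at hball
    have h1 := norm_genFun_le_of_mem_outer (a := a) (b := b) hK (k := k) (x := x) hP hR hq1
      (h k P q u v (x - arcCentre q u v) hk hP hq1 hqP hgcd hball) (by
        intro hqR
        by_contra hcon
        push Not at hcon
        exact hxc ⟨hx01, q, u, v, hq1, hqR, huq, hvq, hgcd, mem_closedBall_iff_norm.2 hcon⟩)
    refine h1.trans ?_
    have h2 : G q u v x ≤ ∑ v ∈ Finset.range (q + 1), G q u v x :=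
      Finset.single_le_sum (fun v _ => hG0 q u v x) (Finset.mem_range.2 (by omega))
    have h3 : ∑ v ∈ Finset.range (q + 1), G q u v x ≤
        ∑ u ∈ Finset.range (q + 1), ∑ v ∈ Finset.range (q + 1), G q u v x :=
      Finset.single_le_sum (f := fun u => ∑ v ∈ Finset.range (q + 1), G q u v x)
        (fun u _ => Finset.sum_nonneg fun v _ => hG0 q u v x) (Finset.mem_range.2 (by omega))
    have h4 : ∑ u ∈ Finset.range (q + 1), ∑ v ∈ Finset.range (q + 1), G q u v x ≤ T x :=
      Finset.single_le_sum (f := fun q => ∑ u ∈ Finset.range (q + 1),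
        ∑ v ∈ Finset.range (q + 1), G q u v x)
        (fun q _ => Finset.sum_nonneg fun u _ => Finset.sum_nonneg fun v _ => hG0 q u v x)
        (Finset.mem_Icc.2 ⟨hq1, Nat.le_floor hqP⟩)
    exact h2.trans (h3.trans h4)
  have h5 : ‖∫ x in D, genFun a b k P x.1 x.2‖ ≤ ∫ x, T x :=
    (norm_integral_le_of_norm_le hTint.integrableOn
      ((ae_restrict_iff' hDm).2 (Filter.Eventually.of_forall hpt))).trans
      (setIntegral_le_integral hTint (Filter.Eventually.of_forall hT0))
  refine h5.trans ?_
  have h6 : ∫ x, T x = ∑ q ∈ Finset.Icc 1 ⌊P⌋₊,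
      ((q : ℝ) + 1) ^ 2 * (V * (q : ℝ) ^ (-(31 / 10) : ℝ) * ((P ^ 8)⁻¹ * J)) := by
    simp only [hT]
    rw [integral_finsetSum _ fun q _ => integrable_finsetSum _ fun u _ =>
      integrable_finsetSum _ fun v _ => hGint q u v]
    refine Finset.sum_congr rfl fun q _ => ?_
    rw [integral_finsetSum _ fun u _ => integrable_finsetSum _ fun v _ => hGint q u v]
    simp_rw [integral_finsetSum _ fun v _ => hGint q _ v, hGval]
    simp only [Finset.sum_const, Finset.card_range, nsmul_eq_mul]
    push_cast
    ring
  have h7 : ∫ x, T x ≤ ∑ q ∈ Finset.Icc 1 ⌊P⌋₊,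
      (4 * V * ((P ^ 8)⁻¹ * J)) * (q : ℝ) ^ (-(11 / 10) : ℝ) := by
    rw [h6]
    refine Finset.sum_le_sum fun q hq => ?_
    have hq1 : (1 : ℝ) ≤ q := by exact_mod_cast (Finset.mem_Icc.1 hq).1
    have hq0 : (0 : ℝ) < q := by linarith
    have h8 : (q : ℝ) ^ (-(11 / 10) : ℝ) = (q : ℝ) ^ 2 * (q : ℝ) ^ (-(31 / 10) : ℝ) := by
      rw [← Real.rpow_natCast, ← Real.rpow_add hq0]; norm_num
    rw [h8]
    calc ((q : ℝ) + 1) ^ 2 * (V * (q : ℝ) ^ (-(31 / 10) : ℝ) * ((P ^ 8)⁻¹ * J))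
        ≤ (2 * (q : ℝ)) ^ 2 * (V * (q : ℝ) ^ (-(31 / 10) : ℝ) * ((P ^ 8)⁻¹ * J)) := by
          gcongr; linarith
      _ = _ := by ring
  rw [← Finset.mul_sum] at h7
  refine h7.trans ?_
  have h9 := sum_rpow_le_tsum (Finset.Icc 1 ⌊P⌋₊)
  calc _ ≤ (4 * V * ((P ^ 8)⁻¹ * J)) * Z := by gcongr
    _ = K * (4 * Z * J) * (P ^ s / P ^ 8) * R ^ (-(1 / 2) : ℝ) := by rw [hV]; ring
    _ ≤ _ := by gcongr; linarith

end Outer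

/-! ### The inner part of the major arcs -/

/-- `u`, `v` and `q` have no common factor. -/
def PrimTriple (q : ℕ) (u v : ℤ) : Prop :=
  ∀ d : ℕ, (d : ℤ) ∣ u → (d : ℤ) ∣ v → d ∣ q → d = 1

lemma primTriple_natCast {q u v : ℕ} :
    PrimTriple q u v ↔ Nat.gcd (Nat.gcd u v) q = 1 := by
  constructor
  · intro h
    refine h _ ?_ ?_ (Nat.gcd_dvd_right _ _)
    · exact_mod_cast (Nat.gcd_dvd_left _ _).trans (Nat.gcd_dvd_left _ _)
    · exact_mod_cast (Nat.gcd_dvd_left _ _).trans (Nat.gcd_dvd_right _ _)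
  · intro h d hu hv hq
    rw [Int.natCast_dvd_natCast] at hu hv
    exact Nat.eq_one_of_dvd_one (h ▸ Nat.dvd_gcd (Nat.dvd_gcd hu hv) hq)

lemma PrimTriple.add_left {q : ℕ} {u v : ℤ} (h : PrimTriple q u v) (m : ℤ) :
    PrimTriple q (u + m * q) v := fun d hu hv hq =>
  h d ((dvd_add_left (Dvd.dvd.mul_left (by exact_mod_cast hq) m)).1 hu) hv hq

lemma PrimTriple.add_right {q : ℕ} {u v : ℤ} (h : PrimTriple q u v) (m : ℤ) :
    PrimTriple q u (v + m * q) := fun d hu hv hq =>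
  h d hu ((dvd_add_left (Dvd.dvd.mul_left (by exact_mod_cast hq) m)).1 hv) hq

/-- The set of all points of the plane within `X` of a centre `(u/q, v/q)` with `q ≤ R`. -/
def planeArcs (R X : ℝ) : Set (ℝ × ℝ) :=
  {x | ∃ (q : ℕ) (u v : ℤ), 1 ≤ q ∧ (q : ℝ) ≤ R ∧ PrimTriple q u v ∧
    x ∈ Metric.closedBall (arcCentre q u v) X}

lemma measurableSet_planeArcs (R X : ℝ) : MeasurableSet (planeArcs R X) := by
  have h : planeArcs R X = ⋃ w : ℕ × ℤ × ℤ, ⋃ (_ : 1 ≤ w.1 ∧ (w.1 : ℝ) ≤ R ∧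
      PrimTriple w.1 w.2.1 w.2.2), Metric.closedBall (arcCentre w.1 w.2.1 w.2.2) X := by
    ext x
    simp only [planeArcs, Set.mem_ofPred_eq, Set.mem_iUnion, Prod.exists, exists_prop, and_assoc]
  rw [h]
  exact MeasurableSet.iUnion fun _ => MeasurableSet.iUnion fun _ =>
    Metric.isClosed_closedBall.measurableSet

lemma planeArcs_shift_left {R X x y : ℝ} (m : ℤ) (h : (x, y) ∈ planeArcs R X) :
    (x + m, y) ∈ planeArcs R X := by
  obtain ⟨q, u, v, hq, hqR, hp, hx⟩ := h
  refine ⟨q, u + m * q, v, hq, hqR, hp.add_left m, ?_⟩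
  have hq0 : (q : ℝ) ≠ 0 := by positivity
  rw [mem_closedBall_arcCentre] at hx ⊢
  have : x + m - ((u + m * q : ℤ) : ℝ) / q = x - u / q := by push_cast; field_simp; ring
  exact ⟨by rw [this]; exact hx.1, hx.2⟩

lemma planeArcs_shift_right {R X x y : ℝ} (m : ℤ) (h : (x, y) ∈ planeArcs R X) :
    (x, y + m) ∈ planeArcs R X := by
  obtain ⟨q, u, v, hq, hqR, hp, hx⟩ := h
  refine ⟨q, u, v + m * q, hq, hqR, hp.add_right m, ?_⟩
  have hq0 : (q : ℝ) ≠ 0 := by positivity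
  rw [mem_closedBall_arcCentre] at hx ⊢
  have : y + m - ((v + m * q : ℤ) : ℝ) / q = y - v / q := by push_cast; field_simp; ring
  exact ⟨hx.1, by rw [this]; exact hx.2⟩

lemma mem_planeArcs_add_one_left {R X x y : ℝ} :
    (x + 1, y) ∈ planeArcs R X ↔ (x, y) ∈ planeArcs R X := by
  constructor
  · intro h
    have := planeArcs_shift_left (-1) h
    simpa using this
  · intro h
    have := planeArcs_shift_left 1 h
    simpa using this

lemma mem_planeArcs_add_one_right {R X x y : ℝ} :
    (x, y + 1) ∈ planeArcs R X ↔ (x, y) ∈ planeArcs R X := by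
  constructor
  · intro h
    have := planeArcs_shift_right (-1) h
    simpa using this
  · intro h
    have := planeArcs_shift_right 1 h
    simpa using this

lemma numerator_bounds {q : ℕ} (hq : 1 ≤ q) {u : ℤ} {x X lo hi : ℝ} (hX : |x - u / q| ≤ X)
    (hlo : lo ≤ x) (hhi : x ≤ hi) : q * (lo - X) ≤ u ∧ (u : ℝ) ≤ q * (hi + X) := by
  have hq0 : (0 : ℝ) < q := by exact_mod_cast hq
  have h := abs_le.1 hX
  have h1 : (u : ℝ) = q * (u / q) := by field_simp
  rw [h1]
  constructor <;> apply mul_le_mul_of_nonneg_left _ hq0.le <;> linarith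

lemma arcs_eq_inter {R X : ℝ} (hR : 1 ≤ R) (hXR : 2 * X * R ^ 2 < 1) :
    arcs R (fun _ => X) = (Set.Icc (0 : ℝ) 1 ×ˢ Set.Icc (0 : ℝ) 1) ∩ planeArcs R X := by
  ext x
  constructor
  · rintro ⟨hx, q, u, v, hq, hqR, hu, hv, hg, hball⟩
    exact ⟨hx, q, u, v, hq, hqR, primTriple_natCast.2 hg, hball⟩
  · rintro ⟨hx, q, u, v, hq, hqR, hp, hball⟩
    have hq1 : (1 : ℝ) ≤ q := by exact_mod_cast hq
    have hball' := mem_closedBall_arcCentre.1 hball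
    have hqX : q * X < 1 := by
      have hX0 : 0 ≤ X := (abs_nonneg _).trans hball'.1
      nlinarith [mul_le_mul_of_nonneg_right hqR hX0]
    have key : ∀ (y : ℝ) (w : ℤ), y ∈ Set.Icc (0 : ℝ) 1 → |y - w / q| ≤ X →
        0 ≤ w ∧ w ≤ q := by
      intro y w hy hw
      have h := numerator_bounds hq hw hy.1 hy.2
      constructor
      · have : (-1 : ℝ) < w := by linarith [h.1]
        have : (-1 : ℤ) < w := by exact_mod_cast this
        omega
      · have : (w : ℝ) < q + 1 := by linarith [h.2]
        have : w < q + 1 := by exact_mod_cast this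
        omega
    obtain ⟨hu0, huq⟩ := key _ u hx.1 hball'.1
    obtain ⟨hv0, hvq⟩ := key _ v hx.2 hball'.2
    obtain ⟨u, rfl⟩ := Int.eq_ofNat_of_zero_le hu0
    obtain ⟨v, rfl⟩ := Int.eq_ofNat_of_zero_le hv0
    exact ⟨hx, q, u, v, hq, hqR, by exact_mod_cast huq, by exact_mod_cast hvq,
      primTriple_natCast.1 hp, hball⟩

/-- The index set of the centres in the half-open unit square. -/
noncomputable def arcIndex (R : ℝ) : Finset (Σ _ : ℕ, ℕ × ℕ) :=
  (Finset.Icc 1 ⌊R⌋₊).sigma fun q =>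
    (Finset.range q ×ˢ Finset.range q).filter fun w => Nat.gcd (Nat.gcd w.1 w.2) q = 1

lemma mem_arcIndex {R : ℝ} (hR : 0 ≤ R) {i : Σ _ : ℕ, ℕ × ℕ} :
    i ∈ arcIndex R ↔ 1 ≤ i.1 ∧ (i.1 : ℝ) ≤ R ∧ i.2.1 < i.1 ∧ i.2.2 < i.1 ∧
      Nat.gcd (Nat.gcd i.2.1 i.2.2) i.1 = 1 := by
  unfold arcIndex
  simp only [Finset.mem_sigma, Finset.mem_Icc, Finset.mem_filter, Finset.mem_product,
    Finset.mem_range, Nat.le_floor_iff hR]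
  tauto

/-- The unit square cuts the arcs centred on its boundary. Shifted by `1/(2R)`, it contains
completely the arcs with `0 ≤ u, v < q` and meets no others: such coordinates lie in `[0, 1 - 1/q]`
with `1/q ≥ 1/R`, and `X < 1/(2R)`. -/
lemma box_inter_planeArcs {R X : ℝ} (hR : 1 ≤ R) (hXR : 2 * X * R ^ 2 < 1) :
    (Set.Ioc (-(1 / (2 * R))) (-(1 / (2 * R)) + 1) ×ˢ Set.Ioc (-(1 / (2 * R))) (-(1 / (2 * R)) + 1))
      ∩ planeArcs R X =
    ⋃ i ∈ arcIndex R, Metric.closedBall (arcCentre i.1 (i.2.1 : ℤ) (i.2.2 : ℤ)) X := by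
  have hR0 : 0 < R := by linarith
  have hXlt : X < 1 / (2 * R) := by
    rw [lt_div_iff₀ (by positivity)]
    nlinarith
  set η := 1 / (2 * R) with hη
  have hηR : 2 * R * η = 1 := by rw [hη]; field_simp
  ext x
  simp only [Set.mem_inter_iff, Set.mem_iUnion, exists_prop]
  constructor
  · rintro ⟨hx, q, u, v, hq, hqR, hp, hball⟩
    have hq1 : (1 : ℝ) ≤ q := by exact_mod_cast hq
    have hball' := mem_closedBall_arcCentre.1 hball
    have hqη : q * η ≤ 1 / 2 := by
      have hη0 : 0 ≤ η := by positivity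
      nlinarith [mul_le_mul_of_nonneg_right hqR hη0]
    have hqX : q * X < q * η := by gcongr
    have key : ∀ (y : ℝ) (w : ℤ), y ∈ Set.Ioc (-η) (-η + 1) → |y - w / q| ≤ X →
        0 ≤ w ∧ w < q := by
      intro y w hy hw
      have h := numerator_bounds hq hw hy.1.le hy.2
      constructor
      · have : (-1 : ℝ) < w := by linarith [h.1]
        have : (-1 : ℤ) < w := by exact_mod_cast this
        omega
      · have : (w : ℝ) < q := by linarith [h.2]
        exact_mod_cast this
    obtain ⟨hu0, huq⟩ := key _ u hx.1 hball'.1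
    obtain ⟨hv0, hvq⟩ := key _ v hx.2 hball'.2
    obtain ⟨u, rfl⟩ := Int.eq_ofNat_of_zero_le hu0
    obtain ⟨v, rfl⟩ := Int.eq_ofNat_of_zero_le hv0
    exact ⟨⟨q, u, v⟩, (mem_arcIndex hR0.le).2 ⟨hq, hqR, by exact_mod_cast huq,
      by exact_mod_cast hvq, primTriple_natCast.1 hp⟩, hball⟩
  · rintro ⟨⟨q, u, v⟩, hi, hball⟩
    obtain ⟨hq, hqR, huq, hvq, hg⟩ := (mem_arcIndex hR0.le).1 hi
    simp only at hq hqR huq hvq hg hball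
    have hball' := mem_closedBall_arcCentre.1 hball
    have hq0 : (0 : ℝ) < q := by exact_mod_cast hq
    have hqinv : 2 * η ≤ 1 / q := by
      rw [le_div_iff₀ hq0]
      have hη0 : 0 ≤ η := by positivity
      nlinarith [mul_le_mul_of_nonneg_right hqR hη0]
    have key : ∀ (y : ℝ) (w : ℕ), w < q → |y - ((w : ℤ) : ℝ) / q| ≤ X →
        y ∈ Set.Ioc (-η) (-η + 1) := by
      intro y w hw hy
      have h := abs_le.1 hy
      push_cast at h
      have h0 : (0 : ℝ) ≤ (w : ℝ) / q := by positivity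
      have h1 : (w : ℝ) / q ≤ 1 - 1 / q := by
        rw [le_sub_iff_add_le, ← add_div, div_le_one hq0]
        exact_mod_cast hw
      constructor <;> linarith [h.1, h.2]
    exact ⟨⟨key _ u huq hball'.1, key _ v hvq hball'.2⟩, q, u, v, hq, hqR,
      primTriple_natCast.2 hg, hball⟩

lemma eq_of_mul_eq_mul {q u v q' u' v' : ℕ} (hg : Nat.gcd (Nat.gcd u v) q = 1) (hu : u * q' = u' * q)
    (hv : v * q' = v' * q) : q ∣ q' := by
  have h : q ∣ Nat.gcd (Nat.gcd (u * q') (v * q')) (q * q') :=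
    Nat.dvd_gcd (Nat.dvd_gcd (hu ▸ Nat.dvd_mul_left q u') (hv ▸ Nat.dvd_mul_left q v'))
      (Nat.dvd_mul_right q q')
  rwa [Nat.gcd_mul_right, Nat.gcd_mul_right, hg, one_mul] at h

/-- Distinct fractions with denominators at most `R` differ by at least `1/R² > 2X`. So a common
point makes both coordinates of the centres agree, and primitivity then forces `q = q'`. -/
lemma pairwiseDisjoint_arcs {R X : ℝ} (hR : 1 ≤ R) (hXR : 2 * X * R ^ 2 < 1) :
    (arcIndex R : Set (Σ _ : ℕ, ℕ × ℕ)).PairwiseDisjoint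
      fun i => Metric.closedBall (arcCentre i.1 (i.2.1 : ℤ) (i.2.2 : ℤ)) X := by
  rintro ⟨q, u, v⟩ hi ⟨q', u', v'⟩ hi' hne
  obtain ⟨hq, hqR, huq, hvq, hg⟩ := (mem_arcIndex (by linarith)).1 (Finset.mem_coe.1 hi)
  obtain ⟨hq', hqR', huq', hvq', hg'⟩ := (mem_arcIndex (by linarith)).1 (Finset.mem_coe.1 hi')
  simp only at hq hqR huq hvq hg hq' hqR' huq' hvq' hg'
  rw [Function.onFun, Set.disjoint_left]
  intro x hx hx'
  apply hne
  have hb := mem_closedBall_arcCentre.1 hx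
  have hb' := mem_closedBall_arcCentre.1 hx'
  simp only at hb hb'
  have hq0 : (0 : ℝ) < q := by exact_mod_cast hq
  have hq0' : (0 : ℝ) < q' := by exact_mod_cast hq'
  have key : ∀ (y : ℝ) (w w' : ℕ), |y - ((w : ℤ) : ℝ) / q| ≤ X → |y - ((w' : ℤ) : ℝ) / q'| ≤ X →
      w * q' = w' * q := by
    intro y w w' h h'
    have hX0 : 0 ≤ X := (abs_nonneg _).trans h
    push_cast at h h'
    have h1 : |(w : ℝ) / q - w' / q'| ≤ 2 * X := by
      have e1 := abs_le.1 h
      have e2 := abs_le.1 h'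
      rw [abs_le]
      constructor <;> linarith [e1.1, e1.2, e2.1, e2.2]
    have h2 : (w : ℝ) / q - w' / q' = (w * q' - w' * q) / (q * q') := by field_simp
    rw [h2, abs_div, abs_of_pos (mul_pos hq0 hq0'), div_le_iff₀ (mul_pos hq0 hq0')] at h1
    have h3 : (q : ℝ) * q' ≤ R ^ 2 := by rw [sq]; gcongr
    have h4 : |(w : ℝ) * q' - w' * q| < 1 := by
      have := mul_le_mul_of_nonneg_left h3 (by linarith : 0 ≤ 2 * X)
      linarith
    have h5 : |((w * q' : ℕ) : ℤ) - ((w' * q : ℕ) : ℤ)| < 1 := by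
      have : ((|((w * q' : ℕ) : ℤ) - ((w' * q : ℕ) : ℤ)| : ℤ) : ℝ) < 1 := by
        push_cast; exact h4
      exact_mod_cast this
    rw [Int.abs_lt_one_iff] at h5
    omega
  have hu := key _ u u' hb.1 hb'.1
  have hv := key _ v v' hb.2 hb'.2
  have hqq : q = q' := Nat.dvd_antisymm (eq_of_mul_eq_mul hg hu hv)
    (eq_of_mul_eq_mul hg' hu.symm hv.symm)
  subst hqq
  rw [Nat.eq_of_mul_eq_mul_right hq hu, Nat.eq_of_mul_eq_mul_right hq hv]

/-- The integrand restricted to `planeArcs` has period 1 in both variables, so the unit square may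
be replaced by the shifted one, where the arcs are whole and disjoint. -/
lemma setIntegral_arcs_eq_sum {F : ℝ × ℝ → ℂ} (hF : Continuous F)
    (h1 : ∀ x y, F (x + 1, y) = F (x, y)) (h2 : ∀ x y, F (x, y + 1) = F (x, y)) {R X : ℝ}
    (hR : 1 ≤ R) (hXR : 2 * X * R ^ 2 < 1) :
    ∫ x in arcs R (fun _ => X), F x = ∑ i ∈ arcIndex R,
      ∫ x in Metric.closedBall (arcCentre i.1 (i.2.1 : ℤ) (i.2.2 : ℤ)) X, F x := by
  have hN := measurableSet_planeArcs R X
  set H := (planeArcs R X).indicator F with hH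
  have hbox : ∀ c d : ℝ, IntegrableOn F (Set.Ioc c d ×ˢ Set.Ioc c d) := fun c d =>
    (hF.continuousOn.integrableOn_compact (isCompact_Icc.prod isCompact_Icc :
      IsCompact (Set.Icc c d ×ˢ Set.Icc c d))).mono_set
      (Set.prod_mono Set.Ioc_subset_Icc_self Set.Ioc_subset_Icc_self)
  have hHbox : ∀ c d : ℝ, IntegrableOn H (Set.Ioc c d ×ˢ Set.Ioc c d) := fun c d =>
    (hbox c d).indicator hN
  have hH1 : ∀ x y, H (x + 1, y) = H (x, y) := by
    intro x y
    classical
    rw [hH, Set.indicator_apply, Set.indicator_apply, h1, if_congr mem_planeArcs_add_one_left rfl rfl]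
  have hH2 : ∀ x y, H (x, y + 1) = H (x, y) := by
    intro x y
    classical
    rw [hH, Set.indicator_apply, Set.indicator_apply, h2, if_congr mem_planeArcs_add_one_right rfl rfl]
  have hae : (Set.Icc (0 : ℝ) 1 ×ˢ Set.Icc (0 : ℝ) 1 : Set (ℝ × ℝ)) =ᵐ[volume]
      (Set.Ioc (0 : ℝ) 1 ×ˢ Set.Ioc (0 : ℝ) 1 : Set (ℝ × ℝ)) := by
    rw [Measure.volume_eq_prod]
    exact Measure.set_prod_ae_eq Ioc_ae_eq_Icc.symm Ioc_ae_eq_Icc.symm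
  rw [arcs_eq_inter hR hXR, ← setIntegral_indicator hN, setIntegral_congr_set hae,
    setIntegral_box_periodic hH1 hH2 hHbox (-(1 / (2 * R))), setIntegral_indicator hN,
    box_inter_planeArcs hR hXR]
  refine integral_biUnion_finset _ (fun i _ => Metric.isClosed_closedBall.measurableSet)
    (pairwiseDisjoint_arcs hR hXR) fun i _ => ?_
  exact hF.continuousOn.integrableOn_compact (isCompact_closedBall _ _)

/-! ### The main term -/

section MainTerm

variable {s : ℕ} {a b : Fin s → ℤ}

lemma measureReal_closedBall_zero {X : ℝ} (hX : 0 ≤ X) :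
    volume.real (Metric.closedBall (0 : ℝ × ℝ) X) = (2 * X) ^ 2 := by
  have h : Metric.closedBall (0 : ℝ × ℝ) X =
      Metric.closedBall (0 : ℝ) X ×ˢ Metric.closedBall (0 : ℝ) X :=
    (closedBall_prod_same (0 : ℝ) (0 : ℝ) X).symm
  rw [h, Measure.volume_eq_prod, measureReal_prod_prod, Real.volume_real_closedBall hX, sq]

lemma card_arcIndex_le {R : ℝ} (hR : 0 ≤ R) : ((arcIndex R).card : ℝ) ≤ R ^ 3 := by
  unfold arcIndex
  rw [Finset.card_sigma]
  push_cast
  have h : ∀ q ∈ Finset.Icc 1 ⌊R⌋₊, ((((Finset.range q ×ˢ Finset.range q).filter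
      fun w => Nat.gcd (Nat.gcd w.1 w.2) q = 1).card : ℕ) : ℝ) ≤ R ^ 2 := by
    intro q hq
    have hqR : (q : ℝ) ≤ R := (Nat.le_floor_iff hR).1 (Finset.mem_Icc.1 hq).2
    have h1 := Finset.card_filter_le (Finset.range q ×ˢ Finset.range q)
      (fun w => Nat.gcd (Nat.gcd w.1 w.2) q = 1)
    rw [Finset.card_product, Finset.card_range] at h1
    calc _ ≤ ((q * q : ℕ) : ℝ) := by exact_mod_cast h1
      _ ≤ R ^ 2 := by push_cast; rw [sq]; gcongr
  calc _ ≤ ∑ q ∈ Finset.Icc 1 ⌊R⌋₊, R ^ 2 := Finset.sum_le_sum h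
    _ = ⌊R⌋₊ * R ^ 2 := by simp
    _ ≤ R * R ^ 2 := by gcongr; exact Nat.floor_le hR
    _ = R ^ 3 := by ring

/-- On an inner arc `q(1 + P⁴‖x‖) ≤ 2R²`. The bound is the resulting pointwise error times the area
`(2R/P⁴)²`. -/
lemma norm_setIntegral_arc_sub_le {k : ℕ} (hk : k ≤ 1) {P R : ℝ} (hP : 1 ≤ P) (hR : 1 ≤ R)
    {q u v : ℕ} (hq : 0 < q) (hqR : (q : ℝ) ≤ R) :
    ‖(∫ x in Metric.closedBall (arcCentre q (u : ℤ) (v : ℤ)) (R / P ^ 4),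
        genFun a b k P x.1 x.2) -
      arcSum a b q u v * ((P / 2 : ℂ) ^ s * ((P ^ 8)⁻¹ : ℝ) *
        ∫ x in Metric.closedBall 0 R, integralProd a b x)‖ ≤
      400 * s * coeffSize a b * 2 ^ s * (P ^ s / P ^ 9) * R ^ 4 := by
  have hP0 : 0 < P := by linarith
  have hR0 : 0 < R := by linarith
  have hP4 : 0 < P ^ 4 := by positivity
  have hM := one_le_coeffSize (a := a) (b := b)
  have hscale := setIntegral_closedBall_scale (integralProd a b) (X := R / P ^ 4) hP4
  rw [mul_div_cancel₀ R hP4.ne', ← pow_mul] at hscale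
  have hmain : arcSum a b q u v * ((P / 2 : ℂ) ^ s * ((P ^ 8)⁻¹ : ℝ) *
      ∫ x in Metric.closedBall 0 R, integralProd a b x) =
      ∫ x in Metric.closedBall (0 : ℝ × ℝ) (R / P ^ 4),
        (P / 2 : ℂ) ^ s * arcSum a b q u v * integralProd a b (P ^ 4 * x.1, P ^ 4 * x.2) := by
    rw [integral_const_mul]
    have : ∀ x : ℝ × ℝ, integralProd a b (P ^ 4 * x.1, P ^ 4 * x.2) =
        integralProd a b (P ^ 4 • x) := fun x => rfl
    simp only [this]
    rw [hscale, Complex.real_smul]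
    ring
  have hint1 : IntegrableOn (fun x : ℝ × ℝ => genFun a b k P (u / q + x.1) (v / q + x.2))
      (Metric.closedBall 0 (R / P ^ 4)) := by
    have hc : Continuous fun x : ℝ × ℝ => genFun a b k P (u / q + x.1) (v / q + x.2) :=
      (continuous_genFun k P).comp
        (g := fun x : ℝ × ℝ => genFun a b k P x.1 x.2)
        (f := fun x : ℝ × ℝ => ((u : ℝ) / q + x.1, (v : ℝ) / q + x.2)) (by fun_prop)
    exact hc.continuousOn.integrableOn_compact (isCompact_closedBall _ _)
  have hint2 : IntegrableOn (fun x : ℝ × ℝ => (P / 2 : ℂ) ^ s * arcSum a b q u v *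
      integralProd a b (P ^ 4 * x.1, P ^ 4 * x.2)) (Metric.closedBall 0 (R / P ^ 4)) := by
    have hc : Continuous fun x : ℝ × ℝ => (P / 2 : ℂ) ^ s * arcSum a b q u v *
        integralProd a b (P ^ 4 * x.1, P ^ 4 * x.2) :=
      continuous_const.mul (continuous_integralProd.comp (by fun_prop))
    exact hc.continuousOn.integrableOn_compact (isCompact_closedBall _ _)
  have htrans : ∀ x : ℝ × ℝ, genFun a b k P (arcCentre q (u : ℤ) (v : ℤ) + x).1
      (arcCentre q (u : ℤ) (v : ℤ) + x).2 = genFun a b k P (u / q + x.1) (v / q + x.2) := by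
    intro x; simp [arcCentre]
  rw [hmain, setIntegral_closedBall_translate
    (fun x : ℝ × ℝ => genFun a b k P x.1 x.2) (arcCentre q (u : ℤ) (v : ℤ))]
  simp only [htrans]
  rw [← integral_sub hint1 hint2]
  have hbound : ∀ x ∈ Metric.closedBall (0 : ℝ × ℝ) (R / P ^ 4),
      ‖genFun a b k P (u / q + x.1) (v / q + x.2) -
        (P / 2 : ℂ) ^ s * arcSum a b q u v * integralProd a b (P ^ 4 * x.1, P ^ 4 * x.2)‖ ≤
      s * (50 * coeffSize a b * (2 * R ^ 2) / P) * (2 * P) ^ s := by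
    intro x hx
    refine (norm_genFun_sub_main_le hk hP hq x).trans ?_
    have hx' : P ^ 4 * ‖x‖ ≤ R := by
      rw [mem_closedBall_zero_iff, le_div_iff₀ hP4] at hx
      linarith
    have : q * (1 + P ^ 4 * ‖x‖) ≤ 2 * R ^ 2 := by
      calc q * (1 + P ^ 4 * ‖x‖) ≤ R * (R + R) := by gcongr
        _ = 2 * R ^ 2 := by ring
    gcongr
  refine (norm_setIntegral_le_of_norm_le_const
    (isCompact_closedBall (0 : ℝ × ℝ) (R / P ^ 4)).measure_lt_top hbound).trans (le_of_eq ?_)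
  rw [measureReal_closedBall_zero (by positivity), mul_pow 2 P s]
  field_simp
  ring

lemma sum_arcIndex_arcSum (R : ℝ) :
    ∑ i ∈ arcIndex R, arcSum a b i.1 i.2.1 i.2.2 = ∑ q ∈ Finset.Icc 1 ⌊R⌋₊, arcCoeff a b q := by
  unfold arcIndex arcCoeff
  rw [Finset.sum_sigma]

lemma norm_setIntegral_arcs_sub_le {k : ℕ} (hk : k ≤ 1) {P R : ℝ} (hP : 1 ≤ P) (hR : 1 ≤ R)
    (hXR : 2 * (R / P ^ 4) * R ^ 2 < 1) :
    ‖(∫ x in arcs R (fun _ => R / P ^ 4), genFun a b k P x.1 x.2) -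
      (∑ q ∈ Finset.Icc 1 ⌊R⌋₊, arcCoeff a b q) * ((P / 2 : ℂ) ^ s * ((P ^ 8)⁻¹ : ℝ) *
        ∫ x in Metric.closedBall 0 R, integralProd a b x)‖ ≤
      400 * s * coeffSize a b * 2 ^ s * (P ^ s / P ^ 9) * R ^ 7 := by
  have hP0 : 0 < P := by linarith
  have hR0 : 0 < R := by linarith
  have hM := one_le_coeffSize (a := a) (b := b)
  rw [setIntegral_arcs_eq_sum (F := fun x : ℝ × ℝ => genFun a b k P x.1 x.2)
    (continuous_genFun k P) (fun x y => genFun_add_one_left k P x y)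
    (fun x y => genFun_add_one_right k P x y) hR hXR,
    ← sum_arcIndex_arcSum, Finset.sum_mul, ← Finset.sum_sub_distrib]
  refine (norm_sum_le_of_le _ fun i hi => ?_).trans (b := ∑ i ∈ arcIndex R,
    400 * s * coeffSize a b * 2 ^ s * (P ^ s / P ^ 9) * R ^ 4) ?_
  · obtain ⟨h1, h2, -⟩ := (mem_arcIndex hR0.le).1 hi
    exact norm_setIntegral_arc_sub_le hk hP hR h1 h2
  · rw [Finset.sum_const, nsmul_eq_mul]
    calc _ ≤ R ^ 3 * (400 * s * coeffSize a b * 2 ^ s * (P ^ s / P ^ 9) * R ^ 4) := by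
          gcongr
          exact card_arcIndex_le hR0.le
      _ = _ := by ring

lemma exists_series_tail_bound (hab : ∀ j, (a j, b j) ≠ (0, 0)) (hq : 15 ≤ q0 a b) :
    ∃ K : ℝ, 0 < K ∧ ∀ R : ℝ, 1 ≤ R →
      ‖(∑ q ∈ Finset.Icc 1 ⌊R⌋₊, arcCoeff a b q) - (singularSeries a b : ℂ)‖ ≤
        K * R ^ (-(1 / 2) : ℝ) := by
  obtain ⟨K, hK, h⟩ := exists_arcCoeff_bound hab hq
  have hZs := Real.summable_nat_rpow.2 (by norm_num : (-(11 / 10) : ℝ) < -1)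
  set Z : ℝ := ∑' n : ℕ, (n : ℝ) ^ (-(11 / 10) : ℝ)
  have hZ : 0 ≤ Z := tsum_nonneg fun n => by positivity
  refine ⟨K * Z + 1, by positivity, fun R hR => ?_⟩
  have hR0 : 0 < R := by linarith
  set S := Finset.Icc 1 ⌊R⌋₊ with hS
  have hsum : Summable fun n => seriesCoeff a b n := (summable_seriesCoeff hab hq).of_norm
  have e1 : ∑ q ∈ S, arcCoeff a b q = ((∑ q ∈ S, seriesCoeff a b q : ℝ) : ℂ) := by
    rw [Complex.ofReal_sum]
    exact Finset.sum_congr rfl fun q hq =>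
      (seriesCoeff_eq_arcCoeff (Finset.mem_Icc.1 hq).1).symm
  rw [singularSeries_eq hab hq, e1, ← Complex.ofReal_sub, Complex.norm_real,
    ← hsum.sum_add_tsum_compl (s := S), norm_sub_rev, add_sub_cancel_left]
  have hbd : ∀ n : ((S : Set ℕ)ᶜ : Set ℕ), ‖seriesCoeff a b n‖ ≤
      K * R ^ (-(1 / 2) : ℝ) * ((n : ℕ) : ℝ) ^ (-(11 / 10) : ℝ) := by
    rintro ⟨n, hn⟩
    rcases Nat.eq_zero_or_pos n with rfl | hn0
    · simp only [ArithmeticFunction.map_zero, norm_zero]; positivity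
    · have hn0' : (0 : ℝ) < n := by exact_mod_cast hn0
      have hRn : R ≤ n := by
        by_contra! hlt
        exact hn (Finset.mem_coe.2 (Finset.mem_Icc.2 ⟨hn0, Nat.le_floor hlt.le⟩))
      have h1 := h n hn0
      rw [← seriesCoeff_eq_arcCoeff hn0, Complex.norm_real] at h1
      refine h1.trans ?_
      have h2 : (n : ℝ) ^ (-(8 / 5) : ℝ) = (n : ℝ) ^ (-(1 / 2) : ℝ) * (n : ℝ) ^ (-(11 / 10) : ℝ) := by
        rw [← Real.rpow_add hn0']; norm_num
      rw [h2, mul_assoc]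
      have h3 : (n : ℝ) ^ (-(1 / 2) : ℝ) ≤ R ^ (-(1 / 2) : ℝ) :=
        Real.rpow_le_rpow_of_nonpos hR0 hRn (by norm_num)
      gcongr
  have hbs : Summable fun n : ((S : Set ℕ)ᶜ : Set ℕ) =>
      K * R ^ (-(1 / 2) : ℝ) * ((n : ℕ) : ℝ) ^ (-(11 / 10) : ℝ) :=
    (hZs.subtype _).mul_left _
  refine (tsum_of_norm_bounded hbs.hasSum hbd).trans ?_
  rw [tsum_mul_left]
  have hsub : ∑' n : ((S : Set ℕ)ᶜ : Set ℕ), ((n : ℕ) : ℝ) ^ (-(11 / 10) : ℝ) ≤ Z :=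
    Summable.tsum_subtype_le (fun n : ℕ => (n : ℝ) ^ (-(11 / 10) : ℝ)) _
      (fun n => by positivity) hZs
  have hRr : 0 ≤ R ^ (-(1 / 2) : ℝ) := by positivity
  calc _ ≤ K * R ^ (-(1 / 2) : ℝ) * Z := by gcongr
    _ ≤ _ := by nlinarith

end MainTerm

/-! ### The asymptotic formula on the major arcs -/

section Asymptotic

variable {s : ℕ} {a b : Fin s → ℤ}

/-- `qR ≤ R² ≤ P` gives `R/P⁴ ≤ 1/(qP³)`. -/
lemma arcs_subset_majorArcs {P R : ℝ} (hP : 1 ≤ P) (hR : 1 ≤ R) (hRP : R ^ 2 ≤ P) :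
    arcs R (fun _ => R / P ^ 4) ⊆ majorArcs P := by
  have hP0 : 0 < P := by linarith
  rw [majorArcs_eq_arcs hP0]
  rintro x ⟨hx, q, u, v, hq, hqR, hu, hv, hg, hball⟩
  have hq0 : (0 : ℝ) < q := by exact_mod_cast hq
  refine ⟨hx, q, u, v, hq, by nlinarith, hu, hv, hg, Metric.closedBall_subset_closedBall ?_ hball⟩
  rw [div_le_div_iff₀ (by positivity) (by positivity)]
  have h1 : R * q ≤ P := by nlinarith
  calc R * (q * P ^ 3) = (R * q) * P ^ 3 := by ring
    _ ≤ P * P ^ 3 := by gcongr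
    _ = 1 * P ^ 4 := by ring

lemma setIntegral_majorArcs_eq (k : ℕ) {P R : ℝ} (hP : 1 ≤ P) (hR : 1 ≤ R) (hRP : R ^ 2 ≤ P) :
    ∫ x in majorArcs P, genFun a b k P x.1 x.2 =
      (∫ x in arcs R (fun _ => R / P ^ 4), genFun a b k P x.1 x.2) +
        ∫ x in majorArcs P \ arcs R (fun _ => R / P ^ 4), genFun a b k P x.1 x.2 := by
  have hint : IntegrableOn (fun x : ℝ × ℝ => genFun a b k P x.1 x.2) (majorArcs P) :=
    ((continuous_genFun k P).continuousOn.integrableOn_compact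
      (isCompact_Icc.prod isCompact_Icc :
        IsCompact (Set.Icc (0 : ℝ) 1 ×ˢ Set.Icc (0 : ℝ) 1))).mono_set fun x hx => hx.1
  rw [← integral_inter_add_sdiff (measurableSet_arcs R fun _ => R / P ^ 4) hint,
    Set.inter_eq_right.2 (arcs_subset_majorArcs hP hR hRP)]

lemma exists_main_term_bound (hab : ∀ j, (a j, b j) ≠ (0, 0)) (hq : 15 ≤ q0 a b) :
    ∃ K : ℝ, 0 < K ∧ ∀ R : ℝ, 1 ≤ R →
      ‖(∑ q ∈ Finset.Icc 1 ⌊R⌋₊, arcCoeff a b q) *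
          (∫ x in Metric.closedBall 0 R, integralProd a b x) -
        singularSeries a b * singularIntegral a b‖ ≤ K * R ^ (-(1 / 2) : ℝ) := by
  obtain ⟨K₁, hK₁, h1⟩ := exists_series_tail_bound hab hq
  obtain ⟨K₂, hK₂, h2⟩ := exists_setIntegral_tail_bound hab hq
  have hint := integrable_integralProd hab hq
  set N : ℝ := ∫ x, ‖integralProd a b x‖
  have hN : 0 ≤ N := integral_nonneg fun x => norm_nonneg _
  refine ⟨K₁ * N + ‖(singularSeries a b : ℂ)‖ * K₂ + 1, by positivity, fun R hR => ?_⟩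
  have hR0 : 0 < R := by linarith
  have hI : ‖∫ x in Metric.closedBall 0 R, integralProd a b x‖ ≤ N :=
    (norm_integral_le_integral_norm _).trans
      (setIntegral_le_integral hint.norm (Eventually.of_forall fun x => norm_nonneg _))
  have h3 := h2 R (Metric.closedBall 0 R) hR0 Metric.isClosed_closedBall.measurableSet
    fun x hx => by rw [mem_closedBall_zero_iff] at hx; exact (not_le.1 hx).le
  rw [← singularIntegral_eq hab hq] at h3
  have h4 := h1 R hR
  have hRr : 0 ≤ R ^ (-(1 / 2) : ℝ) := by positivity
  set A := ∑ q ∈ Finset.Icc 1 ⌊R⌋₊, arcCoeff a b q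
  set I := ∫ x in Metric.closedBall 0 R, integralProd a b x
  calc ‖A * I - singularSeries a b * singularIntegral a b‖ =
        ‖(A - singularSeries a b) * I + singularSeries a b * (I - singularIntegral a b)‖ := by
        ring_nf
    _ ≤ ‖A - singularSeries a b‖ * ‖I‖ +
        ‖(singularSeries a b : ℂ)‖ * ‖I - singularIntegral a b‖ := by
        refine (norm_add_le _ _).trans_eq ?_
        rw [norm_mul, norm_mul]
    _ ≤ (K₁ * R ^ (-(1 / 2) : ℝ)) * N +
        ‖(singularSeries a b : ℂ)‖ * (K₂ * R ^ (-(1 / 2) : ℝ)) := by gcongr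
    _ ≤ _ := by nlinarith

lemma exists_majorArcs_bound (hab : ∀ j, (a j, b j) ≠ (0, 0)) (hq : 15 ≤ q0 a b) :
    ∃ K : ℝ, 0 < K ∧ ∀ (k : ℕ) (P R : ℝ), k ≤ 1 → 2 ≤ P → 1 ≤ R → R ^ 2 ≤ P →
      ‖(∫ x in majorArcs P, genFun a b k P x.1 x.2) -
        (P / 2 : ℂ) ^ s * ((P ^ 8)⁻¹ : ℝ) * (singularSeries a b * singularIntegral a b)‖ ≤
      K * (P ^ s / P ^ 8 * R ^ (-(1 / 2) : ℝ) + P ^ s / P ^ 9 * R ^ 7) := by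
  obtain ⟨K₁, hK₁, h1⟩ := exists_outer_bound hab hq
  obtain ⟨K₂, hK₂, h2⟩ := exists_main_term_bound hab hq
  have hM := one_le_coeffSize (a := a) (b := b)
  refine ⟨K₁ + K₂ + 400 * s * coeffSize a b * 2 ^ s, by positivity,
    fun k P R hk hP hR hRP => ?_⟩
  have hP1 : 1 ≤ P := by linarith
  have hP0 : 0 < P := by linarith
  have hR0 : 0 < R := by linarith
  -- `2R³ ≤ 2R⁴ ≤ 2P² < P⁴`; the last inequality is why `P ≥ 2` is assumed.
  have hXR : 2 * (R / P ^ 4) * R ^ 2 < 1 := by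
    have e1 : 2 * (R / P ^ 4) * R ^ 2 = 2 * R ^ 3 / P ^ 4 := by ring
    rw [e1, div_lt_one (by positivity)]
    have e2 : R ^ 3 ≤ R ^ 4 := pow_le_pow_right₀ hR (by norm_num)
    have e3 : R ^ 4 ≤ P ^ 2 := by
      calc R ^ 4 = (R ^ 2) ^ 2 := by ring
        _ ≤ P ^ 2 := by gcongr
    nlinarith [sq_nonneg P, mul_le_mul hP hP (by norm_num) hP0.le]
  have hc : ‖(P / 2 : ℂ) ^ s * ((P ^ 8)⁻¹ : ℝ)‖ ≤ P ^ s / P ^ 8 := by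
    rw [norm_mul, norm_pow, norm_div, Complex.norm_real, Complex.norm_real,
      Real.norm_of_nonneg hP0.le, Real.norm_of_nonneg (by positivity), div_eq_mul_inv (P ^ s)]
    gcongr
    rw [Complex.norm_ofNat]
    linarith
  have h3 := norm_setIntegral_arcs_sub_le (a := a) (b := b) hk hP1 hR hXR
  have h4 := h1 k P R hk hP1 hR0
  have h5 := h2 R hR
  rw [setIntegral_majorArcs_eq k hP1 hR hRP]
  have hRr : 0 ≤ R ^ (-(1 / 2) : ℝ) := by positivity
  set A := ∑ q ∈ Finset.Icc 1 ⌊R⌋₊, arcCoeff a b q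
  set I := ∫ x in Metric.closedBall 0 R, integralProd a b x
  set c := (P / 2 : ℂ) ^ s * ((P ^ 8)⁻¹ : ℝ)
  set F₁ := ∫ x in arcs R (fun _ => R / P ^ 4), genFun a b k P x.1 x.2
  set F₂ := ∫ x in majorArcs P \ arcs R (fun _ => R / P ^ 4), genFun a b k P x.1 x.2
  have hPs : 0 ≤ P ^ s / P ^ 8 := by positivity
  have hPs' : 0 ≤ P ^ s / P ^ 9 * R ^ 7 := by positivity
  calc ‖F₁ + F₂ - c * (singularSeries a b * singularIntegral a b)‖ =
        ‖(F₁ - A * (c * I)) + F₂ + c * (A * I - singularSeries a b * singularIntegral a b)‖ := by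
        ring_nf
    _ ≤ ‖F₁ - A * (c * I)‖ + ‖F₂‖ +
        ‖c‖ * ‖A * I - singularSeries a b * singularIntegral a b‖ := by
        rw [← norm_mul]; exact norm_add₃_le
    _ ≤ 400 * s * coeffSize a b * 2 ^ s * (P ^ s / P ^ 9) * R ^ 7 +
        K₁ * (P ^ s / P ^ 8) * R ^ (-(1 / 2) : ℝ) +
        P ^ s / P ^ 8 * (K₂ * R ^ (-(1 / 2) : ℝ)) := by gcongr
    _ ≤ _ := by
        have p1 : 0 ≤ (K₁ + K₂) * (P ^ s / P ^ 9 * R ^ 7) := by positivity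
        have p2 : 0 ≤ (400 * s * coeffSize a b * 2 ^ s) *
          (P ^ s / P ^ 8 * R ^ (-(1 / 2) : ℝ)) := by positivity
        linarith

lemma isBigO_majorArcs (hab : ∀ j, (a j, b j) ≠ (0, 0)) (hq : 15 ≤ q0 a b) {k : ℕ} (hk : k ≤ 1) :
    (fun P : ℝ => (∫ x in majorArcs P, genFun a b k P x.1 x.2) -
        (2 : ℂ) ^ (-(s : ℤ)) * ((P ^ ((s : ℝ) - 8) : ℝ) : ℂ) *
          (singularSeries a b : ℂ) * singularIntegral a b)
      =O[atTop] fun P : ℝ => P ^ ((s : ℝ) - 8 - 1 / 32) := by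
  obtain ⟨K, hK, h⟩ := exists_majorArcs_bound hab hq
  refine IsBigO.of_bound (K * 2) ?_
  filter_upwards [eventually_ge_atTop 2] with P hP
  have hP0 : 0 < P := by linarith
  have hP1 : 1 ≤ P := by linarith
  have hpow : P ^ ((s : ℝ) - 8) = P ^ s / P ^ 8 := by
    rw [Real.rpow_sub hP0, Real.rpow_natCast, ← Real.rpow_natCast P 8]
    norm_num
  have hc : (2 : ℂ) ^ (-(s : ℤ)) * ((P ^ ((s : ℝ) - 8) : ℝ) : ℂ) *
      (singularSeries a b : ℂ) * singularIntegral a b = (P / 2 : ℂ) ^ s * ((P ^ 8)⁻¹ : ℝ) *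
        (singularSeries a b * singularIntegral a b) := by
    rw [hpow, zpow_neg, zpow_natCast, div_pow]
    push_cast
    ring
  -- With `R = P^{1/8}` the relative errors `R^{-1/2}` and `R⁷/P` become `P^{-1/16}` and `P^{-1/8}`,
  -- both within the claimed `P^{-1/32}`.
  have hR := h k P (P ^ (1 / 8 : ℝ)) hk hP (Real.one_le_rpow hP1 (by norm_num)) (by
    rw [← Real.rpow_natCast, ← Real.rpow_mul hP0.le]
    exact (Real.rpow_le_rpow_of_exponent_le hP1 (by norm_num)).trans_eq (Real.rpow_one P))
  have hE1 : (P ^ (1 / 8 : ℝ)) ^ (-(1 / 2) : ℝ) ≤ P ^ (-(1 / 32) : ℝ) := by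
    rw [← Real.rpow_mul hP0.le]
    exact Real.rpow_le_rpow_of_exponent_le hP1 (by norm_num)
  have hE2 : (P ^ (1 / 8 : ℝ)) ^ 7 / P ≤ P ^ (-(1 / 32) : ℝ) := by
    rw [← Real.rpow_natCast, ← Real.rpow_mul hP0.le, ← Real.rpow_sub_one hP0.ne']
    exact Real.rpow_le_rpow_of_exponent_le hP1 (by norm_num)
  have hE3 : P ^ ((s : ℝ) - 8 - 1 / 32) = P ^ s / P ^ 8 * P ^ (-(1 / 32) : ℝ) := by
    rw [← hpow, ← Real.rpow_add hP0, sub_eq_add_neg]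
  rw [hc, Real.norm_of_nonneg (by positivity), hE3]
  refine hR.trans ?_
  rw [mul_assoc K 2]
  refine mul_le_mul_of_nonneg_left ?_ hK.le
  have hPs : 0 ≤ P ^ s / P ^ 8 := by positivity
  have e1 : P ^ s / P ^ 9 * (P ^ (1 / 8 : ℝ)) ^ 7 =
      P ^ s / P ^ 8 * ((P ^ (1 / 8 : ℝ)) ^ 7 / P) := by
    field_simp
  rw [e1]
  linarith [mul_le_mul_of_nonneg_left hE1 hPs, mul_le_mul_of_nonneg_left hE2 hPs]

end Asymptotic

end QuarticPairs

/-- The first three conclusions say that the limits and the (absolutely convergent) product which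
define the singular integral and the singular series exist, so that the last one, the asymptotic
formula, speaks of genuine quantities. -/
theorem mainTheorem9 (s : ℕ) (a b : Fin s → ℤ) (hab : ∀ j, (a j, b j) ≠ (0, 0))
    (hq : 15 ≤ QuarticPairs.q0 a b) (k : ℕ) (hk : k = 0 ∨ k = 1) :
    Tendsto (QuarticPairs.truncSingularIntegral a b) atTop
      (𝓝 (QuarticPairs.singularIntegral a b)) ∧
    (∀ p : ℕ, p.Prime → Tendsto (QuarticPairs.normalizedCount a b p) atTop
      (𝓝 (QuarticPairs.padicDensity a b p))) ∧
    (Summable (fun p : Nat.Primes => |QuarticPairs.padicDensity a b p - 1|) ∧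
      Multipliable (fun p : Nat.Primes => QuarticPairs.padicDensity a b p)) ∧
    (fun P : ℝ =>
        (∫ x in QuarticPairs.majorArcs P, QuarticPairs.genFun a b k P x.1 x.2)
          - (2 : ℂ) ^ (-(s : ℤ)) * ((P ^ ((s : ℝ) - 8) : ℝ) : ℂ)
            * (QuarticPairs.singularSeries a b : ℂ) * QuarticPairs.singularIntegral a b)
      =O[atTop] (fun P : ℝ => P ^ ((s : ℝ) - 8 - 1 / 32)) := by
  refine ⟨?_, fun p hp => ?_, ⟨?_, ?_⟩, ?_⟩
  · rw [QuarticPairs.singularIntegral_eq hab hq]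
    exact QuarticPairs.tendsto_truncSingularIntegral hab hq
  · rw [QuarticPairs.padicDensity_eq hab hq hp]
    exact QuarticPairs.tendsto_normalizedCount hab hq hp
  · exact QuarticPairs.summable_abs_padicDensity_sub_one hab hq
  · exact (QuarticPairs.hasProd_padicDensity hab hq).multipliable
  · exact QuarticPairs.isBigO_majorArcs hab hq (by omega)
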